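/- Let $R$ be a commutative ring. A spindle is a set $X$ with a binary operation $\star$ such that $x\star x=x$ and $(x\star y)\star z=(x\star z)\star(y\star z)$ for all $x,y,z\in X$; a spindle homomorphism is a map preserving $\star$. An $X$-module is an $R$-module $M$ with a map $M\times X\to M$, $(m,x)\mapsto m\star x$, that is $R$-linear in $m$ and satisfies $(m\star x)\star y=(m\star y)\star(x\star y)$ (the maps $m\mapsto m\star x$ need not be invertible). If $\varphi\colon X\to X'$ is a spindle homomorphism and $M$ is an $X'$-module, $M^\varphi$ denotes $M$ with the $X$-module structure $m\star x:=m\star\varphi(x)$. For an $X$-module $M$ and $n\ge 0$ put $C_n(M;X)=M\otimes_R R\langle X^{n+1}\rangle$, where $R\langle X^{n+1}\rangle$ is the free $R$-module on the sequences $(x_n,\dots,x_0)\in X^{n+1}$. For $n\ge 1$ the rack differential $\partial^R\colon C_n(M;X)\to C_{n-1}(M;X)$ is $$\partial^R\big(m\otimes(x_n,\dots,x_0)\big)=\sum_{i=0}^n(-1)^{n-i}\Big(m\otimes(x_n,\dots,x_{i+1},x_{i-1},\dots,x_0)-(m\star x_i)\otimes(x_n\star x_i,\dots,x_{i+1}\star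 x_i,x_{i-1},\dots,x_0)\Big),$$ and $\partial^R=0$ on $C_0(M;X)$. Let $CD(M;X)\subset C(M;X)$ be the subcomplex with $CD_n(M;X)$ generated by the elements $m\otimes(x_n,\dots,x_0)$ such that $x_i=x_{i+1}$ for some $0\le i<n$, and let $CN(M;X)=C(M;X)/CD(M;X)$. Their homology groups are the degenerate rack homology $HD_n(M;X,\partial^R)$ and the normalized rack homology $HN_n(M;X,\partial^R)$. For $M=R$ with the trivial action $m\star x=m$ write $HN_n(X,\partial^R)=HN_n(R;X,\partial^R)$. A spindle homomorphism $\varphi$ induces maps $\varphi_*$ on these groups through $m\otimes(x_n,\dots,x_0)\mapsto m\otimes(\varphi(x_n),\dots,\varphi(x_0))$. **Corollary 7.2.** Let $\varphi\colon X\to X'$ be a spindle homomorphism such that $\varphi_*\colon HN_n(X,\partial^R)\to HN_n(X',\partial^R)$ is an isomorphism for every $n\ge 0$, and let $M$ be an $X'$-module such that $\varphi_*\colon HN_n(M^\varphi;X,\partial^R)\to HN_n(M;X',\partial^R)$ is an isomorphism for every $n\ge 0$. Then $\varphi_*\colon HD_n(M^\varphi;X,\partial^R)\to HD_n(M;X',\partial^R)$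 is an isomorphism for every $n\ge 0$. -/

import Mathlib

open CategoryTheory

universe u

namespace RackHomology

/-- A spindle: a set with a binary operation `op x y` (written `x ⋆ y` on paper) that is idempotent
and self-distributive from the right. -/
class Spindle (X : Type u) where
  op : X → X → X
  idem : ∀ x : X, op x x = x
  distrib : ∀ x y z : X, op (op x y) z = op (op x z) (op y z)

/-- A homomorphism of spindles. -/
structure SpindleHom (X X' : Type u) [Spindle X] [Spindle X'] where
  toFun : X → X'
  map_op : ∀ x y : X, toFun (Spindle.op x y) = Spindle.op (toFun x) (toFun y)

/-- An action of the spindle `X` on the `R`-module `M`: `act x m` is the element `m ⋆ x`, which is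
linear in `m` and satisfies `(m ⋆ x) ⋆ y = (m ⋆ y) ⋆ (x ⋆ y)`. -/
structure Action (R : Type u) [CommRing R] (X : Type u) [Spindle X]
    (M : Type u) [AddCommGroup M] [Module R M] where
  act : X → M →ₗ[R] M
  act_act : ∀ (m : M) (x y : X), act y (act x m) = act (Spindle.op x y) (act y m)

/-- The trivial action `m ⋆ x = m` of a spindle on the ground ring `R`. -/
def Action.trivial (R : Type u) [CommRing R] (X : Type u) [Spindle X] : Action R X R where
  act _ := LinearMap.id
  act_act _ _ _ := rfl

/-- The action `m ⋆ x := m ⋆ φ x` of `X` obtained from an action of `X'` through a spindle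
homomorphism `φ : X → X'`; the module `M` with this action is `M^φ`. -/
def Action.comap {R : Type u} [CommRing R] {X X' : Type u} [Spindle X] [Spindle X']
    {M : Type u} [AddCommGroup M] [Module R M] (A : Action R X' M) (φ : SpindleHom X X') :
    Action R X M where
  act x := A.act (φ.toFun x)
  act_act m x y := by rw [A.act_act, φ.map_op]

/-! ### Chains

A sequence `(x_n, …, x_0)` is a function `x : Fin (n + 1) → X`, with `x i` the entry `x_i`. -/

/-- `C_n(M; X) = M ⊗ R⟨X^{n+1}⟩`, realized as the direct sum of copies of `M` indexed by
`X^{n+1}`; the element `Finsupp.single x m` is `m ⊗ x`. For `M = R` this is the free `R`-module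
on `X^{n+1}`. -/
noncomputable abbrev Chain (X M : Type u) [AddCommGroup M] (n : ℕ) : Type u := (Fin (n + 1) → X) →₀ M

/-- The face `(x_{n+1} ⋆ x_i, …, x_{i+1} ⋆ x_i, x_{i-1}, …, x_0)` of a sequence. -/
def starFace {X : Type u} [Spindle X] {n : ℕ} (i : Fin (n + 2)) (x : Fin (n + 2) → X) :
    Fin (n + 1) → X :=
  fun j => if j.castSucc < i then x j.castSucc else Spindle.op (x j.succ) (x i)

/-- The face `(x_{n+1}, …, x_{i+1}, x_{i-1}, …, x_0)` of a sequence, which is the face for the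
trivial operation `x ▷ y = x`. -/
def trivFace {X : Type u} {n : ℕ} (i : Fin (n + 2)) (x : Fin (n + 2) → X) : Fin (n + 1) → X :=
  fun j => if j.castSucc < i then x j.castSucc else x j.succ

section

variable {R : Type u} [CommRing R] {X : Type u} [Spindle X] {M : Type u} [AddCommGroup M]
  [Module R M]

/-- The face map `m ⊗ x ↦ (m ⋆ x_i) ⊗ d_i^⋆ x`. -/
noncomputable def dStar (A : Action R X M) (n : ℕ) (i : Fin (n + 2)) :
    Chain X M (n + 1) →ₗ[R] Chain X M n :=
  Finsupp.lsum R fun x => Finsupp.lsingle (starFace i x) ∘ₗ A.act (x i)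

/-- The face map `m ⊗ x ↦ m ⊗ d_i^▷ x` for the trivial operation `▷` (acting trivially
on `M`). -/
noncomputable def dTriv (R X M : Type u) [CommRing R] [AddCommGroup M] [Module R M] (n : ℕ)
    (i : Fin (n + 2)) : Chain X M (n + 1) →ₗ[R] Chain X M n :=
  Finsupp.lsum R fun x => Finsupp.lsingle (trivFace i x)

/-- The rack differential `∂^R = ∂^▷ - ∂^⋆ : C_{n+1}(M; X) → C_n(M; X)`, where
`∂ = ∑_{i=0}^{n+1} (-1)^{n+1-i} d_i` for each of the two operations. -/
noncomputable def rackD (A : Action R X M) (n : ℕ) : Chain X M (n + 1) →ₗ[R] Chain X M n :=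
  (∑ i : Fin (n + 2), (-1 : ℤ) ^ (n + 1 - (i : ℕ)) • dTriv R X M n i) -
    ∑ i : Fin (n + 2), (-1 : ℤ) ^ (n + 1 - (i : ℕ)) • dStar A n i

end

/-- A sequence is degenerate if `x_i = x_{i+1}` for some `i`. -/
def IsDegenerate {X : Type u} {n : ℕ} (x : Fin (n + 1) → X) : Prop :=
  ∃ i : Fin n, x i.castSucc = x i.succ

/-- `CD_n(M; X)`: the submodule of `C_n(M; X)` generated by all `m ⊗ x` with `x` degenerate. -/
noncomputable def degenerate (R X M : Type u) [CommRing R] [AddCommGroup M] [Module R M] (n : ℕ) :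
    Submodule R (Chain X M n) :=
  Submodule.span R {c | ∃ (m : M) (x : Fin (n + 1) → X), IsDegenerate x ∧ c = Finsupp.single x m}

section

variable {R : Type u} [CommRing R] {X : Type u} {M : Type u} [AddCommGroup M] [Module R M]

lemma dTriv_single (n : ℕ) (i : Fin (n + 2)) (x : Fin (n + 2) → X) (m : M) :
    dTriv R X M n i (Finsupp.single x m) = Finsupp.single (trivFace i x) m := by
  simp [dTriv]

lemma single_mem_degenerate {n : ℕ} {x : Fin (n + 1) → X} (h : IsDegenerate x) (m : M) :
    Finsupp.single x m ∈ degenerate R X M n :=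
  Submodule.subset_span ⟨m, x, h, rfl⟩

lemma isDegenerate_trivFace {n : ℕ} {x : Fin (n + 2) → X} {p : Fin (n + 1)}
    (h : x p.castSucc = x p.succ) {i : Fin (n + 2)} (h1 : i ≠ p.castSucc) (h2 : i ≠ p.succ) :
    IsDegenerate (trivFace i x) := by
  simp only [ne_eq, Fin.ext_iff, Fin.val_castSucc, Fin.val_succ] at h1 h2
  have hi := i.2
  have hp := p.2
  by_cases hlt : (i : ℕ) < p
  · refine ⟨⟨(p : ℕ) - 1, by omega⟩, ?_⟩
    have a1 : ¬ ((p : ℕ) - 1 < i) := by omega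
    have a2 : ¬ ((p : ℕ) - 1 + 1 < i) := by omega
    simp only [trivFace, Fin.lt_def, Fin.val_castSucc, Fin.val_succ, a1, a2, if_false]
    convert h using 2 <;> simp [Fin.ext_iff] <;> omega
  · refine ⟨⟨(p : ℕ), by omega⟩, ?_⟩
    have a1 : ((p : ℕ) < i) := by omega
    have a2 : ((p : ℕ) + 1 < i) := by omega
    simp only [trivFace, Fin.lt_def, Fin.val_castSucc, Fin.val_succ, a1, a2, if_true]
    exact h

end

section Lemmas

variable {R : Type u} [CommRing R] {X X' : Type u} [Spindle X] [Spindle X'] {M : Type u}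
  [AddCommGroup M] [Module R M]

/-- The combination of the two `i`-th faces that appears in the rack differential. -/
noncomputable def rackFace (A : Action R X M) (n : ℕ) (i : Fin (n + 2)) :
    Chain X M (n + 1) →ₗ[R] Chain X M n :=
  dTriv R X M n i - dStar A n i

lemma dStar_single (A : Action R X M) (n : ℕ) (i : Fin (n + 2)) (x : Fin (n + 2) → X) (m : M) :
    dStar A n i (Finsupp.single x m) = Finsupp.single (starFace i x) (A.act (x i) m) := by
  simp [dStar]

lemma rackD_eq (A : Action R X M) (n : ℕ) :
    rackD A n = ∑ i : Fin (n + 2), (-1 : ℤ) ^ (n + 1 - (i : ℕ)) • rackFace A n i := by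
  simp [rackD, rackFace, smul_sub, Finset.sum_sub_distrib]

/-- The presimplicial identity. -/
lemma rackFace_comp (A : Action R X M) (n : ℕ) (i : Fin (n + 2)) (j : Fin (n + 2)) (h : i ≤ j) :
    rackFace A n i ∘ₗ rackFace A (n + 1) j.succ =
      rackFace A n j ∘ₗ rackFace A (n + 1) i.castSucc := by
  have hi : i.castSucc < j.succ := by
    simp only [Fin.lt_def, Fin.le_def, Fin.val_castSucc, Fin.val_succ] at *; omega
  have hj : ¬ j.castSucc < i.castSucc := by
    simp only [Fin.lt_def, Fin.le_def, Fin.val_castSucc] at *; omega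
  refine Finsupp.lhom_ext fun x m => ?_
  have e1 : trivFace i (trivFace j.succ x) = trivFace j (trivFace i.castSucc x) := by
    funext k
    simp only [trivFace, Fin.lt_def, Fin.le_def, Fin.val_castSucc, Fin.val_succ] at *
    split_ifs <;> first | rfl | (exfalso; omega)
  have e2 : trivFace i (starFace j.succ x) = starFace j (trivFace i.castSucc x) := by
    funext k
    simp only [trivFace, starFace, Fin.lt_def, Fin.le_def, Fin.val_castSucc, Fin.val_succ] at *
    split_ifs <;> first | rfl | (exfalso; omega)
  have e3 : starFace i (trivFace j.succ x) = trivFace j (starFace i.castSucc x) := by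
    funext k
    simp only [trivFace, starFace, Fin.lt_def, Fin.le_def, Fin.val_castSucc, Fin.val_succ] at *
    split_ifs <;> first | rfl | (exfalso; omega)
  have e4 : starFace i (starFace j.succ x) = starFace j (starFace i.castSucc x) := by
    funext k
    simp only [starFace, Fin.lt_def, Fin.le_def, Fin.val_castSucc, Fin.val_succ] at *
    split_ifs <;> first | rfl | (exfalso; omega) | exact Spindle.distrib _ _ _
  have f1 : trivFace j.succ x i = x i.castSucc := by simp [trivFace, hi]
  have f2 : starFace j.succ x i = x i.castSucc := by simp [starFace, hi]
  have f3 : trivFace i.castSucc x j = x j.succ := by simp [trivFace, hj]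
  have f4 : starFace i.castSucc x j = Spindle.op (x j.succ) (x i.castSucc) := by
    simp [starFace, hj]
  simp only [rackFace, LinearMap.comp_apply, LinearMap.sub_apply, dStar_single, dTriv_single,
    map_sub, e1, e2, e3, e4, f1, f2, f3, f4,
    A.act_act m (x j.succ) (x i.castSucc)]
  abel

lemma rackD_comp (A : Action R X M) (n : ℕ) : rackD A n ∘ₗ rackD A (n + 1) = 0 := by
  have h : ∀ (i : Fin (n + 2)) (j : Fin (n + 3)),
      ((-1 : ℤ) ^ (n + 1 - (i : ℕ))) * ((-1 : ℤ) ^ (n + 1 + 1 - (j : ℕ))) =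
        -(-1) ^ ((i : ℕ) + (j : ℕ)) := by
    intro i j
    have h1 : (-1 : ℤ) ^ (n + 1 - (i : ℕ)) = (-1) ^ (n + 1) * (-1) ^ (i : ℕ) := by
      rw [← pow_add]; apply neg_one_pow_congr
      have := i.2; simp only [Nat.even_iff]; omega
    have h2 : (-1 : ℤ) ^ (n + 1 + 1 - (j : ℕ)) = -(-1) ^ (n + 1) * (-1) ^ (j : ℕ) := by
      have h3 : (-1 : ℤ) ^ (n + 1 + 1 - (j : ℕ)) = (-1) ^ (n + 1 + 1) * (-1) ^ (j : ℕ) := by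
        rw [← pow_add]; apply neg_one_pow_congr
        have := j.2; simp only [Nat.even_iff]; omega
      rw [h3, pow_succ (-1 : ℤ) (n + 1)]; ring
    rw [h1, h2, pow_add]
    have : (-1 : ℤ) ^ (n + 1) * (-1) ^ (n + 1) = 1 := by rw [← mul_pow]; simp
    linear_combination (-(-1 : ℤ) ^ (i : ℕ) * (-1) ^ (j : ℕ)) * this
  have key : rackD A n ∘ₗ rackD A (n + 1) =
      -∑ p : Fin (n + 2) × Fin (n + 3), (-1 : ℤ) ^ ((p.1 : ℕ) + (p.2 : ℕ)) •
        (rackFace A n p.1 ∘ₗ rackFace A (n + 1) p.2) := by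
    refine LinearMap.ext fun c => ?_
    simp only [rackD_eq, LinearMap.comp_apply, LinearMap.sum_apply, LinearMap.smul_apply, map_sum,
      map_zsmul, Fintype.sum_prod_type, Finset.smul_sum, smul_smul,
      ← Finset.sum_neg_distrib, ← neg_smul]
    rw [Finset.sum_comm]
    refine Finset.sum_congr rfl fun i _ => Finset.sum_congr rfl fun j _ => ?_
    first | rw [h] | rw [mul_comm, h]
  rw [key, neg_eq_zero]
  refine Finset.sum_involution
    (fun p _ => if hp : (p.2 : ℕ) ≤ (p.1 : ℕ) then
      ((⟨p.2, by have := p.1.2; omega⟩ : Fin (n + 2)), p.1.succ)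
      else (⟨(p.2 : ℕ) - 1, by have := p.2.2; omega⟩, p.1.castSucc)) ?_ ?_ ?_ ?_
  · rintro ⟨i, j⟩ -
    by_cases hp : (j : ℕ) ≤ (i : ℕ)
    · have hj : (j : ℕ) < n + 2 := by have := i.2; omega
      obtain ⟨j, rfl⟩ : ∃ j' : Fin (n + 2), j = j'.castSucc := ⟨⟨j, hj⟩, rfl⟩
      have e := rackFace_comp A n j i hp
      simp only [Fin.val_castSucc] at hp ⊢
      simp only [hp, dite_true, Fin.eta, Fin.val_succ]
      rw [e, ← add_smul]
      have : (-1 : ℤ) ^ ((i : ℕ) + j) + (-1) ^ ((j : ℕ) + (i + 1)) = 0 := by ring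
      rw [this, zero_smul]
    · have hj0 : j ≠ 0 := by rintro rfl; simp at hp
      obtain ⟨j, rfl⟩ := Fin.exists_succ_eq.mpr hj0
      have hij : i ≤ j := by
        simp only [Fin.val_succ, Fin.le_def] at *; omega
      have e := rackFace_comp A n i j hij
      simp only [Fin.val_succ] at hp ⊢
      simp only [hp, dite_false, Nat.add_sub_cancel, Fin.eta, Fin.val_castSucc]
      rw [e, ← add_smul]
      have : (-1 : ℤ) ^ ((i : ℕ) + (j + 1)) + (-1) ^ ((j : ℕ) + i) = 0 := by ring
      rw [this, zero_smul]
  · rintro ⟨i, j⟩ - -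
    by_cases hp : (j : ℕ) ≤ (i : ℕ)
    · simp only [hp, dite_true, ne_eq, Prod.mk.injEq, Fin.ext_iff, Fin.val_succ]; omega
    · simp only [hp, dite_false, ne_eq, Prod.mk.injEq, Fin.ext_iff, Fin.val_castSucc]; omega
  · simp
  · rintro ⟨i, j⟩ -
    by_cases hp : (j : ℕ) ≤ (i : ℕ)
    · have h' : ¬ ((i.succ : Fin (n + 3)) : ℕ) ≤ (j : ℕ) := by simp only [Fin.val_succ]; omega
      simp only [dif_pos hp]
      rw [dif_neg h']
      simp
    · have h' : ((i.castSucc : Fin (n + 3)) : ℕ) ≤ (j : ℕ) - 1 := by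
        simp only [Fin.val_castSucc]; omega
      simp only [dif_neg hp]
      rw [dif_pos h']
      simp only [Prod.mk.injEq, Fin.ext_iff, Fin.val_succ, Fin.val_castSucc, true_and]
      omega

lemma isDegenerate_starFace {n : ℕ} {x : Fin (n + 2) → X} {p : Fin (n + 1)}
    (h : x p.castSucc = x p.succ) {i : Fin (n + 2)} (h1 : i ≠ p.castSucc) (h2 : i ≠ p.succ) :
    IsDegenerate (starFace i x) := by
  simp only [ne_eq, Fin.ext_iff, Fin.val_castSucc, Fin.val_succ] at h1 h2
  have hi := i.2
  have hp := p.2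
  by_cases hlt : (i : ℕ) < p
  · refine ⟨⟨(p : ℕ) - 1, by omega⟩, ?_⟩
    have a1 : ¬ ((p : ℕ) - 1 < i) := by omega
    have a2 : ¬ ((p : ℕ) - 1 + 1 < i) := by omega
    simp only [starFace, Fin.lt_def, Fin.val_castSucc, Fin.val_succ, a1, a2, if_false]
    congr 1
    convert h using 2 <;> simp [Fin.ext_iff] <;> omega
  · refine ⟨⟨(p : ℕ), by omega⟩, ?_⟩
    have a1 : ((p : ℕ) < i) := by omega
    have a2 : ((p : ℕ) + 1 < i) := by omega
    simp only [starFace, Fin.lt_def, Fin.val_castSucc, Fin.val_succ, a1, a2, if_true]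
    exact h

lemma rackD_mem_degenerate (A : Action R X M) (n : ℕ) (c : Chain X M (n + 1))
    (hc : c ∈ degenerate R X M (n + 1)) : rackD A n c ∈ degenerate R X M n := by
  suffices degenerate R X M (n + 1) ≤ (degenerate R X M n).comap (rackD A n) from this hc
  refine Submodule.span_le.mpr ?_
  rintro _ ⟨m, x, ⟨p, hx⟩, rfl⟩
  rw [SetLike.mem_coe, Submodule.mem_comap, rackD_eq, LinearMap.sum_apply]
  have hne : p.castSucc ≠ p.succ := Fin.castSucc_lt_succ.ne
  have hsub : ({p.castSucc, p.succ} : Finset (Fin (n + 2))) ⊆ Finset.univ := Finset.subset_univ _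
  rw [← Finset.sum_sdiff hsub, Finset.sum_pair hne]
  refine Submodule.add_mem _ (Submodule.sum_mem _ fun i hi => ?_) ?_
  · simp only [Finset.mem_sdiff, Finset.mem_univ, true_and, Finset.mem_insert,
      Finset.mem_singleton, not_or] at hi
    rw [LinearMap.smul_apply]
    refine zsmul_mem ?_ _
    rw [rackFace, LinearMap.sub_apply, dTriv_single, dStar_single]
    exact Submodule.sub_mem _ (single_mem_degenerate (isDegenerate_trivFace hx hi.1 hi.2) _)
      (single_mem_degenerate (isDegenerate_starFace hx hi.1 hi.2) _)
  · have g1 : trivFace p.castSucc x = trivFace p.succ x := by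
      funext k
      simp only [trivFace, Fin.lt_def, Fin.val_castSucc, Fin.val_succ]
      rcases lt_trichotomy (k : ℕ) p with hk | hk | hk
      · simp [hk, Nat.lt_succ_of_lt hk]
      · obtain rfl : k = p := Fin.ext hk
        simp [hx]
      · have : ¬ (k : ℕ) < p + 1 := by omega
        simp [hk.not_gt, this]
    have g2 : starFace p.castSucc x = starFace p.succ x := by
      funext k
      simp only [starFace, Fin.lt_def, Fin.val_castSucc, Fin.val_succ]
      rcases lt_trichotomy (k : ℕ) p with hk | hk | hk
      · simp [hk, Nat.lt_succ_of_lt hk]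
      · obtain rfl : k = p := Fin.ext hk
        simp [hx, Spindle.idem]
      · have : ¬ (k : ℕ) < p + 1 := by omega
        simp [hk.not_gt, this, hx]
    have g3 : rackFace A n p.castSucc (Finsupp.single x m) =
        rackFace A n p.succ (Finsupp.single x m) := by
      simp only [rackFace, LinearMap.sub_apply, dTriv_single, dStar_single, g1, g2, hx]
    have g4 : n + 1 - (p : ℕ) = (n + 1 - ((p : ℕ) + 1)) + 1 := by have := p.2; omega
    simp only [LinearMap.smul_apply, g3, Fin.val_castSucc, Fin.val_succ]
    rw [← add_smul, g4, pow_succ]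
    simp

/-- The map `C_n(M^φ; X) → C_n(M; X')`, `m ⊗ (x_n, …, x_0) ↦ m ⊗ (φ x_n, …, φ x_0)`. -/
noncomputable def mapChain (R M : Type u) [CommRing R] [AddCommGroup M] [Module R M]
    (φ : SpindleHom X X') (n : ℕ) : Chain X M n →ₗ[R] Chain X' M n :=
  Finsupp.lmapDomain M R fun x => φ.toFun ∘ x

lemma mapChain_rackD (A : Action R X' M) (φ : SpindleHom X X') (n : ℕ) :
    rackD A n ∘ₗ mapChain R M φ (n + 1) = mapChain R M φ n ∘ₗ rackD (A.comap φ) n := by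
  refine Finsupp.lhom_ext fun x m => ?_
  have e1 : ∀ i, trivFace i (φ.toFun ∘ x) = φ.toFun ∘ trivFace i x := by
    intro i; funext k; simp only [trivFace, Function.comp]; split_ifs <;> rfl
  have e2 : ∀ i, starFace i (φ.toFun ∘ x) = φ.toFun ∘ starFace i x := by
    intro i; funext k; simp only [starFace, Function.comp]
    split_ifs <;> simp [φ.map_op]
  have e3 : ∀ {k : ℕ} (y : Fin (k + 1) → X) (m : M),
      mapChain R M φ k (Finsupp.single y m) = Finsupp.single (φ.toFun ∘ y) m := by
    intro k y m
    simp [mapChain, Finsupp.mapDomain_single]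
  simp only [LinearMap.comp_apply, rackD_eq, rackFace, e3, LinearMap.sum_apply,
    LinearMap.smul_apply, LinearMap.sub_apply, dTriv_single, dStar_single, map_sum, map_zsmul,
    map_sub, e1, e2]
  rfl

lemma mapChain_mem_degenerate (φ : SpindleHom X X') (n : ℕ) (c : Chain X M n)
    (hc : c ∈ degenerate R X M n) : mapChain R M φ n c ∈ degenerate R X' M n := by
  suffices degenerate R X M n ≤ (degenerate R X' M n).comap (mapChain R M φ n) from this hc
  refine Submodule.span_le.mpr ?_
  rintro _ ⟨m, x, ⟨p, hx⟩, rfl⟩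
  rw [SetLike.mem_coe, Submodule.mem_comap, mapChain, Finsupp.lmapDomain_apply,
    Finsupp.mapDomain_single]
  exact single_mem_degenerate ⟨p, congrArg φ.toFun hx⟩ m

end Lemmas

section Complexes

variable {R : Type u} [CommRing R] {X X' : Type u} [Spindle X] [Spindle X'] {M : Type u}
  [AddCommGroup M] [Module R M]

/-- The degenerate rack complex `CD(M; X)`, with the differential restricted from `C(M; X)`. -/
noncomputable def CD (A : Action R X M) : ChainComplex (ModuleCat.{u} R) ℕ :=
  ChainComplex.of (fun n => ModuleCat.of R (degenerate R X M n))
    (fun n => ModuleCat.ofHom ((rackD A n).restrict (rackD_mem_degenerate A n)))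
    (fun n => by
      refine ModuleCat.hom_ext (LinearMap.ext fun c => Subtype.ext ?_)
      exact LinearMap.congr_fun (rackD_comp A n) c.1)

/-- The normalized rack complex `CN(M; X) = C(M; X) / CD(M; X)`, with the induced
differential. -/
noncomputable def CN (A : Action R X M) : ChainComplex (ModuleCat.{u} R) ℕ :=
  ChainComplex.of (fun n => ModuleCat.of R (Chain X M n ⧸ degenerate R X M n))
    (fun n => ModuleCat.ofHom (Submodule.mapQ _ _ (rackD A n) (rackD_mem_degenerate A n)))
    (fun n => by
      ext1
      refine Submodule.linearMap_qext _ (LinearMap.ext fun c => ?_)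
      have := LinearMap.congr_fun (rackD_comp A n) c
      simp only [LinearMap.comp_apply, LinearMap.zero_apply] at this
      simp [this])

/-- The chain map `CD(M^φ; X) → CD(M; X')` induced by `φ`. -/
noncomputable def mapCD (A : Action R X' M) (φ : SpindleHom X X') : CD (A.comap φ) ⟶ CD A :=
  ChainComplex.ofHom
    (fun n => ModuleCat.ofHom ((mapChain R M φ n).restrict (mapChain_mem_degenerate φ n)))
    (fun n => by
      simp only [CD, ChainComplex.of_d]
      refine ModuleCat.hom_ext (LinearMap.ext fun c => Subtype.ext ?_)
      exact LinearMap.congr_fun (mapChain_rackD A φ n) c.1)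

/-- The chain map `CN(M^φ; X) → CN(M; X')` induced by `φ`. -/
noncomputable def mapCN (A : Action R X' M) (φ : SpindleHom X X') : CN (A.comap φ) ⟶ CN A :=
  ChainComplex.ofHom
    (fun n => ModuleCat.ofHom
      (Submodule.mapQ _ _ (mapChain R M φ n) (mapChain_mem_degenerate φ n)))
    (fun n => by
      simp only [CN, ChainComplex.of_d]
      ext1
      refine Submodule.linearMap_qext _ (LinearMap.ext fun c => ?_)
      have := LinearMap.congr_fun (mapChain_rackD A φ n) c
      simp only [LinearMap.comp_apply] at this
      simp [this])

/-- The chain map `CN(X) → CN(X')` induced by `φ`, where `CN(X)` is the normalized rack complex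
with coefficients in `R`, on which spindles act trivially (the pullback of the trivial action is
the trivial action). -/
noncomputable def mapCNTrivial (R : Type u) [CommRing R] (φ : SpindleHom X X') :
    CN (Action.trivial R X) ⟶ CN (Action.trivial R X') :=
  mapCN (Action.trivial R X') φ

/-- Normalized rack homology `HN_n(M; X, ∂^R)`. -/
noncomputable abbrev HN (A : Action R X M) (n : ℕ) : ModuleCat.{u} R := (CN A).homology n

/-- Degenerate rack homology `HD_n(M; X, ∂^R)`. -/
noncomputable abbrev HD (A : Action R X M) (n : ℕ) : ModuleCat.{u} R := (CD A).homology n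

/-- `φ_* : HN_n(M^φ; X, ∂^R) → HN_n(M; X', ∂^R)`. -/
noncomputable def mapHN (A : Action R X' M) (φ : SpindleHom X X') (n : ℕ) :
    HN (A.comap φ) n ⟶ HN A n :=
  HomologicalComplex.homologyMap (mapCN A φ) n

/-- `φ_* : HN_n(X, ∂^R) → HN_n(X', ∂^R)`, over the ground ring `R`. -/
noncomputable def mapHNTrivial (R : Type u) [CommRing R] (φ : SpindleHom X X') (n : ℕ) :
    HN (Action.trivial R X) n ⟶ HN (Action.trivial R X') n :=
  HomologicalComplex.homologyMap (mapCNTrivial R φ) n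

/-- `φ_* : HD_n(M^φ; X, ∂^R) → HD_n(M; X', ∂^R)`. -/
noncomputable def mapHD (A : Action R X' M) (φ : SpindleHom X X') (n : ℕ) :
    HD (A.comap φ) n ⟶ HD A n :=
  HomologicalComplex.homologyMap (mapCD A φ) n

end Complexes

end RackHomology

/-! Let C be the rack complex on words, augmented by M in length 0 (`dC`, graded by length), with
degenerate part CD and normalized quotient CN. "φ induces an isomorphism" is expressed throughout as
exactness of a mapping cone (`ConeExact`), a notion that can be stated one degree at a time and that
behaves well under composition, transfer along isomorphisms and extensions.

The heart of the matter is that CD is, up to a shift by two, a twisted tensor product of C itself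
with the unaugmented normalized complex of X. The map `splice` sends c ⊗ (t, z_q, …, z_0) to (c, t,
t, z_q - t, z_{q-1} - z_q, …, z_0 - z_1). Its leading term exhibits a first repetition t, t, so a
triangularity argument shows that it is onto the degenerate chains and that its kernel consists of
the tensors whose word (t, z_q, …, z_0) is degenerate. It is a chain map when deletion of letters
acts on the coefficients C through the diagonal action of X. That action is homotopic to the
identity: d(c, x) + (dc, x) = c - c ⋆ x.

On the twisted tensor product φ factors in two steps. First the coefficients change from C(M^φ; X)
to C(M; X') over the fixed spindle X (`DGAct.coneExact_mapT_id`): filtering by word length leaves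
only the coefficient differential, so exactness in each layer comes from the cone on C. Then the
words change from X to X' with fixed coefficients (`DGAct.coneExact_mapT_comap`): the hypothesis on
trivial coefficients gives contractions of a free cone in any finite range, these extend to all
coefficients for the untwisted differential, and the homotopies of the action correct them for the
twisted one, up to an error that shortens words.

Hence the cone on CD in degree n + 2 is exact as soon as the cone on C is exact in degrees at most n
(`coneExact_degenerate`). Since C is an extension of CN by CD, the hypothesis on CN allows an
induction on the degree that gives exactness for C and CD simultaneously. -/

namespace RackHomology

/-! ### Operators on words that delete one letter at a time -/

section Twist

variable {R : Type u} [CommRing R] {X X' : Type u}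
  {E E' : Type u} [AddCommGroup E] [Module R E] [AddCommGroup E'] [Module R E']

/-- Prepending the letter `x` to lists. -/
noncomputable def consL (R E : Type u) {X : Type u} [CommRing R] [AddCommGroup E] [Module R E]
    (x : X) : (List X →₀ E) →ₗ[R] (List X →₀ E) :=
  Finsupp.lmapDomain E R (List.cons x)

@[simp] lemma consL_single (x : X) (z : List X) (e : E) :
    consL R E x (Finsupp.single z e) = Finsupp.single (x :: z) e := by
  simp [consL, Finsupp.mapDomain_single]

/-- The map `e ⊗ z ↦ g e ⊗ φ z`. -/
noncomputable def mapL (φ : X → X') (g : E →ₗ[R] E') : (List X →₀ E) →ₗ[R] (List X' →₀ E') :=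
  Finsupp.lsum R fun z => Finsupp.lsingle (z.map φ) ∘ₗ g

@[simp] lemma mapL_single (φ : X → X') (g : E →ₗ[R] E') (z : List X) (e : E) :
    mapL φ g (Finsupp.single z e) = Finsupp.single (z.map φ) (g e) := by
  simp [mapL]

/-- The map `e ⊗ z ↦ g e ⊗ z`. -/
noncomputable def coefL (X : Type u) (g : E →ₗ[R] E') : (List X →₀ E) →ₗ[R] (List X →₀ E') :=
  Finsupp.mapRange.linearMap g

@[simp] lemma coefL_single (g : E →ₗ[R] E') (z : List X) (e : E) :
    coefL X g (Finsupp.single z e) = Finsupp.single z (g e) := by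
  simp [coefL]

@[simp] lemma coefL_apply (g : E →ₗ[R] E') (v : List X →₀ E) (z : List X) :
    coefL X g v z = g (v z) := by
  simp [coefL]

lemma mapL_id (g : E →ₗ[R] E') : mapL (id : X → X) g = coefL X g :=
  Finsupp.lhom_ext fun z e => by simp

lemma mapL_consL (φ : X → X') (g : E →ₗ[R] E') (x : X) (v : List X →₀ E) :
    mapL φ g (consL R E x v) = consL R E' (φ x) (mapL φ g v) := by
  have : mapL φ g ∘ₗ consL R E x = consL R E' (φ x) ∘ₗ mapL φ g :=
    Finsupp.lhom_ext fun z e => by simp [consL_single]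
  exact LinearMap.congr_fun this v

/-- The sign `(-1)^{|z|}`. -/
noncomputable def signL (R E X : Type u) [CommRing R] [AddCommGroup E] [Module R E] :
    (List X →₀ E) →ₗ[R] (List X →₀ E) :=
  Finsupp.lsum R fun z => (-1 : R) ^ z.length • Finsupp.lsingle z

@[simp] lemma signL_single (z : List X) (e : E) :
    signL R E X (Finsupp.single z e) = (-1 : R) ^ z.length • Finsupp.single z e := by
  simp [signL]

lemma signL_signL (v : List X →₀ E) : signL R E X (signL R E X v) = v := by
  suffices h : signL R E X ∘ₗ signL R E X = LinearMap.id from LinearMap.congr_fun h v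
  refine Finsupp.lhom_ext fun z e => ?_
  simp [smul_smul, ← mul_pow]

lemma signL_consL (x : X) (v : List X →₀ E) :
    signL R E X (consL R E x v) = -consL R E x (signL R E X v) := by
  suffices h : signL R E X ∘ₗ consL R E x = -(consL R E x ∘ₗ signL R E X) from
    LinearMap.congr_fun h v
  refine Finsupp.lhom_ext fun z e => ?_
  simp [pow_succ]

lemma signL_mapL (φ : X → X') (g : E →ₗ[R] E') (v : List X →₀ E) :
    signL R E' X' (mapL φ g v) = mapL φ g (signL R E X v) := by
  suffices h : signL R E' X' ∘ₗ mapL φ g = mapL φ g ∘ₗ signL R E X from LinearMap.congr_fun h v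
  refine Finsupp.lhom_ext fun z e => ?_
  simp

lemma signL_coefL (g : E →ₗ[R] E') (v : List X →₀ E) :
    signL R E' X (coefL X g v) = coefL X g (signL R E X v) := by
  simpa [mapL_id] using signL_mapL (id : X → X) g v

variable [Spindle X] [Spindle X']

/-- The value on `z` of the operator `twist`. -/
noncomputable def twistOn (b β : E →ₗ[R] E) (γ : X → E →ₗ[R] E) :
    List X → E →ₗ[R] (List X →₀ E)
  | [] => Finsupp.lsingle [] ∘ₗ b
  | x :: z => Finsupp.lsingle z ∘ₗ β - Finsupp.lsingle (z.map (Spindle.op · x)) ∘ₗ γ x -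
      consL R E x ∘ₗ twistOn b β γ z

/-- The operator determined by `e ⊗ () ↦ b e ⊗ ()` and the recursion
`e ⊗ (z, x) ↦ β e ⊗ z - γ_x e ⊗ (z ⋆ x) - (twist (e ⊗ z), x)`. Lists are written with the last
letter first. -/
noncomputable def twist (b β : E →ₗ[R] E) (γ : X → E →ₗ[R] E) :
    (List X →₀ E) →ₗ[R] (List X →₀ E) :=
  Finsupp.lsum R (twistOn b β γ)

@[simp] lemma twist_nil (b β : E →ₗ[R] E) (γ : X → E →ₗ[R] E) (e : E) :
    twist b β γ (Finsupp.single [] e) = Finsupp.single [] (b e) := by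
  simp [twist, twistOn]

lemma twist_cons (b β : E →ₗ[R] E) (γ : X → E →ₗ[R] E) (x : X) (z : List X) (e : E) :
    twist b β γ (Finsupp.single (x :: z) e) =
      Finsupp.single z (β e) - Finsupp.single (z.map (Spindle.op · x)) (γ x e) -
        consL R E x (twist b β γ (Finsupp.single z e)) := by
  simp [twist, twistOn]

lemma twist_consL (b β : E →ₗ[R] E) (γ : X → E →ₗ[R] E) (x : X) (v : List X →₀ E) :
    twist b β γ (consL R E x v) =
      coefL X β v - mapL (Spindle.op · x) (γ x) v - consL R E x (twist b β γ v) := by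
  have : twist b β γ ∘ₗ consL R E x =
      coefL X β - mapL (Spindle.op · x) (γ x) - consL R E x ∘ₗ twist b β γ :=
    Finsupp.lhom_ext fun z e => by simp [twist_cons]
  exact LinearMap.congr_fun this v

/-- Besides φ, this applies to the map z ↦ z ⋆ x of words: right translation by x is a spindle
endomorphism by self-distributivity. That case drives the proof that the operator squares to zero.
-/
lemma mapL_twist {b β : E →ₗ[R] E} {γ : X → E →ₗ[R] E} {b' β' : E' →ₗ[R] E'}
    {γ' : X' → E' →ₗ[R] E'} {φ : X → X'} {g : E →ₗ[R] E'}
    (hφ : ∀ x y, φ (Spindle.op x y) = Spindle.op (φ x) (φ y))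
    (hb : ∀ e, g (b e) = b' (g e)) (hβ : ∀ e, g (β e) = β' (g e))
    (hγ : ∀ x e, g (γ x e) = γ' (φ x) (g e)) (v : List X →₀ E) :
    mapL φ g (twist b β γ v) = twist b' β' γ' (mapL φ g v) := by
  suffices h : mapL φ g ∘ₗ twist b β γ = twist b' β' γ' ∘ₗ mapL φ g from LinearMap.congr_fun h v
  refine Finsupp.lhom_ext fun z => ?_
  induction z with
  | nil => intro e; simp [hb]
  | cons x z ih =>
    intro e
    have h := ih e
    simp only [LinearMap.comp_apply, mapL_single] at h
    simp only [LinearMap.comp_apply, mapL_single, twist_cons, List.map_cons, map_sub, mapL_consL,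
      h, hβ, hγ, List.map_map]
    congr 4
    exact funext fun y => hφ y x

lemma coefL_twist {b β : E →ₗ[R] E} {γ : X → E →ₗ[R] E} {b' β' : E' →ₗ[R] E'}
    {γ' : X → E' →ₗ[R] E'} {g : E →ₗ[R] E'}
    (hb : ∀ e, g (b e) = b' (g e)) (hβ : ∀ e, g (β e) = β' (g e))
    (hγ : ∀ x e, g (γ x e) = γ' x (g e)) (v : List X →₀ E) :
    coefL X g (twist b β γ v) = twist b' β' γ' (coefL X g v) := by
  simp only [← mapL_id]
  exact mapL_twist (fun _ _ => rfl) hb hβ hγ v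

/-- On x :: z the square reduces to the commutators of the operator with β and with the translation
by x, plus x prepended to the square on z. The commutators vanish by naturality, the last term by
induction. -/
lemma twist_twist {b β : E →ₗ[R] E} {γ : X → E →ₗ[R] E} (hb : ∀ e, b (b e) = 0)
    (hbβ : ∀ e, b (β e) = β (b e)) (hbγ : ∀ x e, b (γ x e) = γ x (b e))
    (hβγ : ∀ x e, β (γ x e) = γ x (β e))
    (hγ : ∀ x y e, γ y (γ x e) = γ (Spindle.op x y) (γ y e)) (v : List X →₀ E) :
    twist b β γ (twist b β γ v) = 0 := by
  suffices h : twist b β γ ∘ₗ twist b β γ = 0 from LinearMap.congr_fun h v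
  refine Finsupp.lhom_ext fun z => ?_
  induction z with
  | nil => intro e; simp [hb]
  | cons x z ih =>
    intro e
    have h := ih e
    simp only [LinearMap.comp_apply, LinearMap.zero_apply] at h
    have h1 := coefL_twist (b := b) (β := β) (γ := γ) (g := β) (fun e => (hbβ e).symm)
      (fun e => rfl) hβγ (Finsupp.single z e)
    have h2 := mapL_twist (b := b) (β := β) (γ := γ) (φ := (Spindle.op · x)) (g := γ x)
      (fun y w => Spindle.distrib y w x) (fun e => (hbγ x e).symm) (fun e => (hβγ x e).symm)
      (fun y e => hγ y x e) (Finsupp.single z e)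
    simp only [coefL_single, mapL_single] at h1 h2
    simp only [LinearMap.comp_apply, twist_cons, map_sub, twist_consL, h, map_zero, ← h1, ← h2,
      LinearMap.zero_apply]
    abel

/-- The recursion is linear in β and γ, and acting on coefficients commutes with prepending a
letter, so no Koszul sign appears. With g a differential and β, γ homotopies, the right-hand side
measures the failure of an action to be trivial. -/
lemma coefL_twist_add {β : E →ₗ[R] E} {γ : X → E →ₗ[R] E} (g : E →ₗ[R] E) (v : List X →₀ E) :
    coefL X g (twist 0 β γ v) + twist 0 β γ (coefL X g v) =
      twist 0 (g ∘ₗ β + β ∘ₗ g) (fun x => g ∘ₗ γ x + γ x ∘ₗ g) v := by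
  suffices h : coefL X g ∘ₗ twist 0 β γ + twist 0 β γ ∘ₗ coefL X g =
    twist 0 (g ∘ₗ β + β ∘ₗ g) (fun x => g ∘ₗ γ x + γ x ∘ₗ g) from LinearMap.congr_fun h v
  refine Finsupp.lhom_ext fun z => ?_
  induction z with
  | nil => intro e; simp
  | cons x z ih =>
    intro e
    have h := ih e
    have h1 : ∀ w : List X →₀ E, coefL X g (consL R E x w) = consL R E x (coefL X g w) :=
      fun w => by simpa [mapL_id] using mapL_consL (id : X → X) g x w
    simp only [LinearMap.comp_apply, LinearMap.add_apply, coefL_single] at h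
    simp only [LinearMap.comp_apply, LinearMap.add_apply, coefL_single, twist_cons, map_sub, h1,
      ← h, map_add, Finsupp.single_add]
    abel

lemma twist_sub (b β b' β' : E →ₗ[R] E) (γ γ' : X → E →ₗ[R] E) (v : List X →₀ E) :
    twist b β γ v - twist b' β' γ' v = twist (b - b') (β - β') (γ - γ') v := by
  suffices h : twist b β γ - twist b' β' γ' = twist (b - b') (β - β') (γ - γ') from
    LinearMap.congr_fun h v
  refine Finsupp.lhom_ext fun z => ?_
  induction z with
  | nil => intro e; simp
  | cons x z ih =>
    intro e
    have h := ih e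
    simp only [LinearMap.sub_apply] at h
    simp only [LinearMap.sub_apply, twist_cons, ← h, map_sub, Finsupp.single_sub, Pi.sub_apply]
    abel

lemma signL_twist (β : E →ₗ[R] E) (γ : X → E →ₗ[R] E) (v : List X →₀ E) :
    signL R E X (twist 0 β γ v) = -twist 0 β γ (signL R E X v) := by
  suffices h : signL R E X ∘ₗ twist 0 β γ = -(twist 0 β γ ∘ₗ signL R E X) from
    LinearMap.congr_fun h v
  refine Finsupp.lhom_ext fun z => ?_
  induction z with
  | nil => intro e; simp
  | cons x z ih =>
    intro e
    have h := ih e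
    simp only [LinearMap.comp_apply, LinearMap.neg_apply, signL_single, map_smul] at h
    simp only [LinearMap.comp_apply, LinearMap.neg_apply, twist_cons, map_sub, signL_single,
      signL_consL, h, map_smul, List.length_map, List.length_cons, map_neg, smul_sub, pow_succ,
      mul_smul, neg_smul, one_smul, smul_neg]
    abel

/-- The map b enters only at the empty word, and each letter on the way there contributes one minus
sign. -/
lemma twist_eq_sign_add (b β : E →ₗ[R] E) (γ : X → E →ₗ[R] E) (v : List X →₀ E) :
    twist b β γ v = signL R E X (coefL X b v) + twist 0 β γ v := by
  suffices h : twist b β γ = signL R E X ∘ₗ coefL X b + twist 0 β γ from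
    LinearMap.congr_fun h v
  refine Finsupp.lhom_ext fun z => ?_
  induction z with
  | nil => intro e; simp
  | cons x z ih =>
    intro e
    have h := ih e
    simp only [LinearMap.comp_apply, LinearMap.add_apply] at h
    have h1 := signL_consL (R := R) x (Finsupp.single z (b e))
    simp only [LinearMap.comp_apply, LinearMap.add_apply, twist_cons, h, map_add, coefL_single,
      consL_single] at h1 ⊢
    rw [h1]
    abel

/-- The operator `twist 0 β γ` shortens lists by one letter, and its coefficients lie in any
submodule that contains the values of `β` and `γ`. -/
lemma twist_single_mem {β : E →ₗ[R] E} {γ : X → E →ₗ[R] E} (U : Submodule R E) (e : E)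
    (hβ : β e ∈ U) (hγ : ∀ x, γ x e ∈ U) (z : List X) (w : List X) :
    twist 0 β γ (Finsupp.single z e) w ∈ U ∧
      (w.length + 1 ≠ z.length → twist 0 β γ (Finsupp.single z e) w = 0) := by
  classical
  induction z generalizing w with
  | nil => simp
  | cons x z ih =>
    have hc : consL R E x (twist 0 β γ (Finsupp.single z e)) w ∈ U ∧
        (w.length + 1 ≠ (x :: z).length →
          consL R E x (twist 0 β γ (Finsupp.single z e)) w = 0) := by
      rcases w with _ | ⟨y, w⟩
      · have : consL R E x (twist 0 β γ (Finsupp.single z e)) [] = 0 :=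
          Finsupp.mapDomain_of_notMem_range _ _ (by simp)
        simp [this]
      · by_cases hy : x = y
        · subst hy
          have : consL R E x (twist 0 β γ (Finsupp.single z e)) (x :: w) =
              twist 0 β γ (Finsupp.single z e) w :=
            Finsupp.mapDomain_apply (List.cons_injective) _ _
          rw [this]
          exact ⟨(ih w).1, fun h => (ih w).2 (by simpa using h)⟩
        · have : consL R E x (twist 0 β γ (Finsupp.single z e)) (y :: w) = 0 :=
            Finsupp.mapDomain_of_notMem_range _ _ (by simp [hy])
          simp [this]
    rw [twist_cons, Finsupp.sub_apply, Finsupp.sub_apply]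
    refine ⟨U.sub_mem (U.sub_mem ?_ ?_) hc.1, fun h => ?_⟩
    · rw [Finsupp.single_apply]; split_ifs <;> simp [hβ]
    · rw [Finsupp.single_apply]; split_ifs <;> simp [hγ]
    · rw [hc.2 h, Finsupp.single_eq_of_ne, Finsupp.single_eq_of_ne]
      · simp
      · rintro rfl; simp at h
      · rintro rfl; simp at h

end Twist


/-! ### Exactness of mapping cones, degree by degree -/

section ConeExact

variable {R : Type u} [CommRing R] {V V' V'' W W' : Type u} [AddCommGroup V] [Module R V]
  [AddCommGroup V'] [Module R V'] [AddCommGroup V''] [Module R V'']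
  [AddCommGroup W] [Module R W] [AddCommGroup W'] [Module R W']

/-- Exactness in degree `n` of the mapping cone of the map `A/P → A'/P'` induced by `f`, where `A`
is a graded submodule of `V` and `A/P` carries the differential induced by `d`. -/
def ConeExact (d : V →ₗ[R] V) (d' : V' →ₗ[R] V') (f : V →ₗ[R] V') (A : ℤ → Submodule R V)
    (P : Submodule R V) (A' : ℤ → Submodule R V') (P' : Submodule R V') (n : ℤ) : Prop :=
  ∀ b ∈ A' n, ∀ a ∈ A (n - 1), d a ∈ P → d' b + f a ∈ P' →
    ∃ b' ∈ A' (n + 1), ∃ a' ∈ A n, a + d a' ∈ P ∧ b - d' b' - f a' ∈ P'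

/-- For a cycle (c, a) of the cone of g ∘ f, the pair (c, f a) is a cycle of the cone of g. A
primitive (c', b') of it makes (b', a) a cycle of the cone of f. -/
lemma ConeExact.comp {d : V →ₗ[R] V} {d' : V' →ₗ[R] V'} {d'' : V'' →ₗ[R] V''} {f : V →ₗ[R] V'}
    {g : V' →ₗ[R] V''} {A : ℤ → Submodule R V} {P : Submodule R V} {A' : ℤ → Submodule R V'}
    {P' : Submodule R V'} {A'' : ℤ → Submodule R V''} {P'' : Submodule R V''} {n : ℤ}
    (hf : ConeExact d d' f A P A' P' n) (hg : ConeExact d' d'' g A' P' A'' P'' n)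
    (hfd : ∀ v, f (d v) = d' (f v)) (hgd : ∀ v, g (d' v) = d'' (g v))
    (hfA : ∀ k, ∀ v ∈ A k, f v ∈ A' k) (hfP : ∀ v ∈ P, f v ∈ P')
    (hgA : ∀ k, ∀ v ∈ A' k, g v ∈ A'' k) (hgP : ∀ v ∈ P', g v ∈ P'') :
    ConeExact d d'' (g ∘ₗ f) A P A'' P'' n := by
  intro c hc a ha hda hdc
  obtain ⟨c', hc', b', hb', h1, h2⟩ := hg c hc (f a) (hfA _ _ ha)
    (by rw [← hfd]; exact hfP _ hda) hdc
  obtain ⟨b'', hb'', a', ha', h3, h4⟩ := hf b' hb' a ha hda (by rwa [add_comm])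
  refine ⟨c' + g b'', add_mem hc' (hgA _ _ hb''), a', ha', h3, ?_⟩
  have := P''.add_mem h2 (hgP _ h4)
  simp only [map_sub, hgd] at this
  rw [LinearMap.comp_apply, map_add]
  convert this using 1
  abel

/-- Transfer of cone exactness along maps `J` and `J'` that induce isomorphisms of graded
subquotients of degree `s`. -/
lemma ConeExact.transfer {d : V →ₗ[R] V} {d' : V' →ₗ[R] V'} {f : V →ₗ[R] V'}
    {A : ℤ → Submodule R V} {P : Submodule R V} {A' : ℤ → Submodule R V'} {P' : Submodule R V'}
    {e : W →ₗ[R] W} {e' : W' →ₗ[R] W'} {g : W →ₗ[R] W'}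
    {B : ℤ → Submodule R W} {Q : Submodule R W} {B' : ℤ → Submodule R W'} {Q' : Submodule R W'}
    {n s : ℤ} (J : V →ₗ[R] W) (J' : V' →ₗ[R] W')
    (h : ConeExact d d' f A P A' P' n)
    (hJd : ∀ v, J (d v) = e (J v)) (hJd' : ∀ v, J' (d' v) = e' (J' v))
    (hJf : ∀ v, J' (f v) = g (J v))
    (hA : ∀ k, ∀ v ∈ A k, J v ∈ B (k + s)) (hA' : ∀ k, ∀ v ∈ A' k, J' v ∈ B' (k + s))
    (hP : ∀ v, J v ∈ Q ↔ v ∈ P) (hP' : ∀ v, J' v ∈ Q' ↔ v ∈ P')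
    (hs : ∀ k, ∀ w ∈ B (k + s), ∃ v ∈ A k, J v = w)
    (hs' : ∀ k, ∀ w ∈ B' (k + s), ∃ v ∈ A' k, J' v = w) :
    ConeExact e e' g B Q B' Q' (n + s) := by
  intro b hb a ha hda hdb
  obtain ⟨b, hb₁, rfl⟩ := hs' _ _ hb
  obtain ⟨a, ha₁, rfl⟩ := hs (n - 1) a (by convert ha using 1; congr 1; ring)
  rw [← hJd, hP] at hda
  rw [← hJd', ← hJf, ← map_add, hP'] at hdb
  obtain ⟨b', hb', a', ha', h1, h2⟩ := h b hb₁ a ha₁ hda hdb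
  refine ⟨J' b', ?_, J a', hA _ _ ha', ?_, ?_⟩
  · have := hA' _ _ hb'
    rwa [show n + 1 + s = n + s + 1 by ring] at this
  · rw [← hJd, ← map_add, hP]; exact h1
  · rw [← hJd', ← hJf, ← map_sub, ← map_sub, hP']; exact h2

/-- The converse of `ConeExact.transfer`; surjectivity is only needed in two degrees. -/
lemma ConeExact.transfer_symm {d : V →ₗ[R] V} {d' : V' →ₗ[R] V'} {f : V →ₗ[R] V'}
    {A : ℤ → Submodule R V} {P : Submodule R V} {A' : ℤ → Submodule R V'} {P' : Submodule R V'}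
    {e : W →ₗ[R] W} {e' : W' →ₗ[R] W'} {g : W →ₗ[R] W'}
    {B : ℤ → Submodule R W} {Q : Submodule R W} {B' : ℤ → Submodule R W'} {Q' : Submodule R W'}
    {n s : ℤ} (J : V →ₗ[R] W) (J' : V' →ₗ[R] W')
    (h : ConeExact e e' g B Q B' Q' (n + s))
    (hJd : ∀ v, J (d v) = e (J v)) (hJd' : ∀ v, J' (d' v) = e' (J' v))
    (hJf : ∀ v, J' (f v) = g (J v))
    (hA : ∀ k, ∀ v ∈ A k, J v ∈ B (k + s)) (hA' : ∀ k, ∀ v ∈ A' k, J' v ∈ B' (k + s))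
    (hP : ∀ v, J v ∈ Q ↔ v ∈ P) (hP' : ∀ v, J' v ∈ Q' ↔ v ∈ P')
    (hs : ∀ w ∈ B (n + s), ∃ v ∈ A n, J v = w)
    (hs' : ∀ w ∈ B' (n + 1 + s), ∃ v ∈ A' (n + 1), J' v = w) :
    ConeExact d d' f A P A' P' n := by
  intro b hb a ha hda hdb
  obtain ⟨b', hb', a', ha', h1, h2⟩ := h (J' b) (hA' _ _ hb) (J a)
    (by have := hA _ _ ha; rwa [show n - 1 + s = n + s - 1 by ring] at this)
    (by rwa [← hJd, hP]) (by rwa [← hJd', ← hJf, ← map_add, hP'])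
  rw [show n + s + 1 = n + 1 + s by ring] at hb'
  obtain ⟨b', hb₁, rfl⟩ := hs' _ hb'
  obtain ⟨a', ha₁, rfl⟩ := hs _ ha'
  refine ⟨b', hb₁, a', ha₁, ?_, ?_⟩
  · rwa [← hJd, ← map_add, hP] at h1
  · rwa [← hJd', ← hJf, ← map_sub, ← map_sub, hP'] at h2

/-- The extension of a subcomplex by its quotient. -/
lemma ConeExact.extension {d : V →ₗ[R] V} {d' : V' →ₗ[R] V'} {f : V →ₗ[R] V'}
    {A : ℤ → Submodule R V} {P : Submodule R V} {A' : ℤ → Submodule R V'} {P' : Submodule R V'}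
    {n : ℤ} (hsub : ConeExact d d' f (fun k => A k ⊓ P) ⊥ (fun k => A' k ⊓ P') ⊥ n)
    (hquot : ConeExact d d' f A P A' P' n)
    (hd : ∀ k, ∀ v ∈ A k, d v ∈ A (k - 1)) (hd' : ∀ k, ∀ v ∈ A' k, d' v ∈ A' (k - 1))
    (hf : ∀ k, ∀ v ∈ A k, f v ∈ A' k) (hfd : ∀ v, f (d v) = d' (f v))
    (hdd : ∀ v, d (d v) = 0) (hdd' : ∀ v, d' (d' v) = 0) :
    ConeExact d d' f A ⊥ A' ⊥ n := by
  intro b hb a ha hda hdb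
  simp only [Submodule.mem_bot] at hda hdb
  obtain ⟨b', hb', a', ha', h1, h2⟩ := hquot b hb a ha (by simp [hda]) (by simp [hdb])
  -- Subtracting the boundary of (b', a') moves the cone cycle into the subcomplex.
  obtain ⟨b'', hb'', a'', ha'', h3, h4⟩ := hsub (b - d' b' - f a')
    ⟨sub_mem (sub_mem hb (by simpa using hd' _ _ hb')) (hf _ _ ha'), h2⟩
    (a + d a') ⟨add_mem ha (hd _ _ ha'), h1⟩ (by simp [hda, hdd])
    (by simp only [map_sub, map_add, hdd', hfd, Submodule.mem_bot, sub_zero]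
        rw [← hdb]; abel)
  refine ⟨b' + b'', add_mem hb' hb''.1, a' + a'', add_mem ha' ha''.1, ?_, ?_⟩
  · simp only [Submodule.mem_bot, map_add] at h3 ⊢
    rw [← h3]; abel
  · simp only [Submodule.mem_bot, map_add] at h4 ⊢
    rw [← h4]; abel

end ConeExact

/-! ### Degenerate words -/

/-- Lists with two equal neighbours. -/
inductive Degen {X : Type u} : List X → Prop
  | here (x : X) (l : List X) : Degen (x :: x :: l)
  | cons (x : X) {l : List X} : Degen l → Degen (x :: l)

lemma Degen.map {X X' : Type u} (φ : X → X') {l : List X} (h : Degen l) : Degen (l.map φ) := by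
  induction h with
  | here x l => exact .here _ _
  | cons x _ ih => exact .cons _ ih

lemma degen_cons_cons {X : Type u} {x y : X} {l : List X} :
    Degen (x :: y :: l) ↔ x = y ∨ Degen (y :: l) := by
  constructor
  · intro h
    cases h with
    | here => exact .inl rfl
    | cons _ h => exact .inr h
  · rintro (rfl | h)
    · exact .here _ _
    · exact .cons _ h

lemma not_degen_singleton {X : Type u} {x : X} : ¬ Degen [x] := by
  intro h
  cases h with
  | cons _ h => cases h

lemma not_degen_nil {X : Type u} : ¬ Degen ([] : List X) := nofun

/-! ### Coefficients tensored with nonempty words: degeneracy and length filtration -/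

section Family

variable {R : Type u} [CommRing R] {X X' : Type u} {D D' V : Type u} [AddCommGroup D] [Module R D]
  [AddCommGroup D'] [Module R D'] [AddCommGroup V] [Module R V]

/-- The map `c ⊗ t ↦ g_t c ⊗ τ t`. -/
noncomputable def eMap (τ : X → X') (g : X → D →ₗ[R] D') : (X →₀ D) →ₗ[R] (X' →₀ D') :=
  Finsupp.lsum R fun t => Finsupp.lsingle (τ t) ∘ₗ g t

@[simp] lemma eMap_single (τ : X → X') (g : X → D →ₗ[R] D') (t : X) (c : D) :
    eMap τ g (Finsupp.single t c) = Finsupp.single (τ t) (g t c) := by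
  simp [eMap]

/-- The elements of `D ⊗ R⟨List X × X⟩` whose coefficient at `(z, t)` lies in `Q z t`. -/
def famT (Q : List X → X → Submodule R D) : Submodule R (List X →₀ X →₀ D) where
  carrier := {ξ | ∀ z t, ξ z t ∈ Q z t}
  add_mem' h₁ h₂ z t := (Q z t).add_mem (h₁ z t) (h₂ z t)
  zero_mem' z t := (Q z t).zero_mem
  smul_mem' r _ h z t := (Q z t).smul_mem r (h z t)

lemma single_mem_famT {Q : List X → X → Submodule R D} {z : List X} {t : X} {c : D}
    (hc : c ∈ Q z t) : Finsupp.single z (Finsupp.single t c) ∈ famT Q := by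
  classical
  intro z' t'
  rw [Finsupp.single_apply]
  split_ifs with h
  · subst h
    rw [Finsupp.single_apply]
    split_ifs with h
    · subst h; exact hc
    · exact zero_mem _
  · exact zero_mem _

lemma map_mem_of_mem_famT {Q : List X → X → Submodule R D} {U : Submodule R V}
    (L : (List X →₀ X →₀ D) →ₗ[R] V)
    (h : ∀ z t, ∀ c ∈ Q z t, L (Finsupp.single z (Finsupp.single t c)) ∈ U)
    {ξ : List X →₀ X →₀ D} (hξ : ξ ∈ famT Q) : L ξ ∈ U := by
  rw [← Finsupp.sum_single ξ, Finsupp.sum, map_sum]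
  refine sum_mem fun z _ => ?_
  rw [← Finsupp.sum_single (ξ z), Finsupp.sum]
  rw [← Finsupp.lsingle_apply (R := R), map_sum, map_sum]
  exact sum_mem fun t _ => h z t _ (hξ z t)

lemma hom_ext_single {L L' : (List X →₀ X →₀ D) →ₗ[R] V}
    (h : ∀ z t c, L (Finsupp.single z (Finsupp.single t c)) =
      L' (Finsupp.single z (Finsupp.single t c))) (v : List X →₀ X →₀ D) : L v = L' v := by
  suffices L = L' by rw [this]
  refine Finsupp.lhom_ext' fun z => Finsupp.lhom_ext fun t c => ?_
  simpa using h z t c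

open Classical in
/-- The elements of `D ⊗ R⟨List X × X⟩` supported on the pairs that satisfy `p`. -/
noncomputable def supT (R D : Type u) [CommRing R] [AddCommGroup D] [Module R D]
    (p : List X → X → Prop) : Submodule R (List X →₀ X →₀ D) :=
  famT fun z t => if p z t then ⊤ else ⊥

lemma mem_supT {p : List X → X → Prop} {ξ : List X →₀ X →₀ D} :
    ξ ∈ supT R D p ↔ ∀ z t, ¬ p z t → ξ z t = 0 := by
  refine forall_congr' fun z => forall_congr' fun t => ?_
  by_cases h : p z t <;> simp [h]

lemma single_mem_supT {p : List X → X → Prop} {z : List X} {t : X} (h : p z t) (c : D) :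
    Finsupp.single z (Finsupp.single t c) ∈ supT R D p :=
  single_mem_famT (by simp [h])

lemma map_mem_of_mem_supT {p : List X → X → Prop} {U : Submodule R V}
    (L : (List X →₀ X →₀ D) →ₗ[R] V)
    (h : ∀ z t c, p z t → L (Finsupp.single z (Finsupp.single t c)) ∈ U)
    {ξ : List X →₀ X →₀ D} (hξ : ξ ∈ supT R D p) : L ξ ∈ U := by
  refine map_mem_of_mem_famT L (fun z t c hc => ?_) hξ
  by_cases hp : p z t
  · exact h z t c hp
  · simp only [hp, if_false, Submodule.mem_bot] at hc
    simp [hc]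

lemma supT_mono {p q : List X → X → Prop} (h : ∀ z t, p z t → q z t) :
    supT R D p ≤ supT R D q := by
  intro ξ hξ
  rw [mem_supT] at hξ ⊢
  exact fun z t hq => hξ z t fun hp => hq (h z t hp)

/-- The degenerate part of `D ⊗ R⟨List X × X⟩`. -/
noncomputable abbrev degT (R X D : Type u) [CommRing R] [AddCommGroup D] [Module R D] :
    Submodule R (List X →₀ X →₀ D) :=
  supT R D fun z t => Degen (z ++ [t])

/-- The elements that are, up to degenerate ones, supported on lists shorter than `q`. -/
noncomputable abbrev filT (R X D : Type u) [CommRing R] [AddCommGroup D] [Module R D] (q : ℕ) :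
    Submodule R (List X →₀ X →₀ D) :=
  supT R D fun z t => Degen (z ++ [t]) ∨ z.length < q

lemma consL_mem_degT (x : X) {ξ : List X →₀ X →₀ D} (h : ξ ∈ degT R X D) :
    consL R (X →₀ D) x ξ ∈ degT R X D :=
  map_mem_of_mem_supT (consL R (X →₀ D) x)
    (fun z t c hp => by rw [consL_single]; exact single_mem_supT (.cons x hp) c) h

lemma signL_mem_famT {Q : List X → X → Submodule R D} {ξ : List X →₀ X →₀ D} (hξ : ξ ∈ famT Q) :
    signL R (X →₀ D) X ξ ∈ famT Q := by
  refine map_mem_of_mem_famT _ (fun z t c hc => ?_) hξ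
  rw [signL_single]
  exact Submodule.smul_mem _ _ (single_mem_famT hc)

/-- The map `c ⊗ (z, t) ↦ f c ⊗ (φ z, φ t)`. -/
noncomputable def mapT (φ : X → X') (f : D →ₗ[R] D') :
    (List X →₀ X →₀ D) →ₗ[R] (List X' →₀ X' →₀ D') :=
  mapL φ (eMap φ fun _ => f)

@[simp] lemma mapT_single (φ : X → X') (f : D →ₗ[R] D') (z : List X) (t : X) (c : D) :
    mapT φ f (Finsupp.single z (Finsupp.single t c)) =
      Finsupp.single (z.map φ) (Finsupp.single (φ t) (f c)) := by
  simp [mapT]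

lemma mapT_mem_degT (φ : X → X') (f : D →ₗ[R] D') {ξ : List X →₀ X →₀ D} (hξ : ξ ∈ degT R X D) :
    mapT φ f ξ ∈ degT R X' D' := by
  refine map_mem_of_mem_supT _ (fun z t c hz => ?_) hξ
  rw [mapT_single]
  refine single_mem_supT ?_ _
  convert hz.map φ using 1
  simp

lemma mapT_mem_filT (φ : X → X') (f : D →ₗ[R] D') {q : ℕ} {ξ : List X →₀ X →₀ D}
    (hξ : ξ ∈ filT R X D q) : mapT φ f ξ ∈ filT R X' D' q := by
  refine map_mem_of_mem_supT _ (fun z t c hz => ?_) hξ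
  rw [mapT_single]
  refine single_mem_supT (hz.imp (fun hz => ?_) fun hz => ?_) _
  · convert hz.map φ using 1
    simp
  · simpa using hz

variable [Spindle X]

/-- At a pair of equal neighbours the contributions of the two letters cancel. If the pair contains
the final letter t, the coefficient maps must agree as well; this is the hypothesis on γγ x x. -/
lemma twist_mem_degT (bb ββ : X → D →ₗ[R] D) (γγ : X → X → D →ₗ[R] D)
    (h : ∀ x c, γγ x x c = ββ x c) {ξ : List X →₀ X →₀ D} (hξ : ξ ∈ degT R X D) :
    twist (eMap id bb) (eMap id ββ) (fun x => eMap (Spindle.op · x) (γγ x)) ξ ∈ degT R X D := by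
  refine map_mem_of_mem_supT _ (fun z t c hz => ?_) hξ
  induction z with
  | nil => exact absurd hz not_degen_singleton
  | cons x z ih =>
    rcases z with _ | ⟨y, z⟩
    · rw [List.singleton_append, degen_cons_cons, or_iff_left not_degen_singleton] at hz
      subst hz
      have e : eMap (Spindle.op · x) (γγ x) (Finsupp.single x c) =
          eMap id ββ (Finsupp.single x c) := by
        rw [eMap_single, eMap_single, h, Spindle.idem, id]
      rw [twist_cons, e, List.map_nil, sub_self, zero_sub, twist_nil, eMap_single, consL_single]
      exact neg_mem (single_mem_supT (.here _ _) _)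
    · rw [List.cons_append, List.cons_append, degen_cons_cons] at hz
      rcases hz with rfl | hz
      -- Everything cancels except the words in which both copies of x survive.
      · rw [twist_cons, twist_cons, map_sub, map_sub, consL_single, consL_single, List.map_cons,
          Spindle.idem]
        have : ∀ v : List X →₀ X →₀ D, consL R (X →₀ D) x (consL R (X →₀ D) x v) ∈ degT R X D := by
          intro v
          refine map_mem_of_mem_supT (p := fun _ _ => True)
            (consL R (X →₀ D) x ∘ₗ consL R (X →₀ D) x) (fun z t c _ => ?_) (by simp [mem_supT])
          simp only [LinearMap.comp_apply, consL_single]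
          exact single_mem_supT (.here _ _) _
        rw [sub_sub_cancel]
        exact this _
      · rw [twist_cons, eMap_single, eMap_single]
        refine sub_mem (sub_mem (single_mem_supT hz _) (single_mem_supT ?_ _))
          (consL_mem_degT x (ih hz))
        convert hz.map (Spindle.op · x) using 1
        simp

/-- With b = 0 every term is one letter shorter, while degenerate words remain degenerate. -/
lemma twist_mem_filT (ββ : X → D →ₗ[R] D) (γγ : X → X → D →ₗ[R] D)
    (h : ∀ x c, γγ x x c = ββ x c) {q : ℕ} {ξ : List X →₀ X →₀ D} (hξ : ξ ∈ filT R X D (q + 1)) :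
    twist 0 (eMap id ββ) (fun x => eMap (Spindle.op · x) (γγ x)) ξ ∈ filT R X D q := by
  refine map_mem_of_mem_supT _ (fun z t c hz => ?_) hξ
  rcases hz with hz | hz
  · refine supT_mono (fun _ _ => Or.inl) ?_
    have h0 : (0 : (X →₀ D) →ₗ[R] (X →₀ D)) = eMap id 0 :=
      Finsupp.lhom_ext fun _ _ => by simp
    rw [h0]
    exact twist_mem_degT 0 ββ γγ h (single_mem_supT hz c)
  · rw [mem_supT]
    intro w t' hw
    rw [(twist_single_mem (⊤ : Submodule R (X →₀ D)) _ trivial (fun _ => trivial) z w).2]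
    · rfl
    · intro h'; exact hw (Or.inr (by omega))

end Family

/-! ### Complexes with a homotopically trivial spindle action -/

/-- A differential graded `R`-module with an action of the spindle `X` that is trivial up to the
homotopies `hom x`. -/
structure DGAct (R : Type u) [CommRing R] (X : Type u) [Spindle X] (D : Type u) [AddCommGroup D]
    [Module R D] where
  d : D →ₗ[R] D
  act : X → D →ₗ[R] D
  hom : X → D →ₗ[R] D
  gr : ℤ → Submodule R D
  d_d : ∀ c, d (d c) = 0
  d_act : ∀ x c, d (act x c) = act x (d c)
  act_act : ∀ c x y, act y (act x c) = act (Spindle.op x y) (act y c)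
  d_hom : ∀ x c, d (hom x c) + hom x (d c) = c - act x c
  d_mem : ∀ n, ∀ c ∈ gr n, d c ∈ gr (n - 1)
  act_mem : ∀ n x, ∀ c ∈ gr n, act x c ∈ gr n
  hom_mem : ∀ n x, ∀ c ∈ gr n, hom x c ∈ gr (n + 1)

namespace DGAct

variable {R : Type u} [CommRing R] {X X' : Type u} [Spindle X] [Spindle X'] {D D' : Type u}
  [AddCommGroup D] [Module R D] [AddCommGroup D'] [Module R D']

/-- The pullback along a spindle homomorphism. -/
def comap (S : DGAct R X' D) (φ : SpindleHom X X') : DGAct R X D where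
  d := S.d
  act x := S.act (φ.toFun x)
  hom x := S.hom (φ.toFun x)
  gr := S.gr
  d_d := S.d_d
  d_act x := S.d_act _
  act_act c x y := by rw [S.act_act, φ.map_op]
  d_hom x := S.d_hom _
  d_mem := S.d_mem
  act_mem n x := S.act_mem n _
  hom_mem n x := S.hom_mem n _

variable (S : DGAct R X D)

/-- The part of the differential on `D ⊗ R⟨List X × X⟩` that deletes letters. -/
noncomputable def del : (List X →₀ X →₀ D) →ₗ[R] (List X →₀ X →₀ D) :=
  twist 0 (eMap id S.act) fun x => eMap (Spindle.op · x) fun _ => S.act x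

/-- The differential on `D ⊗ R⟨List X × X⟩`. -/
noncomputable def dT : (List X →₀ X →₀ D) →ₗ[R] (List X →₀ X →₀ D) :=
  twist (eMap id fun _ => S.d) (eMap id S.act) fun x => eMap (Spindle.op · x) fun _ => S.act x

/-- The homotopy between the twisted and the untwisted deletion of letters. -/
noncomputable def homT : (List X →₀ X →₀ D) →ₗ[R] (List X →₀ X →₀ D) :=
  twist 0 (eMap id S.hom) fun x => eMap (Spindle.op · x) fun _ => S.hom x

/-- The differential of `D`, applied to coefficients. -/
noncomputable def coefD : (List X →₀ X →₀ D) →ₗ[R] (List X →₀ X →₀ D) :=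
  coefL X (eMap id fun _ => S.d)

/-- The total grading. -/
def grT (n : ℤ) : Submodule R (List X →₀ X →₀ D) := famT fun z _ => S.gr (n - z.length)

lemma dT_eq (v : List X →₀ X →₀ D) :
    S.dT v = signL R (X →₀ D) X (S.coefD v) + S.del v := twist_eq_sign_add _ _ _ v

lemma dT_dT (v : List X →₀ X →₀ D) : S.dT (S.dT v) = 0 := by
  have ext {f g : (X →₀ D) →ₗ[R] (X →₀ D)} (h : ∀ t c, f (Finsupp.single t c) =
      g (Finsupp.single t c)) (e : X →₀ D) : f e = g e := by
    rw [show f = g from Finsupp.lhom_ext h]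
  refine twist_twist ?_ ?_ ?_ ?_ ?_ v
  · exact ext (f := eMap id (fun _ => S.d) ∘ₗ eMap id fun _ => S.d) (g := 0)
      fun t c => by simp [S.d_d]
  · exact ext (f := eMap id (fun _ => S.d) ∘ₗ eMap id S.act)
      (g := eMap id S.act ∘ₗ eMap id fun _ => S.d) fun t c => by simp [S.d_act]
  · exact fun x => ext (f := eMap id (fun _ => S.d) ∘ₗ eMap (Spindle.op · x) fun _ => S.act x)
      (g := eMap (Spindle.op · x) (fun _ => S.act x) ∘ₗ eMap id fun _ => S.d)
      fun t c => by simp [S.d_act]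
  · exact fun x => ext (f := eMap id S.act ∘ₗ eMap (Spindle.op · x) fun _ => S.act x)
      (g := eMap (Spindle.op · x) (fun _ => S.act x) ∘ₗ eMap id S.act)
      fun t c => by simp [S.act_act c t x]
  · exact fun x y => ext (f := eMap (Spindle.op · y) (fun _ => S.act y) ∘ₗ
      eMap (Spindle.op · x) fun _ => S.act x)
      (g := eMap (Spindle.op · (Spindle.op x y)) (fun _ => S.act (Spindle.op x y)) ∘ₗ
        eMap (Spindle.op · y) fun _ => S.act y)
      fun t c => by simp [S.act_act c x y, Spindle.distrib t x y]

lemma dT_mem_degT {ξ : List X →₀ X →₀ D} (hξ : ξ ∈ degT R X D) : S.dT ξ ∈ degT R X D :=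
  twist_mem_degT (fun _ => S.d) S.act (fun x _ => S.act x) (fun _ _ => rfl) hξ

lemma del_mem_filT {q : ℕ} {ξ : List X →₀ X →₀ D} (hξ : ξ ∈ filT R X D (q + 1)) :
    S.del ξ ∈ filT R X D q :=
  twist_mem_filT S.act (fun x _ => S.act x) (fun _ _ => rfl) hξ

lemma homT_mem_filT {q : ℕ} {ξ : List X →₀ X →₀ D} (hξ : ξ ∈ filT R X D (q + 1)) :
    S.homT ξ ∈ filT R X D q :=
  twist_mem_filT S.hom (fun x _ => S.hom x) (fun _ _ => rfl) hξ

/-- The elements of `X →₀ D` homogeneous of degree `n`. -/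
def grE (n : ℤ) : Submodule R (X →₀ D) where
  carrier := {e | ∀ t, e t ∈ S.gr n}
  add_mem' h₁ h₂ t := add_mem (h₁ t) (h₂ t)
  zero_mem' _ := zero_mem _
  smul_mem' r _ h _ := Submodule.smul_mem _ r (h _)

lemma single_mem_grE {n : ℤ} {c : D} (hc : c ∈ S.gr n) (t : X) :
    Finsupp.single t c ∈ S.grE n := by
  classical
  intro t'
  rw [Finsupp.single_apply]
  split_ifs
  · exact hc
  · exact zero_mem _

/-- A word loses one letter, so a change of r + 1 in coefficient degree is a change of r in total
degree: r = -1 for the action, r = 0 for its homotopy. -/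
lemma twist_mem_grT (r : ℤ) (ββ : X → D →ₗ[R] D) (γγ : X → D →ₗ[R] D)
    (hβ : ∀ n t, ∀ c ∈ S.gr n, ββ t c ∈ S.gr (n + 1 + r))
    (hγ : ∀ n x, ∀ c ∈ S.gr n, γγ x c ∈ S.gr (n + 1 + r))
    {n : ℤ} {ξ : List X →₀ X →₀ D} (hξ : ξ ∈ S.grT n) :
    twist 0 (eMap id ββ) (fun x => eMap (Spindle.op · x) fun _ => γγ x) ξ ∈ S.grT (n + r) := by
  refine map_mem_of_mem_famT _ (fun z t c hc w t' => ?_) hξ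
  have h := twist_single_mem (β := eMap id ββ) (γ := fun x => eMap (Spindle.op · x) fun _ => γγ x)
    (S.grE (n - z.length + 1 + r)) (Finsupp.single t c)
    (by rw [eMap_single]; exact S.single_mem_grE (hβ _ _ _ hc) _)
    (fun x => by rw [eMap_single]; exact S.single_mem_grE (hγ _ _ _ hc) _) z w
  by_cases hw : w.length + 1 = z.length
  · have := h.1 t'
    rwa [← hw, show n - ((w.length + 1 : ℕ) : ℤ) + 1 + r = n + r - w.length by push_cast; ring]
      at this
  · rw [h.2 hw]; exact zero_mem _

lemma homT_mem_grT {n : ℤ} {ξ : List X →₀ X →₀ D} (hξ : ξ ∈ S.grT n) : S.homT ξ ∈ S.grT n := by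
  have h := S.twist_mem_grT 0 S.hom S.hom (fun n t c hc => by simpa using S.hom_mem n t c hc)
    (fun n x c hc => by simpa using S.hom_mem n x c hc) hξ
  rwa [add_zero] at h

lemma del_mem_grT {n : ℤ} {ξ : List X →₀ X →₀ D} (hξ : ξ ∈ S.grT n) : S.del ξ ∈ S.grT (n - 1) :=
  S.twist_mem_grT (-1) S.act S.act (fun n t c hc => by simpa using S.act_mem n t c hc)
    (fun n t c hc => by simpa using S.act_mem n t c hc) hξ

lemma dT_mem_grT {n : ℤ} {ξ : List X →₀ X →₀ D} (hξ : ξ ∈ S.grT n) : S.dT ξ ∈ S.grT (n - 1) := by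
  rw [dT_eq]
  refine add_mem (signL_mem_famT (map_mem_of_mem_famT _ (fun z t c hc => ?_) hξ)) ?_
  · rw [coefD, coefL_single, eMap_single]
    refine single_mem_famT ?_
    have := S.d_mem _ _ hc
    rwa [show n - (z.length : ℤ) - 1 = n - 1 - z.length by ring] at this
  · exact S.del_mem_grT hξ

lemma mapT_twist {φ : X → X'} {f : D →ₗ[R] D'} {b : D →ₗ[R] D} {b' : D' →ₗ[R] D'}
    {g : X → D →ₗ[R] D} {g' : X' → D' →ₗ[R] D'}
    (hφ : ∀ x y, φ (Spindle.op x y) = Spindle.op (φ x) (φ y)) (hb : ∀ c, f (b c) = b' (f c))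
    (hg : ∀ x c, f (g x c) = g' (φ x) (f c)) (v : List X →₀ X →₀ D) :
    mapT φ f (twist (eMap id fun _ => b) (eMap id g)
        (fun x => eMap (Spindle.op · x) fun _ => g x) v)
      = twist (eMap id fun _ => b') (eMap id g') (fun x => eMap (Spindle.op · x) fun _ => g' x)
        (mapT φ f v) := by
  have ext {f g : (X →₀ D) →ₗ[R] (X' →₀ D')} (h : ∀ t c, f (Finsupp.single t c) =
      g (Finsupp.single t c)) (e : X →₀ D) : f e = g e := by
    rw [show f = g from Finsupp.lhom_ext h]
  refine mapL_twist hφ ?_ ?_ ?_ v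
  · exact ext (f := eMap φ (fun _ => f) ∘ₗ eMap id fun _ => b)
      (g := (eMap id fun _ => b') ∘ₗ eMap φ fun _ => f) fun t c => by simp [hb]
  · exact ext (f := eMap φ (fun _ => f) ∘ₗ eMap id g)
      (g := eMap id g' ∘ₗ eMap φ fun _ => f) fun t c => by simp [hg]
  · exact fun x => ext (f := eMap φ (fun _ => f) ∘ₗ eMap (Spindle.op · x) fun _ => g x)
      (g := (eMap (Spindle.op · (φ x)) fun _ => g' (φ x)) ∘ₗ eMap φ fun _ => f)
      fun t c => by simp [hg, hφ]

lemma mapT_mem_grT (S : DGAct R X D) (S' : DGAct R X' D') (φ : X → X') {f : D →ₗ[R] D'}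
    (hf : ∀ n, ∀ c ∈ S.gr n, f c ∈ S'.gr n) {n : ℤ} {ξ : List X →₀ X →₀ D} (hξ : ξ ∈ S.grT n) :
    mapT φ f ξ ∈ S'.grT n := by
  refine map_mem_of_mem_famT _ (fun z t c hc => ?_) hξ
  rw [mapT_single]
  refine single_mem_famT ?_
  rw [List.length_map]
  exact hf _ _ hc

end DGAct


/-! ### Pointwise formulas and finitely supported choices -/

section Pointwise

variable {R : Type u} [CommRing R] {X : Type u} {D D' E : Type u} [AddCommGroup D] [Module R D]
  [AddCommGroup D'] [Module R D'] [AddCommGroup E] [Module R E]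

lemma signL_apply (v : List X →₀ E) (z : List X) :
    signL R E X v z = (-1 : R) ^ z.length • v z := by
  suffices h : Finsupp.lapply z ∘ₗ signL R E X = (-1 : R) ^ z.length • Finsupp.lapply z from
    LinearMap.congr_fun h v
  classical
  refine Finsupp.lhom_ext fun w e => ?_
  simp only [LinearMap.comp_apply, signL_single, LinearMap.smul_apply, Finsupp.lapply_apply,
    Finsupp.smul_apply, Finsupp.single_apply]
  split_ifs with h
  · rw [h]
  · simp

lemma eMap_id_apply (g : X → D →ₗ[R] D') (e : X →₀ D) (t : X) :
    eMap id g e t = g t (e t) := by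
  suffices h : Finsupp.lapply t ∘ₗ eMap id g = g t ∘ₗ Finsupp.lapply t from
    LinearMap.congr_fun h e
  classical
  refine Finsupp.lhom_ext fun w e => ?_
  simp only [LinearMap.comp_apply, eMap_single, Finsupp.lapply_apply, Finsupp.single_apply, id]
  split_ifs with h
  · rw [h]
  · simp

lemma mapT_id_apply (f : D →ₗ[R] D') (v : List X →₀ X →₀ D) (z : List X) (t : X) :
    mapT id f v z t = f (v z t) := by
  rw [mapT, mapL_id, coefL_apply, eMap_id_apply]

/-- Choosing 0 wherever both v and v' vanish keeps the supports finite. -/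
lemma exists_finsupp_of_forall {I A A' B B' : Type*} [Zero A] [Zero A'] [Zero B] [Zero B']
    (v : I →₀ A) (v' : I →₀ A') (Q : I → B → B' → Prop) (h : ∀ i, ∃ b b', Q i b b')
    (h0 : ∀ i, v i = 0 → v' i = 0 → Q i 0 0) :
    ∃ (w : I →₀ B) (w' : I →₀ B'), ∀ i, Q i (w i) (w' i) := by
  classical
  choose g g' hg using h
  let s := v.support ∪ v'.support
  refine ⟨Finsupp.onFinset s (fun i => if i ∈ s then g i else 0) (by intro i; simp_all),
    Finsupp.onFinset s (fun i => if i ∈ s then g' i else 0) (by intro i; simp_all), fun i => ?_⟩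
  simp only [Finsupp.onFinset_apply]
  split_ifs with hi
  · exact hg i
  · simp only [s, Finset.mem_union, Finsupp.mem_support_iff, not_or, not_not] at hi
    exact h0 i hi.1 hi.2

end Pointwise

/-! ### Changing the coefficients over a fixed spindle -/

namespace DGAct

variable {R : Type u} [CommRing R] {X : Type u} [Spindle X] {D D' : Type u}
  [AddCommGroup D] [Module R D] [AddCommGroup D'] [Module R D']

/-- On the longest words only the differential of the coefficients is visible: letter deletion could
reach them only from longer, degenerate words, whose images are degenerate. -/
lemma dT_apply (S : DGAct R X D) {q : ℕ} {v : List X →₀ X →₀ D} (hv : v ∈ filT R X D (q + 1))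
    {z : List X} {t : X} (hz : ¬ Degen (z ++ [t])) (hq : q ≤ z.length) :
    S.dT v z t = (-1 : R) ^ z.length • S.d (v z t) := by
  have := mem_supT.1 (S.del_mem_filT hv) z t (by rintro (h | h); exacts [hz h, by omega])
  rw [dT_eq, Finsupp.add_apply, Finsupp.add_apply, this, add_zero, signL_apply, coefD,
    Finsupp.smul_apply, coefL_apply, eMap_id_apply]

/-- Induction on the bound for the word length. At each nondegenerate word of maximal length the
cycle condition is that of the cone of f in degree n - |z|, so the top layer is removed word by
word. The correction may create terms only on shorter words, modulo degenerate ones. -/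
theorem coneExact_mapT_id (S : DGAct R X D) (S' : DGAct R X D') (f : D →ₗ[R] D')
    (hfd : ∀ c, f (S.d c) = S'.d (f c)) (hfa : ∀ x c, f (S.act x c) = S'.act x (f c))
    (hf : ∀ n, ∀ c ∈ S.gr n, f c ∈ S'.gr n) {n : ℤ}
    (h : ∀ k ≤ n, ConeExact S.d S'.d f S.gr ⊥ S'.gr ⊥ k) :
    ConeExact S.dT S'.dT (mapT id f) S.grT (degT R X D) S'.grT (degT R X D') n := by
  have hfT : ∀ v, mapT id f (S.dT v) = S'.dT (mapT id f v) :=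
    mapT_twist (fun _ _ => rfl) hfd hfa
  suffices H : ∀ q : ℕ, ∀ b ∈ S'.grT n, ∀ a ∈ S.grT (n - 1), b ∈ filT R X D' q →
      a ∈ filT R X D q → S.dT a ∈ degT R X D → S'.dT b + mapT id f a ∈ degT R X D' →
      ∃ b' ∈ S'.grT (n + 1), ∃ a' ∈ S.grT n, a + S.dT a' ∈ degT R X D ∧
        b - S'.dT b' - mapT id f a' ∈ degT R X D' by
    intro b hb a ha
    have bound : ∀ {D : Type u} [AddCommGroup D] [Module R D] (v : List X →₀ X →₀ D) (q : ℕ),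
        v.support.sup List.length < q → v ∈ filT R X D q := by
      intro D _ _ v q hq
      rw [mem_supT]
      intro z t hz
      by_contra hne
      have hzs : z ∈ v.support := by
        rw [Finsupp.mem_support_iff]; rintro h0; rw [h0] at hne; exact hne rfl
      have := Finset.le_sup (f := List.length) hzs
      exact hz (Or.inr (by omega))
    exact H (max (b.support.sup List.length) (a.support.sup List.length) + 1) b hb a ha
      (bound _ _ (by omega)) (bound _ _ (by omega))
  intro q
  induction q with
  | zero =>
    intro b hb a ha hbq haq _ _
    have h0 : ∀ {D : Type u} [AddCommGroup D] [Module R D], filT R X D 0 ≤ degT R X D := by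
      intro D _ _
      exact supT_mono fun z t h => by simpa using h
    exact ⟨0, zero_mem _, 0, zero_mem _, by simpa using h0 haq, by simpa using h0 hbq⟩
  | succ q ih =>
    intro b hb a ha hbq haq hda hdb
    have hσ : ∀ k : ℕ, (-1 : R) ^ k * (-1) ^ k = 1 := fun k => by rw [← mul_pow]; simp
    have key : ∀ z t, ∃ b₁ a₁, b₁ ∈ S'.gr (n + 1 - z.length) ∧ a₁ ∈ S.gr (n - z.length) ∧
        (z.length ≠ q → b₁ = 0 ∧ a₁ = 0) ∧ (¬ Degen (z ++ [t]) → z.length = q →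
          a z t + (-1 : R) ^ z.length • S.d a₁ = 0 ∧
          b z t - (-1 : R) ^ z.length • S'.d b₁ - f a₁ = 0) := by
      intro z t
      by_cases hz : ¬ Degen (z ++ [t]) ∧ z.length = q
      swap
      · exact ⟨0, 0, zero_mem _, zero_mem _, fun _ => ⟨rfl, rfl⟩, fun h₁ h₂ => absurd ⟨h₁, h₂⟩ hz⟩
      have e1 := mem_supT.1 hda z t hz.1
      have e2 := mem_supT.1 hdb z t hz.1
      rw [S.dT_apply haq hz.1 hz.2.ge] at e1
      rw [Finsupp.add_apply, Finsupp.add_apply, S'.dT_apply hbq hz.1 hz.2.ge, mapT_id_apply] at e2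
      -- The sign on the coefficient differential is absorbed by rescaling a here and b₁ afterwards,
      -- both by (-1)^|z|.
      obtain ⟨b₁, hb₁, a₁, ha₁, h1, h2⟩ := h (n - z.length) (by omega) (b z t) (hb z t)
        ((-1 : R) ^ z.length • a z t)
        (Submodule.smul_mem _ _ (by
          have : a z t ∈ S.gr (n - 1 - z.length) := ha z t
          rwa [show n - 1 - (z.length : ℤ) = n - z.length - 1 by ring] at this))
        (by rw [map_smul, e1]; exact zero_mem _)
        (by
          have := congrArg ((-1 : R) ^ z.length • ·) e2
          simp only [smul_add, smul_smul, hσ, one_smul, smul_zero] at this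
          rw [map_smul, this]; exact zero_mem _)
      rw [Submodule.mem_bot] at h1 h2
      refine ⟨(-1 : R) ^ z.length • b₁, a₁, Submodule.smul_mem _ _ (by
        rwa [show n - (z.length : ℤ) + 1 = n + 1 - z.length by ring] at hb₁), ha₁,
        fun h => absurd hz.2 h, fun _ _ => ⟨?_, ?_⟩⟩
      · have := congrArg ((-1 : R) ^ z.length • ·) h1
        simpa only [smul_add, smul_smul, hσ, one_smul, smul_zero] using this
      · rw [map_smul, smul_smul, hσ, one_smul, h2]
    obtain ⟨b₁, a₁, hba⟩ : ∃ (b₁ : List X →₀ X →₀ D') (a₁ : List X →₀ X →₀ D), ∀ z t,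
        b₁ z t ∈ S'.gr (n + 1 - z.length) ∧ a₁ z t ∈ S.gr (n - z.length) ∧
        (z.length ≠ q → b₁ z t = 0 ∧ a₁ z t = 0) ∧ (¬ Degen (z ++ [t]) → z.length = q →
          a z t + (-1 : R) ^ z.length • S.d (a₁ z t) = 0 ∧
          b z t - (-1 : R) ^ z.length • S'.d (b₁ z t) - f (a₁ z t) = 0) := by
      refine exists_finsupp_of_forall b a (fun z (b₁ : X →₀ D') (a₁ : X →₀ D) => ∀ t,
        b₁ t ∈ S'.gr (n + 1 - z.length) ∧ a₁ t ∈ S.gr (n - z.length) ∧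
        (z.length ≠ q → b₁ t = 0 ∧ a₁ t = 0) ∧ (¬ Degen (z ++ [t]) → z.length = q →
          a z t + (-1 : R) ^ z.length • S.d (a₁ t) = 0 ∧
          b z t - (-1 : R) ^ z.length • S'.d (b₁ t) - f (a₁ t) = 0)) (fun z => ?_) ?_
      · exact exists_finsupp_of_forall (b z) (a z) _ (key z)
          fun t hb0 ha0 => ⟨zero_mem _, zero_mem _, fun _ => ⟨rfl, rfl⟩, fun _ _ => by simp [*]⟩
      · intro z hb0 ha0 t
        exact ⟨zero_mem _, zero_mem _, fun _ => ⟨rfl, rfl⟩, fun _ _ => by simp [*]⟩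
    have hb₁ : b₁ ∈ S'.grT (n + 1) := fun z t => (hba z t).1
    have ha₁ : a₁ ∈ S.grT n := fun z t => (hba z t).2.1
    have hbq₁ : b₁ ∈ filT R X D' (q + 1) := mem_supT.2 fun z t hz =>
      ((hba z t).2.2.1 (by rintro rfl; exact hz (Or.inr (by omega)))).1
    have haq₁ : a₁ ∈ filT R X D (q + 1) := mem_supT.2 fun z t hz =>
      ((hba z t).2.2.1 (by rintro rfl; exact hz (Or.inr (by omega)))).2
    -- The corrected cycle has no nondegenerate words of length q left.
    obtain ⟨b', hb', a', ha', h1, h2⟩ := ih (b - S'.dT b₁ - mapT id f a₁)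
      (sub_mem (sub_mem hb (by simpa using S'.dT_mem_grT hb₁)) (mapT_mem_grT S S' id hf ha₁))
      (a + S.dT a₁) (add_mem ha (S.dT_mem_grT ha₁))
      (mem_supT.2 fun z t hz => by
        rw [not_or, not_lt] at hz
        rw [Finsupp.sub_apply, Finsupp.sub_apply, Finsupp.sub_apply, Finsupp.sub_apply,
          S'.dT_apply hbq₁ hz.1 hz.2, mapT_id_apply]
        rcases eq_or_ne z.length q with hq | hq
        · exact ((hba z t).2.2.2 hz.1 hq).2
        · rw [((hba z t).2.2.1 hq).1, ((hba z t).2.2.1 hq).2, mem_supT.1 hbq z t]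
          · simp
          · rintro (h | h)
            exacts [hz.1 h, by omega])
      (mem_supT.2 fun z t hz => by
        rw [not_or, not_lt] at hz
        rw [Finsupp.add_apply, Finsupp.add_apply, S.dT_apply haq₁ hz.1 hz.2]
        rcases eq_or_ne z.length q with hq | hq
        · exact ((hba z t).2.2.2 hz.1 hq).1
        · rw [((hba z t).2.2.1 hq).2, mem_supT.1 haq z t]
          · simp
          · rintro (h | h)
            exacts [hz.1 h, by omega])
      (by rw [map_add, dT_dT, add_zero]; exact hda)
      (by
        rw [map_sub, map_sub, dT_dT, map_add, hfT]
        convert hdb using 1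
        abel)
    refine ⟨b₁ + b', add_mem hb₁ hb', a₁ + a', add_mem ha₁ ha', ?_, ?_⟩
    · rwa [map_add, ← add_assoc]
    · rw [map_add, map_add]
      convert h2 using 1
      abel

end DGAct


/-! ### Contracting homotopies on based complexes -/

section Contraction

variable {R : Type u} [CommRing R] {W : Type u} [AddCommGroup W] [Module R W]

/-- A based complex that is exact modulo the span of the bad basis elements has a contraction up
to any given degree. -/
lemma exists_contraction {I : Type u} (B : I → W) (deg : I → ℕ) (bad : I → Prop)
    (A : ℤ → Submodule R W) (P : Submodule R W) (d : W →ₗ[R] W)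
    (hfree : ∀ g : I → W, ∃ s : W →ₗ[R] W, ∀ i, s (B i) = g i)
    (hB : ∀ i, B i ∈ A (deg i))
    (hA : ∀ (n : ℤ) (L : W →ₗ[R] W) (U : Submodule R W),
      (∀ i, (deg i : ℤ) = n → L (B i) ∈ U) → ∀ v ∈ A n, L v ∈ U)
    (hP : ∀ (L : W →ₗ[R] W) (U : Submodule R W),
      (∀ i, bad i → L (B i) ∈ U) → ∀ v ∈ P, L v ∈ U)
    (hPB : ∀ i, bad i → B i ∈ P)
    (hd : ∀ n, ∀ v ∈ A n, d v ∈ A (n - 1)) (hdP : ∀ v ∈ P, d v ∈ P) (hdd : ∀ v, d (d v) = 0)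
    (hex : ∀ n, ∀ v ∈ A n, d v ∈ P → ∃ w ∈ A (n + 1), v - d w ∈ P) (n : ℕ) :
    ∃ s : W →ₗ[R] W, (∀ i, s (B i) ∈ A (deg i + 1)) ∧ (∀ i, bad i → s (B i) = 0) ∧
      ∀ i, deg i < n → d (s (B i)) + s (d (B i)) - B i ∈ P := by
  classical
  induction n with
  | zero => exact ⟨0, fun i => by simp, fun i _ => rfl, fun i h => absurd h (by omega)⟩
  | succ n ih =>
    obtain ⟨s, hs1, hs2, hs3⟩ := ih
    have hsA : ∀ m, ∀ v ∈ A m, s v ∈ A (m + 1) := fun m =>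
      hA m s _ fun i hi => by rw [← hi]; exact hs1 i
    have hid : ∀ m < (n : ℤ), ∀ v ∈ A m, d (s v) + s (d v) - v ∈ P := fun m hm =>
      hA m (d ∘ₗ s + s ∘ₗ d - LinearMap.id) P fun i hi => by
        simpa using hs3 i (by omega)
    -- In the new degree B - s(dB) is a cycle modulo P, because s already contracts in degree n - 1;
    -- w is a primitive of it.
    have hw : ∀ i, ∃ w, deg i = n → w ∈ A (deg i + 1) ∧ B i - s (d (B i)) - d w ∈ P := by
      intro i
      by_cases hi : deg i = n
      · have hdB := hd _ _ (hB i)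
        obtain ⟨w, hw1, hw2⟩ := hex (deg i) (B i - s (d (B i)))
          (sub_mem (hB i) (by simpa using hsA _ _ hdB)) (by
            have := neg_mem (hid _ (by omega) _ hdB)
            rw [hdd, map_zero, add_zero, neg_sub] at this
            rwa [map_sub])
        exact ⟨w, fun _ => ⟨hw1, hw2⟩⟩
      · exact ⟨0, fun h => absurd h hi⟩
    choose w hw using hw
    -- Bad basis elements keep the value 0, so that s' annihilates P and remains compatible with the
    -- quotient.
    obtain ⟨s', hs'⟩ := hfree fun i => if deg i = n ∧ ¬ bad i then w i else s (B i)
    have hs'bad : ∀ i, bad i → s' (B i) = 0 := fun i hi => by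
      rw [hs', if_neg (by simp [hi]), hs2 i hi]
    have hss : ∀ m ≠ (n : ℤ), ∀ v ∈ A m, s' v = s v := fun m hm v hv => by
      have := hA m (s' - s) ⊥ (fun i hi => by
        rw [Submodule.mem_bot, LinearMap.sub_apply, hs', if_neg (by omega), sub_self]) v hv
      exact sub_eq_zero.1 (by simpa using this)
    refine ⟨s', fun i => ?_, hs'bad, fun i hi => ?_⟩
    · rw [hs']
      split_ifs with h
      · exact (hw i h.1).1
      · exact hs1 i
    · by_cases hb : bad i
      · have h0 : s' (d (B i)) = 0 := by
          simpa using hP s' ⊥ (fun i hi => by simp [hs'bad i hi]) _ (hdP _ (hPB i hb))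
        rw [hs'bad i hb, h0, map_zero, add_zero, zero_sub]
        exact neg_mem (hPB i hb)
      · rcases eq_or_ne (deg i) n with hn | hn
        · rw [hs', if_pos ⟨hn, hb⟩, hss _ (by omega) _ (hd _ _ (hB i))]
          have := neg_mem (hw i hn).2
          convert this using 1
          abel
        · rw [hs', if_neg (by simp [hn]), hss _ (by omega) _ (hd _ _ (hB i))]
          exact hs3 i (by omega)

variable {V V' : Type u} [AddCommGroup V] [Module R V] [AddCommGroup V'] [Module R V']

/-- The differential of the mapping cone. -/
def coneD (d : V →ₗ[R] V) (d' : V' →ₗ[R] V') (f : V →ₗ[R] V') : (V' × V) →ₗ[R] (V' × V) :=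
  (d' ∘ₗ LinearMap.fst R V' V + f ∘ₗ LinearMap.snd R V' V).prod (-(d ∘ₗ LinearMap.snd R V' V))

@[simp] lemma coneD_apply (d : V →ₗ[R] V) (d' : V' →ₗ[R] V') (f : V →ₗ[R] V') (v : V' × V) :
    coneD d d' f v = (d' v.1 + f v.2, -d v.2) := rfl

lemma coneExact_iff {d : V →ₗ[R] V} {d' : V' →ₗ[R] V'} {f : V →ₗ[R] V'}
    {A : ℤ → Submodule R V} {P : Submodule R V} {A' : ℤ → Submodule R V'} {P' : Submodule R V'}
    {n : ℤ} : ConeExact d d' f A P A' P' n ↔ ∀ v ∈ (A' n).prod (A (n - 1)),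
      coneD d d' f v ∈ P'.prod P → ∃ w ∈ (A' (n + 1)).prod (A n),
        v - coneD d d' f w ∈ P'.prod P := by
  constructor
  · rintro h ⟨b, a⟩ ⟨hb, ha⟩ ⟨h1, h2⟩
    obtain ⟨b', hb', a', ha', h3, h4⟩ := h b hb a ha (by simpa using h2) h1
    exact ⟨(b', a'), ⟨hb', ha'⟩, by simpa [sub_sub] using h4, by simpa using h3⟩
  · intro h b hb a ha h1 h2
    obtain ⟨⟨b', a'⟩, ⟨hb', ha'⟩, h3, h4⟩ := h (b, a) ⟨hb, ha⟩ ⟨h2, by simpa using h1⟩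
    exact ⟨b', hb', a', ha', by simpa using h4, by simpa [sub_sub] using h3⟩

end Contraction

/-! ### Extension of scalars on the mapping cone -/

section Tensor

variable {R : Type u} [CommRing R] {X X' : Type u} {D : Type u} [AddCommGroup D] [Module R D]

/-- The map `K × D → D ⊗ K` for `K = R⟨List X × X⟩`. -/
noncomputable def tens (k : List X →₀ X →₀ R) : D →ₗ[R] (List X →₀ X →₀ D) where
  toFun c := mapT id (LinearMap.toSpanSingleton R D c) k
  map_add' c c' := by
    rw [← LinearMap.add_apply]
    exact hom_ext_single (fun z t r => by simp) k
  map_smul' s c := by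
    rw [RingHom.id_apply, ← LinearMap.smul_apply]
    exact hom_ext_single (fun z t r => by simp [smul_comm r s]) k

lemma tens_def (k : List X →₀ X →₀ R) (c : D) :
    tens k c = mapT id (LinearMap.toSpanSingleton R D c) k := rfl

@[simp] lemma tens_single (z : List X) (t : X) (r : R) (c : D) :
    tens (Finsupp.single z (Finsupp.single t r)) c =
      Finsupp.single z (Finsupp.single t (r • c)) := by
  simp [tens_def]

lemma tens_mem_degT {k : List X →₀ X →₀ R} (hk : k ∈ degT R X R) (c : D) :
    tens k c ∈ degT R X D := mapT_mem_degT _ _ hk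

/-- The map `W × D → D ⊗ W` for `W = R⟨List X' × X'⟩ × R⟨List X × X⟩`. -/
noncomputable def tensW (k : (List X' →₀ X' →₀ R) × (List X →₀ X →₀ R)) :
    D →ₗ[R] (List X' →₀ X' →₀ D) × (List X →₀ X →₀ D) :=
  (tens k.1).prod (tens k.2)

/-- `tensW` as a linear function of its first argument. -/
noncomputable def tensWL (X X' : Type u) (c : D) :
    ((List X' →₀ X' →₀ R) × (List X →₀ X →₀ R)) →ₗ[R]
      (List X' →₀ X' →₀ D) × (List X →₀ X →₀ D) :=
  (mapT id (LinearMap.toSpanSingleton R D c)).prodMap (mapT id (LinearMap.toSpanSingleton R D c))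

lemma tensWL_apply (k : (List X' →₀ X' →₀ R) × (List X →₀ X →₀ R)) (c : D) :
    tensWL X X' c k = tensW k c := rfl

/-- The basis of `R⟨List X' × X'⟩ × R⟨List X × X⟩`. -/
noncomputable def basW (R X X' : Type u) [CommRing R] :
    (List X' × X') ⊕ (List X × X) → (List X' →₀ X' →₀ R) × (List X →₀ X →₀ R)
  | .inl p => (Finsupp.single p.1 (Finsupp.single p.2 1), 0)
  | .inr p => (0, Finsupp.single p.1 (Finsupp.single p.2 1))

/-- The degree of the basis elements in the mapping cone. -/
def basDeg (X X' : Type u) : (List X' × X') ⊕ (List X × X) → ℕ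
  | .inl p => p.1.length
  | .inr p => p.1.length + 1

/-- The degenerate basis elements. -/
def basBad (X X' : Type u) : (List X' × X') ⊕ (List X × X) → Prop
  | .inl p => Degen (p.1 ++ [p.2])
  | .inr p => Degen (p.1 ++ [p.2])

lemma tensW_inl (z : List X') (t : X') (c : D) :
    tensW (basW R X X' (.inl (z, t))) c = (Finsupp.single z (Finsupp.single t c), 0) := by
  refine Prod.ext ?_ ?_
  · simp [tensW, basW]
  · simp [tensW, basW, tens_def]

lemma tensW_inr (z : List X) (t : X) (c : D) :
    tensW (basW R X X' (.inr (z, t))) c = (0, Finsupp.single z (Finsupp.single t c)) := by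
  refine Prod.ext ?_ ?_
  · simp [tensW, basW, tens_def]
  · simp [tensW, basW]

variable {U : Type u} [AddCommGroup U] [Module R U]

lemma mem_of_famT_prod {Q' : List X' → X' → Submodule R D} {Q : List X → X → Submodule R D}
    {Z : Submodule R U} (L : (List X' →₀ X' →₀ D) × (List X →₀ X →₀ D) →ₗ[R] U)
    (h' : ∀ z t, ∀ c ∈ Q' z t, L (tensW (basW R X X' (.inl (z, t))) c) ∈ Z)
    (h : ∀ z t, ∀ c ∈ Q z t, L (tensW (basW R X X' (.inr (z, t))) c) ∈ Z)
    {v : (List X' →₀ X' →₀ D) × (List X →₀ X →₀ D)} (hv : v ∈ (famT Q').prod (famT Q)) :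
    L v ∈ Z := by
  obtain ⟨b, a⟩ := v
  have : L (b, a) = (L ∘ₗ LinearMap.inl R _ _) b + (L ∘ₗ LinearMap.inr R _ _) a := by
    simp [← map_add]
  rw [this]
  refine add_mem (map_mem_of_mem_famT _ (fun z t c hc => ?_) hv.1)
    (map_mem_of_mem_famT _ (fun z t c hc => ?_) hv.2)
  · simpa [tensW_inl] using h' z t c hc
  · simpa [tensW_inr] using h z t c hc

lemma mem_of_supT_prod {p' : List X' → X' → Prop} {p : List X → X → Prop}
    {Z : Submodule R U} (L : (List X' →₀ X' →₀ D) × (List X →₀ X →₀ D) →ₗ[R] U)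
    (h' : ∀ z t c, p' z t → L (tensW (basW R X X' (.inl (z, t))) c) ∈ Z)
    (h : ∀ z t c, p z t → L (tensW (basW R X X' (.inr (z, t))) c) ∈ Z)
    {v : (List X' →₀ X' →₀ D) × (List X →₀ X →₀ D)}
    (hv : v ∈ (supT R D p').prod (supT R D p)) : L v ∈ Z := by
  refine mem_of_famT_prod L (fun z t c hc => ?_) (fun z t c hc => ?_) hv
  · by_cases hp : p' z t
    · exact h' z t c hp
    · simp only [hp, if_false, Submodule.mem_bot] at hc
      simp [hc]
  · by_cases hp : p z t
    · exact h z t c hp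
    · simp only [hp, if_false, Submodule.mem_bot] at hc
      simp [hc]

lemma hom_ext_tensW {L L' : (List X' →₀ X' →₀ D) × (List X →₀ X →₀ D) →ₗ[R] U}
    (h : ∀ i c, L (tensW (basW R X X' i) c) = L' (tensW (basW R X X' i) c)) : L = L' := by
  refine LinearMap.ext fun v => sub_eq_zero.1 ?_
  have := mem_of_supT_prod (p' := fun _ _ => True) (p := fun _ _ => True) (Z := ⊥) (v := v) (L - L')
    (fun z t c _ => by simp [h]) (fun z t c _ => by simp [h]) (by simp [mem_supT])
  simpa using this

/-- The linear map with prescribed values on the basis. -/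
noncomputable def liftW (g : (List X' × X') ⊕ (List X × X) → D →ₗ[R] U) :
    (List X' →₀ X' →₀ D) × (List X →₀ X →₀ D) →ₗ[R] U :=
  (Finsupp.lsum R fun z => Finsupp.lsum R fun t => g (.inl (z, t))).coprod
    (Finsupp.lsum R fun z => Finsupp.lsum R fun t => g (.inr (z, t)))

lemma liftW_tensW (g : (List X' × X') ⊕ (List X × X) → D →ₗ[R] U)
    (i : (List X' × X') ⊕ (List X × X)) (c : D) : liftW g (tensW (basW R X X' i) c) = g i c := by
  rcases i with ⟨z, t⟩ | ⟨z, t⟩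
  · rw [tensW_inl, liftW, LinearMap.coprod_apply, map_zero, add_zero, Finsupp.lsum_single,
      Finsupp.lsum_single]
  · rw [tensW_inr, liftW, LinearMap.coprod_apply, map_zero, zero_add, Finsupp.lsum_single,
      Finsupp.lsum_single]

lemma tensW_basW_one (i : (List X' × X') ⊕ (List X × X)) :
    tensW (basW R X X' i) (1 : R) = basW R X X' i := by
  rcases i with ⟨z, t⟩ | ⟨z, t⟩
  · rw [tensW_inl]; rfl
  · rw [tensW_inr]; rfl

/-- The extension of scalars of an endomorphism. -/
noncomputable def extW (D : Type u) [AddCommGroup D] [Module R D]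
    (s : (List X' →₀ X' →₀ R) × (List X →₀ X →₀ R) →ₗ[R]
      (List X' →₀ X' →₀ R) × (List X →₀ X →₀ R)) :
    (List X' →₀ X' →₀ D) × (List X →₀ X →₀ D) →ₗ[R]
      (List X' →₀ X' →₀ D) × (List X →₀ X →₀ D) :=
  liftW fun i => tensW (s (basW R X X' i))

lemma extW_tensW (s : (List X' →₀ X' →₀ R) × (List X →₀ X →₀ R) →ₗ[R]
      (List X' →₀ X' →₀ R) × (List X →₀ X →₀ R))
    (k : (List X' →₀ X' →₀ R) × (List X →₀ X →₀ R)) (c : D) :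
    extW D s (tensW k c) = tensW (s k) c := by
  suffices h : extW D s ∘ₗ tensWL X X' c = tensWL X X' c ∘ₗ s from LinearMap.congr_fun h k
  refine hom_ext_tensW fun i r => ?_
  have hr : tensW (basW R X X' i) r = r • basW R X X' i := by
    conv_lhs => rw [← mul_one r, ← smul_eq_mul, map_smul, tensW_basW_one]
  rw [hr, map_smul, map_smul, LinearMap.comp_apply, LinearMap.comp_apply, tensWL_apply,
    tensWL_apply, extW, liftW_tensW]

end Tensor


/-- Perturbation of a contraction. Here ε is the sign, δ the coefficient differential, e and e₀ the
twisted and untwisted deletions, h the homotopy between them, and s contracts for e₀. Put w = hs +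
sh. Passing from e₀ to e costs -(δw + wδ) in the anticommutator with s, and the correction εw
cancels this against εδ. What remains is the anticommutator of e with εw, which shortens words. -/
lemma homotopy_formula {A : Type*} [Ring A] {ε δ h s e e₀ : A} (hεε : ε * ε = 1)
    (hεδ : ε * δ = δ * ε) (hεh : ε * h = -(h * ε)) (hεs : ε * s = -(s * ε)) (hsδ : s * δ = δ * s)
    (he : e = e₀ - (δ * h + h * δ)) :
    (ε * δ + e) * (s + ε * (h * s + s * h)) + (s + ε * (h * s + s * h)) * (ε * δ + e) =
      (e₀ * s + s * e₀) + (e * (ε * (h * s + s * h)) + ε * (h * s + s * h) * e) := by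
  obtain ⟨w, hw⟩ : ∃ w, w = h * s + s * h := ⟨_, rfl⟩
  rw [← hw]
  have hwε : w * ε = ε * w := by
    have h1 : h * s * ε = ε * (h * s) := by
      rw [mul_assoc, ← neg_eq_iff_eq_neg.2 hεs, mul_neg, ← mul_assoc, ← mul_assoc, hεh, neg_mul]
    have h2 : s * h * ε = ε * (s * h) := by
      rw [mul_assoc, ← neg_eq_iff_eq_neg.2 hεh, mul_neg, ← mul_assoc, ← mul_assoc, hεs, neg_mul]
    rw [hw, add_mul, mul_add, h1, h2]
  have a1 : ε * δ * s + s * (ε * δ) = 0 := by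
    rw [← mul_assoc s, ← neg_eq_iff_eq_neg.2 hεs, mul_assoc, neg_mul, mul_assoc, hsδ,
      add_neg_cancel]
  have a2 : ε * δ * (ε * w) + ε * w * (ε * δ) = δ * w + w * δ := by
    have h1 : ε * δ * (ε * w) = δ * w := by
      rw [hεδ, mul_assoc, ← mul_assoc ε ε, hεε, one_mul]
    have h2 : ε * w * (ε * δ) = w * δ := by
      rw [← hwε, mul_assoc, ← mul_assoc ε ε, hεε, one_mul]
    rw [h1, h2]
  have a3 : e * s + s * e = e₀ * s + s * e₀ - (δ * w + w * δ) := by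
    have h1 : h * δ * s = h * s * δ := by rw [mul_assoc, mul_assoc, hsδ]
    have h2 : s * (δ * h) = δ * (s * h) := by rw [← mul_assoc, ← mul_assoc, hsδ]
    rw [he, hw]
    simp only [sub_mul, mul_sub, add_mul, mul_add, h1, h2]
    simp only [mul_assoc]
    abel
  calc _ = (ε * δ * s + s * (ε * δ)) + (ε * δ * (ε * w) + ε * w * (ε * δ)) + (e * s + s * e) +
        (e * (ε * w) + ε * w * e) := by
        simp only [add_mul, mul_add]; abel
    _ = _ := by rw [a1, a2, a3]; abel

/-! ### The mapping cone with ground ring coefficients, and its signs -/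

/-- The ground ring in degree zero. -/
def DGAct.ground (R : Type u) [CommRing R] (X : Type u) [Spindle X] : DGAct R X R where
  d := 0
  act _ := LinearMap.id
  hom _ := 0
  gr n := if n = 0 then ⊤ else ⊥
  d_d _ := rfl
  d_act _ _ := rfl
  act_act _ _ _ := rfl
  d_hom _ _ := by simp
  d_mem _ _ _ := zero_mem _
  act_mem _ _ _ h := h
  hom_mem _ _ _ _ := zero_mem _

section Spindleless

variable {R : Type u} [CommRing R] {X X' : Type u} {D : Type u} [AddCommGroup D] [Module R D]

lemma eMap_zero {D' : Type u} [AddCommGroup D'] [Module R D'] :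
    (eMap id fun _ => 0 : (X →₀ D) →ₗ[R] (X →₀ D')) = 0 :=
  Finsupp.lhom_ext fun t c => by simp

/-- The two summands of the mapping cone. -/
abbrev ConeT (X X' D : Type u) [AddCommGroup D] : Type u :=
  (List X' →₀ X' →₀ D) × (List X →₀ X →₀ D)

/-- The sign operator on the mapping cone. -/
noncomputable def signW (R X X' D : Type u) [CommRing R] [AddCommGroup D] [Module R D] :
    Module.End R (ConeT X X' D) :=
  (signL R (X' →₀ D) X').prodMap (-signL R (X →₀ D) X)

lemma signW_signW : signW R X X' D * signW R X X' D = 1 := by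
  refine LinearMap.ext fun v => Prod.ext ?_ ?_ <;> simp [signW, signL_signL]

lemma signW_tensW (k : ConeT X X' R) (c : D) :
    signW R X X' D (tensW k c) = tensW (signW R X X' R k) c := by
  refine Prod.ext ?_ ?_ <;> simp [signW, tensW, tens_def, mapT, signL_mapL]

/-- The degenerate part of the mapping cone. -/
noncomputable abbrev degW (R X X' D : Type u) [CommRing R] [AddCommGroup D] [Module R D] :
    Submodule R (ConeT X X' D) := (degT R X' D).prod (degT R X D)

/-- The filtration of the mapping cone by the number of letters. -/
noncomputable abbrev filW (R X X' D : Type u) [CommRing R] [AddCommGroup D] [Module R D] (q : ℕ) :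
    Submodule R (ConeT X X' D) := (filT R X' D q).prod (filT R X D (q - 1))

lemma tensW_zero (c : D) : tensW (0 : ConeT X X' R) c = 0 := by
  rw [← tensWL_apply, map_zero]

lemma tensW_add_sub (k₁ k₂ k₃ : ConeT X X' R) (c : D) :
    tensW (k₁ + k₂ - k₃) c = tensW k₁ c + tensW k₂ c - tensW k₃ c := by
  refine Prod.ext ?_ ?_ <;> simp [tensW, tens_def]

lemma tensW_mem_degW {k : ConeT X X' R} (hk : k ∈ degW R X X' R) (c : D) :
    tensW k c ∈ degW R X X' D :=
  ⟨tens_mem_degT hk.1 c, tens_mem_degT hk.2 c⟩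

lemma tensW_basW (i : (List X' × X') ⊕ (List X × X)) (r : R) :
    tensW (basW R X X' i) r = r • basW R X X' i := by
  conv_lhs => rw [← mul_one r, ← smul_eq_mul, map_smul, tensW_basW_one]

lemma basW_mem_degW {i : (List X' × X') ⊕ (List X × X)} (h : basBad X X' i) :
    basW R X X' i ∈ degW R X X' R := by
  rcases i with ⟨z, t⟩ | ⟨z, t⟩
  · exact ⟨single_mem_supT h _, zero_mem _⟩
  · exact ⟨zero_mem _, single_mem_supT h _⟩

end Spindleless

/-! ### Comparison of the twisted and untwisted differentials -/

section Untwisted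

variable {R : Type u} [CommRing R] {X X' : Type u} [Spindle X] [Spindle X'] {D : Type u}
  [AddCommGroup D] [Module R D]

/-- The untwisted deletion of letters. -/
noncomputable def delU (R X D : Type u) [CommRing R] [Spindle X] [AddCommGroup D] [Module R D] :
    (List X →₀ X →₀ D) →ₗ[R] (List X →₀ X →₀ D) :=
  twist 0 (eMap id fun _ => LinearMap.id) fun x => eMap (Spindle.op · x) fun _ => LinearMap.id

lemma mapT_delU {D' : Type u} [AddCommGroup D'] [Module R D'] (f : D →ₗ[R] D')
    (v : List X →₀ X →₀ D) : mapT id f (delU R X D v) = delU R X D' (mapT id f v) := by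
  have := DGAct.mapT_twist (φ := (id : X → X)) (f := f) (b := 0) (b' := 0)
    (g := fun _ => LinearMap.id) (g' := fun _ => LinearMap.id) (fun _ _ => rfl)
    (fun _ => by simp) (fun _ _ => rfl) v
  rw [eMap_zero, eMap_zero] at this
  exact this

lemma ground_dT : (DGAct.ground R X).dT = delU R X R := by
  simp only [DGAct.dT, DGAct.ground, delU, eMap_zero]

lemma ground_grT_apply {n : ℤ} {k : List X →₀ X →₀ R} (hk : k ∈ (DGAct.ground R X).grT n)
    {z : List X} {t : X} (h : (z.length : ℤ) ≠ n) : k z t = 0 := by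
  have := hk z t
  simpa [DGAct.ground, show ¬ n - (z.length : ℤ) = 0 by omega] using this

/-- Each action map is the identity minus the anticommutator of d with its homotopy, and the
deletion operator depends linearly on the action maps. -/
lemma DGAct.del_eq (S : DGAct R X D) (v : List X →₀ X →₀ D) :
    S.del v = delU R X D v - (S.coefD (S.homT v) + S.homT (S.coefD v)) := by
  rw [coefD, homT, coefL_twist_add, delU, twist_sub, del]
  have ext {f g : (X →₀ D) →ₗ[R] (X →₀ D)} (h : ∀ t c, f (Finsupp.single t c) =
      g (Finsupp.single t c)) : f = g := Finsupp.lhom_ext h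
  have key : ∀ x c, S.act x c = c - (S.d (S.hom x c) + S.hom x (S.d c)) := fun x c => by
    rw [S.d_hom, sub_sub_cancel]
  congr 1
  congr 1
  · simp
  · refine ext fun t c => ?_
    simp [key t c, Finsupp.single_sub, Finsupp.single_add]
  · funext x
    refine ext fun t c => ?_
    simp [key x c, Finsupp.single_sub, Finsupp.single_add]

variable (S : DGAct R X' D) (φ : SpindleHom X X')

/-- The untwisted differential on the mapping cone. -/
noncomputable def delUW (R D : Type u) [CommRing R] [AddCommGroup D] [Module R D]
    (φ : SpindleHom X X') : Module.End R (ConeT X X' D) :=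
  coneD (delU R X D) (delU R X' D) (mapT φ.toFun LinearMap.id)

namespace DGAct

/-- The differential of `D` on the mapping cone. -/
noncomputable def coefW : Module.End R (ConeT X X' D) := S.coefD.prodMap (S.comap φ).coefD

/-- The homotopy on the mapping cone. -/
noncomputable def homW : Module.End R (ConeT X X' D) := S.homT.prodMap (-(S.comap φ).homT)

/-- The twisted deletion of letters on the mapping cone. -/
noncomputable def delW : Module.End R (ConeT X X' D) :=
  coneD (S.comap φ).del S.del (mapT φ.toFun LinearMap.id)

/-- The differential of the mapping cone. -/
noncomputable def dW : Module.End R (ConeT X X' D) :=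
  coneD (S.comap φ).dT S.dT (mapT φ.toFun LinearMap.id)

lemma dW_eq : S.dW φ = signW R X X' D * S.coefW φ + S.delW φ := by
  refine LinearMap.ext fun v => Prod.ext ?_ ?_
  · simp [dW, signW, coefW, delW, dT_eq, add_assoc]
  · simp [dW, signW, coefW, delW, dT_eq, add_comm]

lemma delW_eq : S.delW φ = delUW R D φ - (S.coefW φ * S.homW φ + S.homW φ * S.coefW φ) := by
  refine LinearMap.ext fun v => Prod.ext ?_ ?_
  · simp [delW, delUW, coefW, homW, del_eq]
    abel
  · simp [delW, delUW, coefW, homW, del_eq]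
    abel

lemma signW_coefW : signW R X X' D * S.coefW φ = S.coefW φ * signW R X X' D := by
  refine LinearMap.ext fun v => Prod.ext ?_ ?_ <;> simp [signW, coefW, coefD, signL_coefL]

lemma signW_homW : signW R X X' D * S.homW φ = -(S.homW φ * signW R X X' D) := by
  refine LinearMap.ext fun v => Prod.ext ?_ ?_ <;> simp [signW, homW, homT, signL_twist]

lemma mapT_comap_dT (v : List X →₀ X →₀ D) :
    mapT φ.toFun (LinearMap.id : D →ₗ[R] D) ((S.comap φ).dT v) =
      S.dT (mapT φ.toFun (LinearMap.id : D →ₗ[R] D) v) :=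
  mapT_twist (f := LinearMap.id) (b := S.d) (b' := S.d) (g := (S.comap φ).act) (g' := S.act)
    φ.map_op
    (fun _ => rfl) (fun _ _ => rfl) v

lemma dW_dW (v : ConeT X X' D) : S.dW φ (S.dW φ v) = 0 := by
  refine Prod.ext ?_ ?_ <;> simp [dW, dT_dT, mapT_comap_dT]

end DGAct

/-- The untwisted cone differential is the identity of D tensored with the one over R, so a
contraction over R extends to any coefficients. -/
lemma delUW_tensW (k : ConeT X X' R) (c : D) :
    delUW R D φ (tensW k c) = tensW (delUW R R φ k) c := by
  have h : mapT φ.toFun (LinearMap.id : D →ₗ[R] D) (tens k.2 c) =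
      tens (mapT φ.toFun (LinearMap.id : R →ₗ[R] R) k.2) c := by
    exact hom_ext_single (L := mapT φ.toFun LinearMap.id ∘ₗ
        mapT id (LinearMap.toSpanSingleton R D c))
      (L' := mapT id (LinearMap.toSpanSingleton R D c) ∘ₗ mapT φ.toFun LinearMap.id)
      (fun z t r => by simp) k.2
  refine Prod.ext ?_ ?_
  · simp only [delUW, tensW, coneD_apply, LinearMap.prod_apply]
    simpa [tens_def, mapT_delU] using h
  · simp only [delUW, tensW, coneD_apply, LinearMap.prod_apply, Function.prod]
    simp [tens_def, mapT_delU]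

lemma coefW_tensW (k : ConeT X X' R) (c : D) :
    S.coefW φ (tensW k c) = tensW k (S.d c) := by
  have h : ∀ {Y : Type u} (k : List Y →₀ Y →₀ R),
      coefL Y (eMap id fun _ => S.d) (tens k c) = tens k (S.d c) := by
    intro Y k
    rw [tens_def, tens_def, ← LinearMap.comp_apply]
    exact hom_ext_single (fun z t r => by simp) k
  refine Prod.ext ?_ ?_
  · simp only [DGAct.coefW, tensW, LinearMap.prodMap_apply, LinearMap.prod_apply]
    exact h k.1
  · simp only [DGAct.coefW, tensW, LinearMap.prodMap_apply, LinearMap.prod_apply]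
    exact h k.2

/-- The graded pieces of the mapping cone. -/
noncomputable def DGAct.grW (n : ℤ) : Submodule R (ConeT X X' D) :=
  (S.grT n).prod ((S.comap φ).grT (n - 1))

/-- The graded pieces of the mapping cone with coefficients in the ground ring. -/
noncomputable abbrev grK (R X X' : Type u) [CommRing R] [Spindle X] [Spindle X'] (n : ℤ) :
    Submodule R (ConeT X X' R) :=
  ((DGAct.ground R X').grT n).prod ((DGAct.ground R X).grT (n - 1))

lemma tens_mem_grT (S : DGAct R X D) {m j : ℤ} {k : List X →₀ X →₀ R}
    (hk : k ∈ (DGAct.ground R X).grT m) {c : D} (hc : c ∈ S.gr j) :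
    tens k c ∈ S.grT (m + j) := by
  rw [tens_def]
  refine map_mem_of_mem_famT _ (fun z t r hr => ?_) hk
  rw [mapT_single]
  refine single_mem_famT ?_
  rw [LinearMap.toSpanSingleton_apply]
  by_cases h : m - (z.length : ℤ) = 0
  · refine Submodule.smul_mem _ _ ?_
    rwa [List.length_map, show m + j - (z.length : ℤ) = j by omega]
  · simp only [DGAct.ground, h, if_false, Submodule.mem_bot] at hr
    rw [hr, zero_smul]
    exact zero_mem _

lemma tens_mem_filT {m : ℤ} {q : ℕ} (hm : m < q) {k : List X →₀ X →₀ R}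
    (hk : k ∈ (DGAct.ground R X).grT m) (c : D) : tens k c ∈ filT R X D q := by
  rw [tens_def, mem_supT]
  intro z t hz
  rw [mapT_id_apply, ground_grT_apply hk, map_zero]
  intro h
  exact hz (Or.inr (by omega))

lemma tensW_mem_filW {m q : ℕ} (hm : m < q) {k : ConeT X X' R} (hk : k ∈ grK R X X' m) (c : D) :
    tensW k c ∈ filW R X X' D q :=
  ⟨tens_mem_filT (by omega) hk.1 c, tens_mem_filT (by omega) hk.2 c⟩

lemma tensW_mem_grW {m j : ℤ} {k : ConeT X X' R} (hk : k ∈ grK R X X' m) {c : D}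
    (hc : c ∈ S.gr j) : tensW k c ∈ S.grW φ (m + j) :=
  ⟨tens_mem_grT S hk.1 hc, by
    have := tens_mem_grT (S.comap φ) hk.2 hc
    rwa [show m - 1 + j = m + j - 1 by ring] at this⟩

/-- The sign records the cone degree. In the second summand a word of length m - 1 sits in degree m,
which explains the extra minus sign there. -/
lemma signW_of_mem_grK {m : ℕ} {k : ConeT X X' R} (hk : k ∈ grK R X X' m) :
    signW R X X' R k = (-1 : R) ^ m • k := by
  refine Prod.ext (Finsupp.ext fun z => Finsupp.ext fun t => ?_)
    (Finsupp.ext fun z => Finsupp.ext fun t => ?_)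
  · simp only [signW, LinearMap.prodMap_apply, signL_apply, Prod.smul_fst, Finsupp.smul_apply]
    by_cases h : (z.length : ℤ) = m
    · rw [show z.length = m by omega]
    · rw [ground_grT_apply hk.1 h, smul_zero, smul_zero]
  · simp only [signW, LinearMap.prodMap_apply, LinearMap.neg_apply, Finsupp.neg_apply, signL_apply,
      Prod.smul_snd, Finsupp.smul_apply]
    by_cases h : (z.length : ℤ) = m - 1
    · rw [show m = z.length + 1 by omega, pow_succ, mul_neg_one, neg_smul]
    · rw [ground_grT_apply hk.2 h, smul_zero, smul_zero, neg_zero]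

lemma basW_mem_grK (i : (List X' × X') ⊕ (List X × X)) :
    basW R X X' i ∈ grK R X X' (basDeg X X' i) := by
  rcases i with ⟨z, t⟩ | ⟨z, t⟩
  · exact ⟨single_mem_famT (by simp [DGAct.ground, basDeg]), zero_mem _⟩
  · exact ⟨zero_mem _, single_mem_famT (by simp [DGAct.ground, basDeg])⟩

lemma grK_induction {n : ℤ} (L : ConeT X X' R →ₗ[R] ConeT X X' R)
    (U : Submodule R (ConeT X X' R))
    (h : ∀ i, (basDeg X X' i : ℤ) = n → L (basW R X X' i) ∈ U) :
    ∀ v ∈ grK R X X' n, L v ∈ U := by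
  intro v hv
  refine mem_of_famT_prod L (fun z t r hr => ?_) (fun z t r hr => ?_) hv
  · rw [tensW_basW, map_smul]
    by_cases hz : n - (z.length : ℤ) = 0
    · exact U.smul_mem _ (h _ (by simp only [basDeg]; omega))
    · simp only [DGAct.ground, hz, if_false, Submodule.mem_bot] at hr
      simp [hr]
  · rw [tensW_basW, map_smul]
    by_cases hz : n - 1 - (z.length : ℤ) = 0
    · exact U.smul_mem _ (h _ (by simp only [basDeg]; push_cast; omega))
    · simp only [DGAct.ground, hz, if_false, Submodule.mem_bot] at hr
      simp [hr]

end Untwisted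


/-! ### Changing the spindle with fixed coefficients -/

variable {R : Type u} [CommRing R] {X X' : Type u} [Spindle X] [Spindle X'] {D : Type u}
  [AddCommGroup D] [Module R D]

lemma exists_mem_filT {X D : Type u} [AddCommGroup D] [Module R D] (v : List X →₀ X →₀ D) :
    ∃ q₀ : ℕ, ∀ q ≥ q₀, v ∈ filT R X D q := by
  refine ⟨v.support.sup List.length + 1, fun q hq => mem_supT.2 fun z t hz => ?_⟩
  by_contra hne
  have hzs : z ∈ v.support := by
    rw [Finsupp.mem_support_iff]; rintro h0; rw [h0] at hne; exact hne rfl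
  have := Finset.le_sup (f := List.length) hzs
  exact hz (Or.inr (by omega))

lemma filT_mono {X D : Type u} [AddCommGroup D] [Module R D] {q q' : ℕ} (h : q ≤ q') :
    filT R X D q ≤ filT R X D q' :=
  supT_mono fun _ _ => Or.imp_right fun h' => by omega

lemma filT_zero {X D : Type u} [AddCommGroup D] [Module R D] : filT R X D 0 = degT R X D := by
  simp only [filT, degT, Nat.not_lt_zero, or_false]

lemma filW_zero {X X' D : Type u} [AddCommGroup D] [Module R D] :
    filW R X X' D 0 = degW R X X' D := by
  rw [filW, filT_zero, filT_zero]

lemma signW_mem_filW {X X' D : Type u} [AddCommGroup D] [Module R D] {q : ℕ}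
    {v : ConeT X X' D} (hv : v ∈ filW R X X' D q) : signW R X X' D v ∈ filW R X X' D q :=
  ⟨signL_mem_famT hv.1, neg_mem (signL_mem_famT hv.2)⟩

namespace DGAct

variable (S : DGAct R X' D) (φ : SpindleHom X X')

lemma homW_mem_filW {q : ℕ} {v : ConeT X X' D} (hv : v ∈ filW R X X' D (q + 1)) :
    S.homW φ v ∈ filW R X X' D q :=
  ⟨S.homT_mem_filT hv.1, neg_mem ((S.comap φ).homT_mem_filT (filT_mono (by omega) hv.2))⟩

lemma delW_mem_filW {q : ℕ} {v : ConeT X X' D} (hv : v ∈ filW R X X' D (q + 1)) :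
    S.delW φ v ∈ filW R X X' D q :=
  ⟨add_mem (S.del_mem_filT hv.1) (mapT_mem_filT _ _ hv.2),
    neg_mem ((S.comap φ).del_mem_filT (filT_mono (by omega) hv.2))⟩

lemma dW_mem_degW {v : ConeT X X' D} (hv : v ∈ degW R X X' D) : S.dW φ v ∈ degW R X X' D :=
  ⟨add_mem (S.dT_mem_degT hv.1) (mapT_mem_degT _ _ hv.2), neg_mem ((S.comap φ).dT_mem_degT hv.2)⟩

lemma homW_mem_grW {n : ℤ} {v : ConeT X X' D} (hv : v ∈ S.grW φ n) : S.homW φ v ∈ S.grW φ n :=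
  ⟨S.homT_mem_grT hv.1, neg_mem ((S.comap φ).homT_mem_grT hv.2)⟩

lemma signW_mem_grW {n : ℤ} {v : ConeT X X' D} (hv : v ∈ S.grW φ n) :
    signW R X X' D v ∈ S.grW φ n :=
  ⟨signL_mem_famT hv.1, neg_mem (signL_mem_famT hv.2)⟩

lemma dW_mem_grW {n : ℤ} {v : ConeT X X' D} (hv : v ∈ S.grW φ n) :
    S.dW φ v ∈ S.grW φ (n - 1) :=
  ⟨add_mem (S.dT_mem_grT hv.1) (mapT_mem_grT (S.comap φ) S _ (fun _ _ h => h) hv.2),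
    neg_mem ((S.comap φ).dT_mem_grT hv.2)⟩

lemma delW_mem_grW {n : ℤ} {v : ConeT X X' D} (hv : v ∈ S.grW φ n) :
    S.delW φ v ∈ S.grW φ (n - 1) :=
  ⟨add_mem (S.del_mem_grT hv.1) (mapT_mem_grT (S.comap φ) S _ (fun _ _ h => h) hv.2),
    neg_mem ((S.comap φ).del_mem_grT hv.2)⟩

end DGAct

/-- Over the ground ring the action is the identity and d = 0, so the untwisted cone differential is
the true one. The cone is free, starts in degree 0 and is exact modulo degenerate words, which
suffices for a contraction. -/
lemma exists_contraction_cone (φ : SpindleHom X X')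
    (h : ∀ n, ConeExact (DGAct.ground R X).dT (DGAct.ground R X').dT
      (mapT φ.toFun (LinearMap.id : R →ₗ[R] R)) (DGAct.ground R X).grT (degT R X R)
      (DGAct.ground R X').grT (degT R X' R) n) (n : ℕ) :
    ∃ s : Module.End R (ConeT X X' R),
      (∀ i, s (basW R X X' i) ∈ grK R X X' (basDeg X X' i + 1)) ∧
      (∀ i, basBad X X' i → s (basW R X X' i) = 0) ∧
      ∀ i, basDeg X X' i < n → delUW R R φ (s (basW R X X' i)) +
        s (delUW R R φ (basW R X X' i)) - basW R X X' i ∈ degW R X X' R := by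
  have e : delUW R R φ = (DGAct.ground R X').dW φ := by
    rw [DGAct.dW, ground_dT]
    exact congrArg (fun d => coneD d _ _) ground_dT.symm
  rw [e]
  refine exists_contraction (basW R X X') (basDeg X X') (basBad X X') (grK R X X') _ _
    (fun g => ⟨liftW fun i => LinearMap.toSpanSingleton R _ (g i), fun i => ?_⟩) basW_mem_grK
    (fun n L U => grK_induction L U) (fun L U hL v hv => ?_) (fun i => basW_mem_degW)
    (fun n v => (DGAct.ground R X').dW_mem_grW φ) (fun v => (DGAct.ground R X').dW_mem_degW φ)
    ((DGAct.ground R X').dW_dW φ) (fun n v hv hdv => ?_) n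
  · conv_lhs => rw [← tensW_basW_one, liftW_tensW]
    simp
  · refine mem_of_supT_prod (U := ConeT X X' R) L (fun z t r hz => ?_) (fun z t r hz => ?_) hv
    · rw [tensW_basW, map_smul]; exact U.smul_mem _ (hL (.inl (z, t)) hz)
    · rw [tensW_basW, map_smul]; exact U.smul_mem _ (hL (.inr (z, t)) hz)
  · obtain ⟨w, hw, hvw⟩ := coneExact_iff.1 (h n) v hv hdv
    exact ⟨w, ⟨hw.1, by rw [add_sub_cancel_right]; exact hw.2⟩, hvw⟩

namespace DGAct

variable (S : DGAct R X' D)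

-- Only a contraction below a degree N that bounds the words of v is needed. Extended to D and
-- corrected by the homotopies of the action, it kills v up to degenerate terms and a remainder on
-- shorter words, to which induction on the length applies.
set_option maxHeartbeats 1600000 in
theorem coneExact_mapT_comap (φ : SpindleHom X X')
    (h : ∀ n, ConeExact (DGAct.ground R X).dT (DGAct.ground R X').dT
      (mapT φ.toFun (LinearMap.id : R →ₗ[R] R)) (DGAct.ground R X).grT (degT R X R)
      (DGAct.ground R X').grT (degT R X' R) n) (n : ℤ) :
    ConeExact (S.comap φ).dT S.dT (mapT φ.toFun LinearMap.id) (S.comap φ).grT (degT R X D)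
      S.grT (degT R X' D) n := by
  rw [coneExact_iff]
  intro v hv hdv
  obtain ⟨q₁, hq₁⟩ := exists_mem_filT (R := R) v.1
  obtain ⟨q₂, hq₂⟩ := exists_mem_filT (R := R) v.2
  obtain ⟨N, hvN⟩ : ∃ N, v ∈ filW R X X' D N :=
    ⟨q₁ + q₂ + 1, hq₁ _ (by omega), hq₂ _ (by omega)⟩
  obtain ⟨s₀, hs1, hs2, hs3⟩ := exists_contraction_cone φ h N
  set s : Module.End R (ConeT X X' D) := extW D s₀ with hs
  set ε := signW R X X' D
  set H := S.homW φ
  have hsB : ∀ i c, s (tensW (basW R X X' i) c) = tensW (s₀ (basW R X X' i)) c :=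
    fun i c => extW_tensW s₀ _ c
  have hsfil : ∀ {q} {w : ConeT X X' D}, w ∈ filW R X X' D q → s w ∈ filW R X X' D (q + 1) := by
    intro q w hw
    refine mem_of_supT_prod s (fun z t c hz => ?_) (fun z t c hz => ?_) hw
    · rw [hsB]
      rcases hz with hz | hz
      · rw [hs2 (.inl (z, t)) hz, tensW_zero]; exact zero_mem _
      · exact tensW_mem_filW (m := z.length + 1) (by omega)
          (by simpa [basDeg] using hs1 (.inl (z, t))) c
    · rw [hsB]
      rcases hz with hz | hz
      · rw [hs2 (.inr (z, t)) hz, tensW_zero]; exact zero_mem _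
      · exact tensW_mem_filW (m := z.length + 1 + 1) (by omega)
          (by simpa [basDeg] using hs1 (.inr (z, t))) c
  have hsdeg : ∀ {w : ConeT X X' D}, w ∈ degW R X X' D → s w = 0 := by
    intro w hw
    refine (Submodule.mem_bot R).1 (mem_of_supT_prod s (fun z t c hz => ?_) (fun z t c hz => ?_) hw)
    · rw [hsB, hs2 (.inl (z, t)) hz, tensW_zero]; exact zero_mem _
    · rw [hsB, hs2 (.inr (z, t)) hz, tensW_zero]; exact zero_mem _
  have hsgr : ∀ {m} {w : ConeT X X' D}, w ∈ S.grW φ m → s w ∈ S.grW φ (m + 1) := by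
    intro m w hw
    refine mem_of_famT_prod s (fun z t c hz => ?_) (fun z t c hz => ?_) hw
    · rw [hsB]
      have := tensW_mem_grW S φ (hs1 (.inl (z, t))) hz
      simp only [basDeg] at this
      rwa [show (z.length : ℤ) + 1 + (m - z.length) = m + 1 by ring] at this
    · rw [hsB]
      have := tensW_mem_grW S φ (hs1 (.inr (z, t))) hz
      simp only [basDeg] at this
      rwa [show ((z.length + 1 : ℕ) : ℤ) + 1 + (m - 1 - z.length) = m + 1 by push_cast; ring]
        at this
  -- The correction u preserves the length filtration, since s lengthens words by one and H shortens
  -- them by one.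
  set u : Module.End R (ConeT X X' D) := ε * (H * s + s * H) with hu
  have hufil : ∀ {q} {w : ConeT X X' D}, w ∈ filW R X X' D q → u w ∈ filW R X X' D q := by
    intro q w hw
    refine signW_mem_filW (add_mem (S.homW_mem_filW φ (hsfil hw)) ?_)
    rcases q with _ | q
    · have h0 : H w ∈ filW R X X' D 0 := S.homW_mem_filW φ
        ⟨filT_mono (by omega) hw.1, filT_mono (by omega) hw.2⟩
      rw [filW_zero] at h0
      rw [Module.End.mul_apply, hsdeg h0]
      exact zero_mem _
    · exact hsfil (S.homW_mem_filW φ hw)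
  have hugr : ∀ {m} {w : ConeT X X' D}, w ∈ S.grW φ m → u w ∈ S.grW φ (m + 1) := fun hw =>
    S.signW_mem_grW φ (add_mem (S.homW_mem_grW φ (hsgr hw)) (hsgr (S.homW_mem_grW φ hw)))
  have formula := homotopy_formula (s := s) (signW_signW (R := R) (X := X) (X' := X') (D := D))
    (S.signW_coefW φ) (S.signW_homW φ)
    (hom_ext_tensW fun i c => by
      have hi := signW_tensW (R := R) (basW R X X' i) c
      rw [signW_of_mem_grK (basW_mem_grK i)] at hi
      have hi' := signW_tensW (R := R) (s₀ (basW R X X' i)) c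
      rw [signW_of_mem_grK (m := basDeg X X' i + 1) (by push_cast; exact hs1 i)] at hi'
      rw [LinearMap.neg_apply, Module.End.mul_apply, Module.End.mul_apply, hsB, hi, hi',
        ← tensWL_apply, ← tensWL_apply, map_smul, map_smul, tensWL_apply, tensWL_apply, map_smul,
        hsB, pow_succ, mul_neg_one]
      exact neg_smul ((-1 : R) ^ basDeg X X' i) (tensW (s₀ (basW R X X' i)) c))
    (hom_ext_tensW fun i c => by
      rw [Module.End.mul_apply, Module.End.mul_apply, hsB, coefW_tensW, coefW_tensW, hsB])
    (S.delW_eq φ)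
  rw [← S.dW_eq φ, ← hu] at formula
  suffices key : ∀ q ≤ N, ∀ v ∈ filW R X X' D q, v ∈ S.grW φ n → S.dW φ v ∈ degW R X X' D →
      ∃ w ∈ S.grW φ (n + 1), v - S.dW φ w ∈ degW R X X' D by
    obtain ⟨w, hw, hvw⟩ := key N le_rfl v hvN hv hdv
    exact ⟨w, ⟨hw.1, by have := hw.2; rwa [add_sub_cancel_right] at this⟩, hvw⟩
  intro q
  induction q with
  | zero =>
    intro _ v hv0 _ _
    rw [filW_zero] at hv0
    exact ⟨0, zero_mem _, by simpa using hv0⟩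
  | succ q ih =>
    intro hq v hvq hv hdv
    -- Each basis element allowed by the filtration has cone degree below N or is degenerate, so the
    -- contraction identity is available on all of v.
    have hctr : (delUW R D φ * s + s * delUW R D φ - 1) v ∈ degW R X X' D := by
      have step : ∀ i c, (basDeg X X' i < N ∨ basBad X X' i) →
          (delUW R D φ * s + s * delUW R D φ - 1 : Module.End R (ConeT X X' D))
            (tensW (basW R X X' i) c) ∈ degW R X X' D := by
        intro i c hi
        have e : (delUW R D φ * s + s * delUW R D φ - 1 : Module.End R (ConeT X X' D))
            (tensW (basW R X X' i) c) = tensW (delUW R R φ (s₀ (basW R X X' i)) +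
              s₀ (delUW R R φ (basW R X X' i)) - basW R X X' i) c := by
          rw [LinearMap.sub_apply, LinearMap.add_apply, Module.End.mul_apply, Module.End.mul_apply,
            hsB, delUW_tensW, delUW_tensW, hs, extW_tensW, Module.End.one_apply]
          exact (tensW_add_sub _ _ _ c).symm
        rcases hi with hi | hi
        · rw [e]; exact tensW_mem_degW (hs3 i hi) c
        · rw [LinearMap.sub_apply, LinearMap.add_apply, Module.End.mul_apply, Module.End.mul_apply,
            Module.End.one_apply, hsB, hs2 i hi, tensW_zero, map_zero, zero_add]
          refine sub_mem ?_ (tensW_mem_degW (basW_mem_degW hi) c)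
          rw [hsdeg]
          · exact zero_mem _
          · rw [delUW_tensW]
            refine tensW_mem_degW ?_ c
            have e : delUW R R φ = (DGAct.ground R X').dW φ := by
              rw [DGAct.dW, ground_dT]
              exact congrArg (fun d => coneD d _ _) ground_dT.symm
            rw [e]
            exact (DGAct.ground R X').dW_mem_degW φ (basW_mem_degW hi)
      refine mem_of_supT_prod _ (fun z t c hz => ?_) (fun z t c hz => ?_) hvq
      · exact step _ c (hz.symm.imp (fun h => by simp only [basDeg]; omega) id)
      · exact step _ c (hz.symm.imp (fun h => by simp only [basDeg]; omega) id)
    have hv' := LinearMap.congr_fun formula v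
    simp only [LinearMap.add_apply, Module.End.mul_apply, LinearMap.sub_apply,
      Module.End.one_apply] at hv' hctr
    have hu0 : u (S.dW φ v) ∈ degW R X X' D := by
      rw [← filW_zero] at hdv ⊢
      exact hufil hdv
    rw [hsdeg hdv, zero_add] at hv'
    -- Modulo degenerate terms v₁ is v minus the boundary of s v + u v. It has lower filtration,
    -- because `delW` shortens words and u does not lengthen them.
    set v₁ := -(S.delW φ (u v) + u (S.delW φ v)) with hv₁
    have e₁ : v₁ = v - S.dW φ (s v + u v) + (delUW R D φ (s v) + s (delUW R D φ v) - v -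
        u (S.dW φ v)) := by
      rw [hv₁, eq_sub_of_add_eq hv']; abel
    have hv₁gr : v₁ ∈ S.grW φ n := by
      refine neg_mem (add_mem ?_ ?_)
      · simpa using S.delW_mem_grW φ (hugr hv)
      · simpa using hugr (S.delW_mem_grW φ hv)
    obtain ⟨w, hw, hvw⟩ := ih (by omega) v₁
      (neg_mem (add_mem (S.delW_mem_filW φ (hufil hvq)) (hufil (S.delW_mem_filW φ hvq)))) hv₁gr
      (by
        rw [e₁, map_add, map_sub, S.dW_dW, sub_zero]
        exact add_mem hdv (S.dW_mem_degW φ (sub_mem hctr hu0)))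
    refine ⟨w + (s v + u v), add_mem hw (add_mem (hsgr hv) (hugr hv)), ?_⟩
    have := sub_mem hvw (sub_mem hctr hu0)
    rw [e₁] at this
    convert this using 1
    rw [map_add]
    abel

end DGAct


/-! ### Chains supported on a set of words -/

section Supported

variable {R : Type u} [CommRing R] {I M V : Type u} [AddCommGroup M] [Module R M]
  [AddCommGroup V] [Module R V]

lemma map_mem_of_mem_supported {s : Set I} {U : Submodule R V} (L : (I →₀ M) →ₗ[R] V)
    (h : ∀ i ∈ s, ∀ m, L (Finsupp.single i m) ∈ U) {v : I →₀ M} (hv : v ∈ Finsupp.supported M R s) :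
    L v ∈ U := by
  rw [← Finsupp.sum_single v, Finsupp.sum, map_sum]
  exact sum_mem fun i hi => h i ((Finsupp.mem_supported R v).1 hv hi) _

lemma mem_supported_iff {s : Set I} {v : I →₀ M} :
    v ∈ Finsupp.supported M R s ↔ ∀ i, v i ≠ 0 → i ∈ s := by
  rw [Finsupp.mem_supported]
  exact forall_congr' fun i => by simp

end Supported

/-! ### Position of a repetition in a word -/

/-- The list has two equal neighbours among its first `q + 1` letters. -/
inductive DegAt {X : Type u} : ℕ → List X → Prop
  | here (q : ℕ) (x : X) (l : List X) : DegAt (q + 1) (x :: x :: l)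
  | cons {q : ℕ} (x : X) {l : List X} : DegAt q l → DegAt (q + 1) (x :: l)

section DegAt

variable {X : Type u}

lemma DegAt.mono {q q' : ℕ} {l : List X} (h : DegAt q l) (hq : q ≤ q') : DegAt q' l := by
  induction h generalizing q' with
  | here q x l =>
    obtain ⟨q', rfl⟩ : ∃ p, q' = p + 1 := ⟨q' - 1, by omega⟩
    exact .here _ _ _
  | cons x _ ih =>
    obtain ⟨q', rfl⟩ : ∃ p, q' = p + 1 := ⟨q' - 1, by omega⟩
    exact .cons _ (ih (by omega))

lemma Degen.exists_degAt {l : List X} (h : Degen l) : ∃ q, DegAt q l := by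
  induction h with
  | here x l => exact ⟨1, .here 0 x l⟩
  | cons x _ ih => obtain ⟨q, hq⟩ := ih; exact ⟨q + 1, .cons x hq⟩

/-- A repetition either occurs earlier or occupies exactly positions q and q + 1; the second form is
the leading word of a spliced chain. -/
lemma DegAt.exists_eq {q : ℕ} {l : List X} (h : DegAt (q + 1) l) :
    DegAt q l ∨ ∃ z t y, z.length = q ∧ l = z ++ t :: t :: y := by
  induction q generalizing l with
  | zero =>
    cases h with
    | here _ x l => exact .inr ⟨[], x, l, rfl, rfl⟩
    | cons x h => cases h
  | succ q ih =>
    cases h with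
    | here _ x l => exact .inl (.here _ _ _)
    | cons x h =>
      rcases ih h with h | ⟨z, t, y, hz, rfl⟩
      · exact .inl (.cons _ h)
      · exact .inr ⟨x :: z, t, y, by simp [hz], rfl⟩

lemma degAt_append (z : List X) (t : X) (y : List X) :
    DegAt (z.length + 1) (z ++ t :: t :: y) := by
  induction z with
  | nil => exact .here _ _ _
  | cons x z ih => exact .cons _ ih

lemma degAt_cons_cons {q : ℕ} {x y : X} {l : List X} (h : DegAt (q + 1) (x :: y :: l)) :
    x = y ∨ DegAt q (y :: l) := by
  cases h with
  | here => exact .inl rfl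
  | cons _ h => exact .inr h

/-- The first |z| + 1 letters of the word are those of z followed by t, so the repetition already
lies there. -/
lemma DegAt.degen_append {z : List X} {t : X} {y : List X} {q : ℕ}
    (h : DegAt q (z ++ t :: t :: y)) (hq : q ≤ z.length) : Degen (z ++ [t]) := by
  induction z generalizing q with
  | nil =>
    obtain rfl : q = 0 := by simpa using hq
    cases h
  | cons x z ih =>
    rcases q with _ | q
    · cases h
    · rw [List.length_cons, Nat.add_le_add_iff_right] at hq
      rcases z with _ | ⟨w, z⟩
      · rcases degAt_cons_cons h with rfl | h
        · exact .here _ _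
        · exact .cons _ (ih h hq)
      · rcases degAt_cons_cons h with rfl | h
        · exact .here _ _
        · exact .cons _ (ih h hq)

end DegAt

/-! ### The augmented rack complex and the splicing isomorphism -/

section Chains

variable {R : Type u} [CommRing R] {X X' : Type u} [Spindle X] [Spindle X'] {M : Type u}
  [AddCommGroup M] [Module R M]

/-- The augmented rack differential on `M ⊗ R⟨List X⟩`. -/
noncomputable def dC (A : Action R X M) : (List X →₀ M) →ₗ[R] (List X →₀ M) :=
  twist 0 LinearMap.id A.act

/-- Chains supported on lists of length `n`. -/
noncomputable def grC (R X M : Type u) [CommRing R] [AddCommGroup M] [Module R M] (n : ℤ) :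
    Submodule R (List X →₀ M) :=
  Finsupp.supported M R {l | (l.length : ℤ) = n}

/-- Chains supported on degenerate lists. -/
noncomputable def degC (R X M : Type u) [CommRing R] [AddCommGroup M] [Module R M] :
    Submodule R (List X →₀ M) :=
  Finsupp.supported M R {l | Degen l}

lemma single_mem_grC {X : Type u} {n : ℤ} {l : List X} (h : (l.length : ℤ) = n) (m : M) :
    Finsupp.single l m ∈ grC R X M n := Finsupp.single_mem_supported R m h

lemma single_mem_degC {X : Type u} {l : List X} (h : Degen l) (m : M) :
    Finsupp.single l m ∈ degC R X M := Finsupp.single_mem_supported R m h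

lemma dC_dC (A : Action R X M) (v : List X →₀ M) : dC A (dC A v) = 0 :=
  twist_twist (b := 0) (β := LinearMap.id) (γ := A.act) (fun _ => rfl) (fun _ => rfl)
    (fun x _ => (map_zero (A.act x)).symm) (fun _ _ => rfl) (fun x y e => A.act_act e x y) v

lemma dC_consL (A : Action R X M) (x : X) (v : List X →₀ M) :
    dC A (consL R M x v) = v - mapL (Spindle.op · x) (A.act x) v - consL R M x (dC A v) := by
  have h : coefL X (LinearMap.id : M →ₗ[R] M) v = v := by
    rw [coefL]; simp
  rw [dC, twist_consL, h]

lemma dC_mem_grC (A : Action R X M) {n : ℤ} {v : List X →₀ M} (hv : v ∈ grC R X M n) :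
    dC A v ∈ grC R X M (n - 1) := by
  refine map_mem_of_mem_supported _ (fun l hl m => ?_) hv
  rw [grC, mem_supported_iff]
  intro w hw
  have h := (twist_single_mem (β := LinearMap.id) (γ := A.act) ⊤ m trivial (fun _ => trivial) l
    w).2
  simp only [Set.mem_ofPred_eq] at hl ⊢
  by_contra hne
  exact hw (h (by omega))

lemma mapL_mem_grC {X X' : Type u} (φ : X → X') (g : M →ₗ[R] M) {n : ℤ} {v : List X →₀ M}
    (hv : v ∈ grC R X M n) : mapL φ g v ∈ grC R X' M n := by
  refine map_mem_of_mem_supported _ (fun l hl m => ?_) hv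
  rw [mapL_single]
  exact single_mem_grC (by simpa using hl) _

lemma consL_mem_grC {X : Type u} (x : X) {n : ℤ} {v : List X →₀ M} (hv : v ∈ grC R X M n) :
    consL R M x v ∈ grC R X M (n + 1) := by
  refine map_mem_of_mem_supported _ (fun l hl m => ?_) hv
  rw [consL_single]
  refine single_mem_grC ?_ _
  rw [Set.mem_ofPred_eq] at hl
  simp [hl]

lemma consL_mem_degC {X : Type u} (x : X) {v : List X →₀ M} (hv : v ∈ degC R X M) :
    consL R M x v ∈ degC R X M := by
  refine map_mem_of_mem_supported _ (fun l hl m => ?_) hv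
  rw [consL_single]
  exact single_mem_degC (.cons x hl) _

lemma mapL_comap_dC (A : Action R X' M) (φ : SpindleHom X X') (v : List X →₀ M) :
    mapL φ.toFun (LinearMap.id : M →ₗ[R] M) (dC (A.comap φ) v) =
      dC A (mapL φ.toFun (LinearMap.id : M →ₗ[R] M) v) :=
  mapL_twist (b := 0) (β := LinearMap.id) (γ := (A.comap φ).act) (b' := 0) (β' := LinearMap.id)
    (γ' := A.act) (g := LinearMap.id) φ.map_op (fun _ => rfl) (fun _ => rfl) (fun _ _ => rfl) v

lemma dC_mapL (A : Action R X M) (x : X) (v : List X →₀ M) :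
    dC A (mapL (Spindle.op · x) (A.act x) v) = mapL (Spindle.op · x) (A.act x) (dC A v) :=
  (mapL_twist (b := 0) (β := LinearMap.id) (γ := A.act) (b' := 0) (β' := LinearMap.id)
    (γ' := A.act) (g := A.act x) (φ := (Spindle.op · x)) (fun y w => Spindle.distrib y w x)
    (fun _ => map_zero (A.act x)) (fun _ => rfl) (fun y e => A.act_act e y x) v).symm

lemma mapL_act_act (A : Action R X M) (v : List X →₀ M) (x y : X) :
    mapL (Spindle.op · y) (A.act y) (mapL (Spindle.op · x) (A.act x) v) =
      mapL (Spindle.op · (Spindle.op x y)) (A.act (Spindle.op x y))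
        (mapL (Spindle.op · y) (A.act y) v) := by
  suffices h : mapL (Spindle.op · y) (A.act y) ∘ₗ mapL (Spindle.op · x) (A.act x) =
      mapL (Spindle.op · (Spindle.op x y)) (A.act (Spindle.op x y)) ∘ₗ
        mapL (Spindle.op · y) (A.act y) from LinearMap.congr_fun h v
  refine Finsupp.lhom_ext fun z m => ?_
  simp only [LinearMap.comp_apply, mapL_single, A.act_act m x y, List.map_map]
  congr 2
  exact funext fun w => Spindle.distrib w x y

/-- The augmented rack complex as a differential graded module with a homotopically trivial
action. -/
noncomputable def chainDG (A : Action R X M) : DGAct R X (List X →₀ M) where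
  d := dC A
  act x := mapL (Spindle.op · x) (A.act x)
  hom x := consL R M x
  gr := grC R X M
  d_d := dC_dC A
  d_act := dC_mapL A
  act_act := mapL_act_act A
  d_hom x c := by rw [dC_consL]; abel
  d_mem _ _ := dC_mem_grC A
  act_mem _ _ _ := mapL_mem_grC _ _
  hom_mem _ x _ := consL_mem_grC x

/-- The coefficient of `(z, t)` in the map `splice`. -/
noncomputable def spliceOn (R M : Type u) {X : Type u} [CommRing R] [AddCommGroup M] [Module R M] :
    List X → X → (List X →₀ M) →ₗ[R] (List X →₀ M)
  | [], t => consL R M t ∘ₗ consL R M t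
  | x :: z, t => (consL R M x - consL R M (z.headD t)) ∘ₗ spliceOn R M z t

/-- The map `c ⊗ (t, z_q, …, z_0) ↦ (c, t, t, z_q - t, z_{q-1} - z_q, …, z_0 - z_1)`. -/
noncomputable def splice (R X M : Type u) [CommRing R] [AddCommGroup M] [Module R M] :
    (List X →₀ X →₀ List X →₀ M) →ₗ[R] (List X →₀ M) :=
  Finsupp.lsum R fun z => Finsupp.lsum R fun t => spliceOn R M z t

@[simp] lemma splice_single {X : Type u} (z : List X) (t : X) (c : List X →₀ M) :
    splice R X M (Finsupp.single z (Finsupp.single t c)) = spliceOn R M z t c := by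
  simp only [splice, Finsupp.lsum_single]

lemma mapL_spliceOn {X X' : Type u} (φ : X → X') (g : M →ₗ[R] M) (z : List X) (t : X)
    (c : List X →₀ M) :
    mapL φ g (spliceOn R M z t c) = spliceOn R M (z.map φ) (φ t) (mapL φ g c) := by
  induction z with
  | nil => simp [spliceOn, mapL_consL]
  | cons x z ih =>
    have h : (z.map φ).headD (φ t) = φ (z.headD t) := by cases z <;> rfl
    simp only [spliceOn, List.map_cons, LinearMap.comp_apply, LinearMap.sub_apply, map_sub,
      mapL_consL, ih, h]

/-- A repetition in z followed by t makes one of the factors (letter minus next letter) vanish. -/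
lemma spliceOn_eq_zero {X : Type u} {z : List X} {t : X} (h : Degen (z ++ [t]))
    (c : List X →₀ M) : spliceOn R M z t c = 0 := by
  induction z with
  | nil => exact absurd h not_degen_singleton
  | cons x z ih =>
    rcases z with _ | ⟨w, z⟩
    · rw [List.singleton_append, degen_cons_cons, or_iff_left not_degen_singleton] at h
      subst h
      simp [spliceOn]
    · rw [List.cons_append, List.cons_append, degen_cons_cons] at h
      rcases h with rfl | h
      · simp [spliceOn]
      · rw [spliceOn, LinearMap.comp_apply, ih h, map_zero]

lemma spliceOn_mem_degC {X : Type u} (z : List X) (t : X) (c : List X →₀ M) :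
    spliceOn R M z t c ∈ degC R X M := by
  induction z with
  | nil =>
    refine map_mem_of_mem_supported (s := Set.univ) _ (fun l _ m => ?_) (by simp)
    simp only [spliceOn, LinearMap.comp_apply, consL_single]
    exact single_mem_degC (.here _ _) _
  | cons x z ih => exact sub_mem (consL_mem_degC _ ih) (consL_mem_degC _ ih)

lemma spliceOn_mem_grC {X : Type u} (z : List X) (t : X) {n : ℤ} {c : List X →₀ M}
    (hc : c ∈ grC R X M n) : spliceOn R M z t c ∈ grC R X M (n + z.length + 2) := by
  induction z with
  | nil =>
    have := consL_mem_grC t (consL_mem_grC t hc)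
    rwa [show n + 1 + 1 = n + (([] : List X).length : ℤ) + 2 by simp; ring] at this
  | cons x z ih =>
    rw [show n + ((x :: z).length : ℤ) + 2 = n + z.length + 2 + 1 by
      rw [List.length_cons]; push_cast; ring]
    exact sub_mem (consL_mem_grC _ ih) (consL_mem_grC _ ih)

/-- Prepending x subtracts the letter that comes next, which `splice` of an arbitrary chain no
longer reveals. Fixing that letter to be w gives a closed formula. -/
lemma splice_consL_consL {X : Type u} (x w : X) (v : List X →₀ X →₀ List X →₀ M) :
    splice R X M (consL R _ x (consL R _ w v)) =
      consL R M x (splice R X M (consL R _ w v)) - consL R M w (splice R X M (consL R _ w v)) := by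
  suffices h : splice R X M ∘ₗ consL R _ x ∘ₗ consL R _ w =
      (consL R M x - consL R M w) ∘ₗ splice R X M ∘ₗ consL R _ w from LinearMap.congr_fun h v
  refine LinearMap.ext (hom_ext_single fun z t c => ?_)
  simp only [LinearMap.comp_apply, consL_single, splice_single, spliceOn, List.headD_cons]

lemma DGAct.dT_nil {D : Type u} [AddCommGroup D] [Module R D] (S : DGAct R X D) (t : X) (c : D) :
    S.dT (Finsupp.single [] (Finsupp.single t c)) =
      Finsupp.single [] (Finsupp.single t (S.d c)) := by
  rw [DGAct.dT, twist_nil, eMap_single, id]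

lemma DGAct.dT_cons {D : Type u} [AddCommGroup D] [Module R D] (S : DGAct R X D) (x : X)
    (z : List X) (t : X) (c : D) :
    S.dT (Finsupp.single (x :: z) (Finsupp.single t c)) =
      Finsupp.single z (Finsupp.single t (S.act t c)) -
      Finsupp.single (z.map (Spindle.op · x)) (Finsupp.single (Spindle.op t x) (S.act x c)) -
      consL R _ x (S.dT (Finsupp.single z (Finsupp.single t c))) := by
  rw [DGAct.dT, twist_cons, eMap_single, eMap_single, id]

lemma DGAct.map_dT_cons {D V : Type u} [AddCommGroup D] [Module R D] [AddCommGroup V] [Module R V]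
    (S : DGAct R X D) (L : (List X →₀ X →₀ D) →ₗ[R] V) (x : X) (z : List X) (t : X) (c : D) :
    L (S.dT (Finsupp.single (x :: z) (Finsupp.single t c))) =
      L (Finsupp.single z (Finsupp.single t (S.act t c))) -
      L (Finsupp.single (z.map (Spindle.op · x)) (Finsupp.single (Spindle.op t x) (S.act x c))) -
      L (consL R _ x (S.dT (Finsupp.single z (Finsupp.single t c)))) := by
  rw [DGAct.dT_cons, map_sub, map_sub]

lemma chainDG_d (A : Action R X M) : (chainDG A).d = dC A := rfl

lemma chainDG_act (A : Action R X M) (x : X) :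
    (chainDG A).act x = mapL (Spindle.op · x) (A.act x) := rfl

/-- This computation dictates the twisted differential. When a difference x - t is deleted in front
of (c, t, t), the two plain deletions cancel, and the starred ones leave (c ⋆ t, t, t) minus (c, t,
t) ⋆ x. Hence the plain face acts on the coefficient by t and the starred face by x. -/
lemma splice_dT_single (A : Action R X M) (z : List X) (t : X) (c : List X →₀ M) :
    splice R X M ((chainDG A).dT (Finsupp.single z (Finsupp.single t c))) =
      dC A (spliceOn R M z t c) := by
  have hact : ∀ (z : List X) (x : X), spliceOn R M (z.map (Spindle.op · x)) (Spindle.op t x)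
      (mapL (Spindle.op · x) (A.act x) c) =
      mapL (Spindle.op · x) (A.act x) (spliceOn R M z t c) :=
    fun z x => (mapL_spliceOn _ _ _ _ _).symm
  induction z with
  | nil =>
    rw [DGAct.dT_nil, splice_single, chainDG_d]
    simp only [spliceOn, LinearMap.comp_apply, dC_consL, mapL_consL, Spindle.idem, map_sub]
    abel
  | cons x z ih =>
    rcases z with _ | ⟨w, z⟩
    · have h := hact [] t
      have h' := hact [] x
      rw [Spindle.idem] at h
      rw [List.map_nil] at h h'
      rw [DGAct.map_dT_cons, DGAct.dT_nil, consL_single, splice_single, splice_single,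
        splice_single, List.map_nil, chainDG_act, chainDG_act, chainDG_d, h', h]
      rw [DGAct.dT_nil, splice_single, chainDG_d] at ih
      have e : ∀ v, spliceOn R M [x] t v =
        consL R M x (spliceOn R M [] t v) - consL R M t (spliceOn R M [] t v) := fun _ => rfl
      rw [e, e, map_sub, dC_consL, dC_consL, ih]
      abel
    · rw [DGAct.map_dT_cons, splice_single, splice_single] at ih
      -- The induction hypothesis is solved for the one term not yet in spliced form, the splice of
      -- w prepended to the differential.
      have hQ := eq_sub_of_add_eq' (sub_eq_iff_eq_add.1 ih).symm
      have hc := DGAct.map_dT_cons (chainDG A) (splice R X M ∘ₗ consL R _ x) w z t c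
      simp only [LinearMap.comp_apply, consL_single, splice_single, splice_consL_consL] at hc
      have e : ∀ (y : X) (z : List X) (t : X) v, spliceOn R M (y :: z) t v =
        consL R M y (spliceOn R M z t v) - consL R M (z.headD t) (spliceOn R M z t v) :=
        fun _ _ _ _ => rfl
      have hw := hact (w :: z) w
      rw [DGAct.map_dT_cons, hc, hQ, splice_single, splice_single, chainDG_act, chainDG_act,
        chainDG_act, hact (w :: z) x, e x (w :: z) t c, map_sub (dC A), dC_consL, List.headD_cons,
        dC_consL, ← hw, List.map_cons, e (Spindle.op w w), Spindle.idem, e w z t, e x z t,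
        e x (z.map _)]
      simp only [map_sub]
      abel

lemma splice_dT (A : Action R X M) (v : List X →₀ X →₀ List X →₀ M) :
    splice R X M ((chainDG A).dT v) = dC A (splice R X M v) :=
  hom_ext_single (L := splice R X M ∘ₗ (chainDG A).dT) (L' := dC A ∘ₗ splice R X M)
    (fun z t c => by
      rw [LinearMap.comp_apply, LinearMap.comp_apply, splice_single, splice_dT_single]) v

lemma splice_mapT {X X' : Type u} (φ : X → X') (v : List X →₀ X →₀ List X →₀ M) :
    splice R X' M (mapT φ (mapL φ (LinearMap.id : M →ₗ[R] M)) v) =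
      mapL φ (LinearMap.id : M →ₗ[R] M) (splice R X M v) :=
  hom_ext_single (L := splice R X' M ∘ₗ mapT φ (mapL φ (LinearMap.id : M →ₗ[R] M)))
    (L' := mapL φ (LinearMap.id : M →ₗ[R] M) ∘ₗ splice R X M)
    (fun z t c => by
      rw [LinearMap.comp_apply, LinearMap.comp_apply, mapT_single, splice_single, splice_single,
        mapL_spliceOn]) v

lemma splice_mem_degC {X : Type u} (v : List X →₀ X →₀ List X →₀ M) :
    splice R X M v ∈ degC R X M :=
  map_mem_of_mem_supT (p := fun _ _ => True) (splice R X M)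
    (fun z t c _ => by rw [splice_single]; exact spliceOn_mem_degC z t c) (by simp [mem_supT])

lemma splice_mem_grC (A : Action R X M) {n : ℤ} {v : List X →₀ X →₀ List X →₀ M}
    (hv : v ∈ (chainDG A).grT n) : splice R X M v ∈ grC R X M (n + 2) := by
  refine map_mem_of_mem_famT (splice R X M) (fun z t c hc => ?_) hv
  rw [splice_single]
  have := spliceOn_mem_grC (R := R) z t hc
  rwa [sub_add_cancel] at this

lemma splice_eq_zero {X : Type u} {v : List X →₀ X →₀ List X →₀ M}
    (hv : v ∈ degT R X (List X →₀ M)) : splice R X M v = 0 :=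
  (Submodule.mem_bot R).1 (map_mem_of_mem_supT (splice R X M)
    (fun z t c hz => by rw [splice_single, spliceOn_eq_zero hz]; exact zero_mem _) hv)

/-- The leading term of `splice`. -/
lemma spliceOn_sub_mem {X : Type u} (z : List X) (t : X) (y : List X) (m : M) :
    spliceOn R M z t (Finsupp.single y m) - Finsupp.single (z ++ t :: t :: y) m ∈
      Finsupp.supported M R {l | DegAt z.length l ∧ l.length = z.length + 2 + y.length} := by
  induction z with
  | nil => simp [spliceOn]
  | cons x z ih =>
    have hcons : ∀ (w : X) {v : List X →₀ M}, v ∈ Finsupp.supported M R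
        {l | DegAt z.length l ∧ l.length = z.length + 2 + y.length} →
        consL R M w v ∈ Finsupp.supported M R
          {l | DegAt (x :: z).length l ∧ l.length = (x :: z).length + 2 + y.length} := by
      intro w v hv
      refine map_mem_of_mem_supported _ (fun l hl m => ?_) hv
      rw [consL_single]
      refine Finsupp.single_mem_supported R m ⟨.cons w hl.1, ?_⟩
      have := hl.2
      simp only [List.length_cons]
      omega
    have hhead : Finsupp.single (z.headD t :: (z ++ t :: t :: y)) m ∈ Finsupp.supported M R
        {l | DegAt (x :: z).length l ∧ l.length = (x :: z).length + 2 + y.length} := by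
      refine Finsupp.single_mem_supported R m ⟨?_, by simp; omega⟩
      cases z with
      | nil => exact .here _ _ _
      | cons w z => exact .here _ _ _
    have e : spliceOn R M (x :: z) t (Finsupp.single y m) -
        Finsupp.single (x :: z ++ t :: t :: y) m =
        consL R M x (spliceOn R M z t (Finsupp.single y m) -
          Finsupp.single (z ++ t :: t :: y) m) -
        consL R M (z.headD t) (spliceOn R M z t (Finsupp.single y m) -
          Finsupp.single (z ++ t :: t :: y) m) -
        Finsupp.single (z.headD t :: (z ++ t :: t :: y)) m := by
      simp only [spliceOn, LinearMap.comp_apply, LinearMap.sub_apply, map_sub, consL_single,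
        List.cons_append]
      abel
    rw [e]
    exact sub_mem (sub_mem (hcons _ ih) (hcons _ ih)) hhead

/-- Triangularity: a degenerate word whose first repetition is t, t after z is the leading term of a
spliced generator, and the other terms have earlier repetitions. -/
lemma exists_splice_eq (A : Action R X M) {n : ℤ} {v : List X →₀ M}
    (hv : v ∈ grC R X M (n + 2) ⊓ degC R X M) : ∃ w ∈ (chainDG A).grT n, splice R X M w = v := by
  suffices H : ∀ q : ℕ, Finsupp.supported M R {l : List X | DegAt q l ∧ (l.length : ℤ) = n + 2} ≤
      ((chainDG A).grT n).map (splice R X M) by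
    have hv' : v ∈ Finsupp.supported M R {l : List X | Degen l ∧ (l.length : ℤ) = n + 2} := by
      rw [mem_supported_iff]
      exact fun l hl => ⟨mem_supported_iff.1 hv.2 l hl, mem_supported_iff.1 hv.1 l hl⟩
    exact map_mem_of_mem_supported (U := ((chainDG A).grT n).map (splice R X M)) LinearMap.id
      (fun l hl m => by
        obtain ⟨q, hq⟩ := hl.1.exists_degAt
        exact H q (Finsupp.single_mem_supported R m ⟨hq, hl.2⟩)) hv'
  intro q
  induction q with
  | zero =>
    intro v hv
    have : v = 0 := Finsupp.ext fun l => by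
      by_contra h
      cases (mem_supported_iff.1 hv l h).1
    rw [this]
    exact zero_mem _
  | succ q ih =>
    intro v hv
    refine map_mem_of_mem_supported (U := ((chainDG A).grT n).map (splice R X M)) LinearMap.id
      (fun l hl m => ?_) hv
    rw [LinearMap.id_apply]
    rcases hl.1.exists_eq with h | ⟨z, t, y, hz, rfl⟩
    · exact ih (Finsupp.single_mem_supported R m ⟨h, hl.2⟩)
    · have hlen := hl.2
      simp only [List.length_append, List.length_cons] at hlen
      have h1 : spliceOn R M z t (Finsupp.single y m) ∈
          ((chainDG A).grT n).map (splice R X M) := by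
        refine ⟨Finsupp.single z (Finsupp.single t (Finsupp.single y m)), ?_, splice_single z t _⟩
        exact single_mem_famT (single_mem_grC (by push_cast at hlen; omega) m)
      have h2 := ih (Finsupp.supported_mono (R := R) (M := M) (fun l hl => ?_)
        (spliceOn_sub_mem (R := R) z t y m))
      · have := sub_mem h1 h2
        rwa [sub_sub_cancel] at this
      · exact ⟨hz ▸ hl.1, by have := hl.2; push_cast at hlen; omega⟩

/-- Leading coefficients of `splice`. -/
lemma splice_apply {X : Type u} {v : List X →₀ X →₀ List X →₀ M} {z : List X} {t : X}
    (hv : v ∈ filT R X (List X →₀ M) (z.length + 1)) (hz : ¬ Degen (z ++ [t])) (y : List X) :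
    splice R X M v (z ++ t :: t :: y) = v z t y := by
  classical
  let L₁ : (List X →₀ X →₀ List X →₀ M) →ₗ[R] M :=
    Finsupp.lapply (z ++ t :: t :: y) ∘ₗ splice R X M
  let L₂ : (List X →₀ X →₀ List X →₀ M) →ₗ[R] M :=
    Finsupp.lapply y ∘ₗ Finsupp.lapply t ∘ₗ Finsupp.lapply z
  suffices H : (L₁ - L₂) v ∈ (⊥ : Submodule R M) from
    sub_eq_zero.1 ((Submodule.mem_bot R).1 H)
  refine map_mem_of_mem_supT _ (fun z' t' c hz' => ?_) hv
  rw [Submodule.mem_bot, LinearMap.sub_apply, sub_eq_zero]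
  simp only [L₁, L₂, LinearMap.comp_apply, splice_single, Finsupp.lapply_apply]
  by_cases hd : Degen (z' ++ [t'])
  · rw [spliceOn_eq_zero hd, Finsupp.single_apply]
    split_ifs with h1
    · rw [Finsupp.single_apply, if_neg]
      · rfl
      · rintro rfl
        exact hz (h1 ▸ hd)
    · rfl
  have hlen : z'.length ≤ z.length := by have := hz'.resolve_left hd; omega
  suffices H : Finsupp.lapply (z ++ t :: t :: y) ∘ₗ spliceOn R M z' t' =
      Finsupp.lapply y ∘ₗ Finsupp.lapply t ∘ₗ Finsupp.lapply z ∘ₗ Finsupp.lsingle z' ∘ₗ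
        Finsupp.lsingle t' from LinearMap.congr_fun H c
  refine Finsupp.lhom_ext fun y' m => ?_
  simp only [LinearMap.comp_apply, Finsupp.lapply_apply, Finsupp.lsingle_apply]
  have h0 := spliceOn_sub_mem (R := R) z' t' y' m
  have h1 : (spliceOn R M z' t' (Finsupp.single y' m) - Finsupp.single (z' ++ t' :: t' :: y') m)
      (z ++ t :: t :: y) = 0 := by
    by_contra hne
    exact hz ((mem_supported_iff.1 h0 _ hne).1.degen_append hlen)
  rw [Finsupp.sub_apply, sub_eq_zero] at h1
  rw [h1]
  by_cases heq : z' = z ∧ t' = t ∧ y' = y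
  · obtain ⟨rfl, rfl, rfl⟩ := heq
    simp
  · rw [Finsupp.single_eq_of_ne']
    · symm
      by_cases e1 : z' = z
      · subst e1
        rw [Finsupp.single_eq_same]
        by_cases e2 : t' = t
        · subst e2
          rw [Finsupp.single_eq_same, Finsupp.single_eq_of_ne']
          exact fun e3 => heq ⟨rfl, rfl, e3⟩
        · rw [Finsupp.single_eq_of_ne' e2]; rfl
      · rw [Finsupp.single_eq_of_ne' e1]; rfl
    · intro h
      -- If z' were shorter than z, the pair t', t' would be a repetition inside z followed by t,
      -- which is nondegenerate.
      rcases hlen.lt_or_eq with hlt | hlt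
      · have := (degAt_append z' t' y').mono (q' := z.length) (by omega)
        rw [h] at this
        exact hz (this.degen_append le_rfl)
      · obtain ⟨e1, e2⟩ := List.append_inj h hlt
        simp only [List.cons.injEq] at e2
        exact heq ⟨e1, e2.1, e2.2.2⟩

/-- Leading coefficients on the longest nondegenerate words can be read off from the spliced chain,
so they vanish one length after another. -/
lemma mem_degT_of_splice_eq_zero {X : Type u} {v : List X →₀ X →₀ List X →₀ M}
    (hv : splice R X M v = 0) : v ∈ degT R X (List X →₀ M) := by
  obtain ⟨q, hq⟩ := exists_mem_filT (R := R) v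
  suffices H : ∀ q, v ∈ filT R X (List X →₀ M) q → v ∈ degT R X (List X →₀ M) from
    H q (hq q le_rfl)
  intro q
  induction q with
  | zero => intro hq; rwa [filT_zero] at hq
  | succ q ih =>
    intro hq
    refine ih (mem_supT.2 fun z t hz => ?_)
    rw [not_or, not_lt] at hz
    by_cases hlen : z.length = q
    · refine Finsupp.ext fun y => ?_
      rw [← splice_apply (by rwa [hlen]) hz.1 y, hv]
      rfl
    · exact mem_supT.1 hq z t (by rintro (h | h); exacts [hz.1 h, by omega])

end Chains


/-! ### Trivial coefficients: removing the augmentation -/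

section Trivial

variable {R : Type u} [CommRing R] {X X' : Type u}

/-- The map `r ⊗ (z, t) ↦ r ⊗ (z, t)` onto chains of positive length. -/
noncomputable def snocL (R X : Type u) [CommRing R] : (List X →₀ X →₀ R) →ₗ[R] (List X →₀ R) :=
  Finsupp.lsum R fun z => Finsupp.lsum R fun t => Finsupp.lsingle (z ++ [t])

@[simp] lemma snocL_single (z : List X) (t : X) (r : R) :
    snocL R X (Finsupp.single z (Finsupp.single t r)) = Finsupp.single (z ++ [t]) r := by
  simp only [snocL, Finsupp.lsum_single, Finsupp.lsingle_apply]

lemma snocL_apply (v : List X →₀ X →₀ R) (z : List X) (t : X) :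
    snocL R X v (z ++ [t]) = v z t := by
  classical
  let L : (List X →₀ X →₀ R) →ₗ[R] R := Finsupp.lapply t ∘ₗ Finsupp.lapply z
  refine hom_ext_single (L := Finsupp.lapply (z ++ [t]) ∘ₗ snocL R X) (L' := L)
    (fun z' t' r => ?_) v
  simp only [L, LinearMap.comp_apply, snocL_single, Finsupp.lapply_apply]
  by_cases hz : z' = z
  · subst hz
    rw [Finsupp.single_eq_same]
    by_cases ht : t' = t
    · subst ht
      rw [Finsupp.single_eq_same, Finsupp.single_eq_same]
    · rw [Finsupp.single_eq_of_ne' ht, Finsupp.single_eq_of_ne']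
      simpa using ht
  · rw [Finsupp.single_eq_of_ne' hz, Finsupp.single_eq_of_ne']
    · rfl
    · intro h
      exact hz (List.append_inj' h rfl).1

lemma snocL_mem_degC_iff (v : List X →₀ X →₀ R) : snocL R X v ∈ degC R X R ↔ v ∈ degT R X R := by
  refine ⟨fun h => mem_supT.2 fun z t hz => ?_, fun h => ?_⟩
  · rw [← snocL_apply]
    by_contra hne
    exact hz (mem_supported_iff.1 h _ hne)
  · refine map_mem_of_mem_supT _ (fun z t r hz => ?_) h
    rw [snocL_single]
    exact single_mem_degC hz r

lemma snocL_consL (x : X) (v : List X →₀ X →₀ R) :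
    snocL R X (consL R _ x v) = consL R R x (snocL R X v) :=
  hom_ext_single (L := snocL R X ∘ₗ consL R _ x) (L' := consL R R x ∘ₗ snocL R X)
    (fun z t r => by simp only [LinearMap.comp_apply, consL_single, snocL_single,
      List.cons_append]) v

lemma snocL_mapT (φ : X → X') (v : List X →₀ X →₀ R) :
    snocL R X' (mapT φ (LinearMap.id : R →ₗ[R] R) v) =
      mapL φ (LinearMap.id : R →ₗ[R] R) (snocL R X v) :=
  hom_ext_single (L := snocL R X' ∘ₗ mapT φ (LinearMap.id : R →ₗ[R] R))
    (L' := mapL φ (LinearMap.id : R →ₗ[R] R) ∘ₗ snocL R X)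
    (fun z t r => by simp only [LinearMap.comp_apply, mapT_single, snocL_single, mapL_single,
      List.map_append, List.map_cons, List.map_nil]) v

variable [Spindle X] [Spindle X']

lemma snocL_mem_grC {n : ℤ} {v : List X →₀ X →₀ R} (hv : v ∈ (DGAct.ground R X).grT n) :
    snocL R X v ∈ grC R X R (n + 1) := by
  refine map_mem_of_mem_famT _ (fun z t r hr => ?_) hv
  by_cases h : n - (z.length : ℤ) = 0
  · rw [snocL_single]
    refine single_mem_grC ?_ r
    simp only [List.length_append, List.length_singleton]
    push_cast
    omega
  · simp only [DGAct.ground, h, if_false, Submodule.mem_bot] at hr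
    rw [hr]
    simp

lemma exists_snocL_eq {n : ℤ} (hn : 0 ≤ n) {w : List X →₀ R} (hw : w ∈ grC R X R (n + 1)) :
    ∃ v ∈ (DGAct.ground R X).grT n, snocL R X v = w := by
  refine map_mem_of_mem_supported (U := ((DGAct.ground R X).grT n).map (snocL R X)) LinearMap.id
    (fun l hl r => ?_) hw
  rw [Set.mem_ofPred_eq] at hl
  obtain ⟨z, t, rfl⟩ : ∃ z t, l = z ++ [t] := by
    rcases List.eq_nil_or_concat l with rfl | ⟨z, t, rfl⟩
    · simp at hl; omega
    · exact ⟨z, t, by simp⟩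
  refine ⟨Finsupp.single z (Finsupp.single t r), single_mem_famT ?_, snocL_single z t r⟩
  have h : n - (z.length : ℤ) = 0 := by
    simp only [List.length_append, List.length_singleton] at hl
    push_cast at hl
    omega
  simp [DGAct.ground, h]

lemma snocL_dT (v : List X →₀ X →₀ R) :
    snocL R X ((DGAct.ground R X).dT v) = dC (Action.trivial R X) (snocL R X v) := by
  refine hom_ext_single (L := snocL R X ∘ₗ (DGAct.ground R X).dT)
    (L' := dC (Action.trivial R X) ∘ₗ snocL R X) (fun z t r => ?_) v
  simp only [LinearMap.comp_apply, snocL_single]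
  induction z with
  | nil =>
    rw [DGAct.dT_nil, snocL_single, dC, List.nil_append, twist_cons, twist_nil]
    simp [DGAct.ground, Action.trivial]
  | cons x z ih =>
    rw [DGAct.map_dT_cons, snocL_consL, ih, snocL_single, snocL_single, List.cons_append,
      dC, twist_cons, List.map_append]
    rfl

/-- Words of positive length, shifted by one, form the complex with ground ring coefficients. For
trivial coefficients the augmentation is zero on single letters, so leaving out the empty word is
compatible with the differential. -/
theorem coneExact_ground (φ : SpindleHom X X')
    (h : ∀ n, ConeExact (dC (Action.trivial R X)) (dC (Action.trivial R X'))
      (mapL φ.toFun (LinearMap.id : R →ₗ[R] R)) (grC R X R) (degC R X R) (grC R X' R)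
      (degC R X' R) n) (n : ℤ) :
    ConeExact (DGAct.ground R X).dT (DGAct.ground R X').dT
      (mapT φ.toFun (LinearMap.id : R →ₗ[R] R)) (DGAct.ground R X).grT (degT R X R)
      (DGAct.ground R X').grT (degT R X' R) n := by
  rcases lt_or_ge n 0 with hn | hn
  · intro b hb a ha _ _
    have hb0 : b = 0 := Finsupp.ext fun z => Finsupp.ext fun t => by
      rw [ground_grT_apply hb (by omega)]; rfl
    have ha0 : a = 0 := Finsupp.ext fun z => Finsupp.ext fun t => by
      rw [ground_grT_apply ha (by omega)]; rfl
    subst hb0 ha0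
    exact ⟨0, zero_mem _, 0, zero_mem _, by simp, by simp⟩
  -- The empty word is not in the image of `snocL`, but primitives are lifted only in degrees n and
  -- n + 1, that is, from words of length n + 1 and n + 2 with n ≥ 0.
  · exact ConeExact.transfer_symm (snocL R X) (snocL R X') (h (n + 1)) snocL_dT snocL_dT
      (snocL_mapT _) (fun _ _ => snocL_mem_grC) (fun _ _ => snocL_mem_grC) snocL_mem_degC_iff
      snocL_mem_degC_iff (fun _ => exists_snocL_eq hn) (fun _ => exists_snocL_eq (by omega))

end Trivial

/-! ### The induction linking degenerate chains to all chains -/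

section Degenerate

variable {R : Type u} [CommRing R] {X X' : Type u} [Spindle X] [Spindle X'] {M : Type u}
  [AddCommGroup M] [Module R M]

lemma mapT_mapT_id {D D' : Type u} [AddCommGroup D] [Module R D] [AddCommGroup D'] [Module R D']
    {X X' : Type u} (φ : X → X') (f : D →ₗ[R] D') (v : List X →₀ X →₀ D) :
    mapT φ (LinearMap.id : D' →ₗ[R] D') (mapT id f v) = mapT φ f v :=
  hom_ext_single (L := mapT φ (LinearMap.id : D' →ₗ[R] D') ∘ₗ mapT id f) (L' := mapT φ f)
    (fun z t c => by simp [LinearMap.comp_apply]) v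

lemma grC_eq_bot {X : Type u} {n : ℤ} (hn : n < 0) {v : List X →₀ M} (hv : v ∈ grC R X M n) :
    v = 0 :=
  Finsupp.ext fun l => by
    by_contra h
    have := mem_supported_iff.1 hv l h
    rw [Set.mem_ofPred_eq] at this
    omega

/-- The mapping cone of `φ` on degenerate chains is exact as far as the mapping cone on all chains
is exact in degrees smaller by two. -/
theorem coneExact_degenerate (A : Action R X' M) (φ : SpindleHom X X')
    (hX : ∀ n, ConeExact (dC (Action.trivial R X)) (dC (Action.trivial R X'))
      (mapL φ.toFun (LinearMap.id : R →ₗ[R] R)) (grC R X R) (degC R X R) (grC R X' R)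
      (degC R X' R) n) {n : ℤ}
    (h : ∀ k ≤ n, ConeExact (dC (A.comap φ)) (dC A) (mapL φ.toFun (LinearMap.id : M →ₗ[R] M))
      (grC R X M) ⊥ (grC R X' M) ⊥ k) :
    ConeExact (dC (A.comap φ)) (dC A) (mapL φ.toFun (LinearMap.id : M →ₗ[R] M))
      (fun k => grC R X M k ⊓ degC R X M) ⊥ (fun k => grC R X' M k ⊓ degC R X' M) ⊥ (n + 2) := by
  have hfa : ∀ (x : X) (c : List X →₀ M), mapL φ.toFun (LinearMap.id : M →ₗ[R] M)
      ((chainDG (A.comap φ)).act x c) = ((chainDG A).comap φ).act x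
        (mapL φ.toFun (LinearMap.id : M →ₗ[R] M) c) := by
    intro x c
    suffices H : mapL φ.toFun (LinearMap.id : M →ₗ[R] M) ∘ₗ (chainDG (A.comap φ)).act x =
        ((chainDG A).comap φ).act x ∘ₗ mapL φ.toFun (LinearMap.id : M →ₗ[R] M) from
      LinearMap.congr_fun H c
    refine Finsupp.lhom_ext fun z m => ?_
    simp [chainDG, DGAct.comap, Action.comap, Function.comp_def, φ.map_op]
  -- First factor: coefficients pass from C(M^φ; X) to C(M; X') over the spindle X.
  have hA := DGAct.coneExact_mapT_id (chainDG (A.comap φ)) ((chainDG A).comap φ)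
    (mapL φ.toFun (LinearMap.id : M →ₗ[R] M)) (mapL_comap_dC A φ) hfa
    (fun _ _ => mapL_mem_grC _ _) h
  -- Second factor: words pass from X to X', with coefficients in C(M; X').
  have hB := DGAct.coneExact_mapT_comap (chainDG A) φ (coneExact_ground φ hX) n
  have hAB := hA.comp hB
    (DGAct.mapT_twist (fun _ _ => rfl) (mapL_comap_dC A φ) hfa)
    (DGAct.mapT_comap_dT (chainDG A) φ)
    (fun _ _ => DGAct.mapT_mem_grT _ _ id fun _ _ => mapL_mem_grC _ _)
    (fun _ => mapT_mem_degT _ _)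
    (fun _ _ => DGAct.mapT_mem_grT ((chainDG A).comap φ) (chainDG A) φ.toFun fun _ _ hc => hc)
    (fun _ => mapT_mem_degT _ _)
  refine ConeExact.transfer (splice R X M) (splice R X' M) hAB (splice_dT (A.comap φ))
    (splice_dT A) (fun v => ?_)
    (fun _ _ hv => ⟨splice_mem_grC _ hv, splice_mem_degC _⟩)
    (fun _ _ hv => ⟨splice_mem_grC _ hv, splice_mem_degC _⟩)
    (fun v => ?_) (fun v => ?_) (fun _ _ hw => exists_splice_eq _ hw)
    (fun _ _ hw => exists_splice_eq _ hw)
  · rw [LinearMap.comp_apply, mapT_mapT_id, splice_mapT]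
  · exact ⟨fun h => mem_degT_of_splice_eq_zero ((Submodule.mem_bot R).1 h),
      fun h => (Submodule.mem_bot R).2 (splice_eq_zero h)⟩
  · exact ⟨fun h => mem_degT_of_splice_eq_zero ((Submodule.mem_bot R).1 h),
      fun h => (Submodule.mem_bot R).2 (splice_eq_zero h)⟩

/-- If `φ` induces an isomorphism on normalized homology with trivial coefficients and with
coefficients in `M`, then its mapping cone on degenerate chains is exact. -/
theorem coneExact_degenerate_of_normalized (A : Action R X' M) (φ : SpindleHom X X')
    (hX : ∀ n, ConeExact (dC (Action.trivial R X)) (dC (Action.trivial R X'))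
      (mapL φ.toFun (LinearMap.id : R →ₗ[R] R)) (grC R X R) (degC R X R) (grC R X' R)
      (degC R X' R) n)
    (hM : ∀ n, ConeExact (dC (A.comap φ)) (dC A) (mapL φ.toFun (LinearMap.id : M →ₗ[R] M))
      (grC R X M) (degC R X M) (grC R X' M) (degC R X' M) n) (n : ℤ) :
    ConeExact (dC (A.comap φ)) (dC A) (mapL φ.toFun (LinearMap.id : M →ₗ[R] M))
      (fun k => grC R X M k ⊓ degC R X M) ⊥ (fun k => grC R X' M k ⊓ degC R X' M) ⊥ n := by
  have key : ∀ N : ℕ, ∀ k < (N : ℤ), ConeExact (dC (A.comap φ)) (dC A)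
      (mapL φ.toFun (LinearMap.id : M →ₗ[R] M)) (grC R X M) ⊥ (grC R X' M) ⊥ k := by
    intro N
    induction N with
    | zero =>
      intro k hk b hb a ha _ _
      obtain rfl := grC_eq_bot (by exact_mod_cast hk) hb
      obtain rfl := grC_eq_bot (by push_cast at hk; omega) ha
      exact ⟨0, zero_mem _, 0, zero_mem _, by simp, by simp⟩
    | succ N ih =>
      intro k hk
      -- Exactness for all chains up to degree k - 2 gives it for degenerate chains in degree k,
      -- hence for all chains in degree k by extension with the normalized ones.
      have := coneExact_degenerate A φ hX (n := k - 2)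
        (fun j hj => ih j (by push_cast at hk; omega))
      rw [sub_add_cancel] at this
      exact this.extension (hM k) (fun _ _ => dC_mem_grC _) (fun _ _ => dC_mem_grC _)
        (fun _ _ => mapL_mem_grC _ _) (mapL_comap_dC A φ) (dC_dC _) (dC_dC _)
  have := coneExact_degenerate A φ hX (n := n - 2)
    (fun j _ => key (j.toNat + 1) j (by push_cast; omega))
  rwa [sub_add_cancel] at this

end Degenerate


/-! ### Isomorphisms on homology in terms of elements -/

section Homology

variable {R : Type u} [CommRing R]

lemma homologyπ_eq_zero_iff (S : ShortComplex (ModuleCat.{u} R)) (z : S.cycles) :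
    S.homologyπ z = 0 ↔ ∃ y, S.f y = S.iCycles z := by
  have h1 : S.moduleCatHomologyIso.hom (S.homologyπ z) =
      S.moduleCatLeftHomologyData.π (S.moduleCatCyclesIso.hom z) :=
    ConcreteCategory.congr_hom S.π_moduleCatCyclesIso_hom z
  have h2 : (S.moduleCatCyclesIso.hom z : LinearMap.ker S.g.hom).1 = S.iCycles z :=
    ConcreteCategory.congr_hom S.moduleCatCyclesIso_hom_i z
  have hinj : Function.Injective S.moduleCatHomologyIso.hom :=
    (ModuleCat.mono_iff_injective _).1 inferInstance
  rw [← map_eq_zero_iff _ hinj, h1, ← h2]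
  refine (Submodule.Quotient.mk_eq_zero _).trans ⟨?_, ?_⟩
  · rintro ⟨y, hy⟩
    exact ⟨y, congrArg Subtype.val hy⟩
  · rintro ⟨y, hy⟩
    exact ⟨y, Subtype.ext hy⟩

lemma exists_iCycles_eq (S : ShortComplex (ModuleCat.{u} R)) {x : S.X₂} (hx : S.g x = 0) :
    ∃ z : S.cycles, S.iCycles z = x :=
  ⟨S.moduleCatCyclesIso.inv ⟨x, hx⟩, ConcreteCategory.congr_hom S.moduleCatCyclesIso_inv_iCycles _⟩

lemma g_iCycles (S : ShortComplex (ModuleCat.{u} R)) (z : S.cycles) : S.g (S.iCycles z) = 0 :=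
  ConcreteCategory.congr_hom S.iCycles_g z

lemma homologyπ_surjective (S : ShortComplex (ModuleCat.{u} R)) :
    Function.Surjective S.homologyπ :=
  (ModuleCat.epi_iff_surjective _).1 inferInstance

/-- The two conjuncts are injectivity and surjectivity, with classes replaced by cycles and equality
by differing by a boundary. -/
lemma isIso_shortComplex_homologyMap_iff {S T : ShortComplex (ModuleCat.{u} R)} (φ : S ⟶ T) :
    IsIso (ShortComplex.homologyMap φ) ↔
      (∀ a, S.g a = 0 → (∃ b, T.f b = φ.τ₂ a) → ∃ a', S.f a' = a) ∧
      ∀ b, T.g b = 0 → ∃ a, S.g a = 0 ∧ ∃ b', T.f b' = b - φ.τ₂ a := by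
  have nat (z : S.cycles) : ShortComplex.homologyMap φ (S.homologyπ z) =
      T.homologyπ (ShortComplex.cyclesMap φ z) :=
    ConcreteCategory.congr_hom (ShortComplex.homologyπ_naturality φ) z
  have nat' (z : S.cycles) : T.iCycles (ShortComplex.cyclesMap φ z) = φ.τ₂ (S.iCycles z) :=
    ConcreteCategory.congr_hom (ShortComplex.cyclesMap_i φ) z
  rw [ConcreteCategory.isIso_iff_bijective]
  constructor
  · rintro ⟨hi, hs⟩
    refine ⟨fun a ha hb => ?_, fun b hb => ?_⟩
    · obtain ⟨z, rfl⟩ := exists_iCycles_eq S ha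
      rw [← nat', ← homologyπ_eq_zero_iff, ← nat, map_eq_zero_iff _ hi] at hb
      exact (homologyπ_eq_zero_iff S z).1 hb
    · obtain ⟨w, rfl⟩ := exists_iCycles_eq T hb
      obtain ⟨x, hx⟩ := hs (T.homologyπ w)
      obtain ⟨z, rfl⟩ := homologyπ_surjective S x
      refine ⟨S.iCycles z, g_iCycles S z, ?_⟩
      rw [← nat', ← map_sub, ← homologyπ_eq_zero_iff, map_sub, ← nat, hx, sub_self]
  · rintro ⟨hi, hs⟩
    refine ⟨(injective_iff_map_eq_zero _).2 fun x hx => ?_, fun y => ?_⟩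
    · obtain ⟨z, rfl⟩ := homologyπ_surjective S x
      rw [nat, homologyπ_eq_zero_iff, nat'] at hx
      exact (homologyπ_eq_zero_iff S z).2 (hi _ (g_iCycles S z) hx)
    · obtain ⟨w, rfl⟩ := homologyπ_surjective T y
      obtain ⟨a, ha, hb⟩ := hs _ (g_iCycles T w)
      obtain ⟨z, rfl⟩ := exists_iCycles_eq S ha
      rw [← nat', ← map_sub, ← homologyπ_eq_zero_iff, map_sub, ← nat, sub_eq_zero] at hb
      exact ⟨_, hb.symm⟩

lemma d_next_eq_zero_iff (K : ChainComplex (ModuleCat.{u} R) ℕ) (n : ℕ) (x : K.X n) :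
    (K.sc n).g x = 0 ↔ ∀ m, K.d n m x = 0 := by
  refine ⟨fun h m => ?_, fun h => h _⟩
  by_cases hm : (ComplexShape.down ℕ).Rel n m
  · obtain rfl := (ComplexShape.down ℕ).next_eq' hm
    exact h
  · rw [K.shape _ _ hm]
    rfl

lemma exists_d_prev_eq_iff (K : ChainComplex (ModuleCat.{u} R) ℕ) (n : ℕ) (x : K.X n) :
    (∃ y, (K.sc n).f y = x) ↔ ∃ y, K.d (n + 1) n y = x := by
  have h : ∀ j, (ComplexShape.down ℕ).prev n = j →
      ((∃ y, (K.sc n).f y = x) ↔ ∃ y, K.d j n y = x) := by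
    rintro j rfl
    rfl
  exact h _ (ChainComplex.prev ℕ n)

lemma isIso_homologyMap_iff {K L : ChainComplex (ModuleCat.{u} R) ℕ} (f : K ⟶ L) (n : ℕ) :
    IsIso (HomologicalComplex.homologyMap f n) ↔
      (∀ a, (∀ m, K.d n m a = 0) → (∃ b, L.d (n + 1) n b = f.f n a) →
        ∃ a', K.d (n + 1) n a' = a) ∧
      ∀ b, (∀ m, L.d n m b = 0) → ∃ a, (∀ m, K.d n m a = 0) ∧
        ∃ b', L.d (n + 1) n b' = b - f.f n a := by
  simp only [← d_next_eq_zero_iff, ← exists_d_prev_eq_iff]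
  exact isIso_shortComplex_homologyMap_iff
    ((HomologicalComplex.shortComplexFunctor _ _ n).map f)

end Homology

/-! ### From sequences to words, and conclusion -/

section Lists

/-- The sign that relates `rackD` to `dC`. -/
def degSign : ℕ → ℤ
  | 0 => 1
  | n + 1 => (-1) ^ (n + 1) * degSign n

lemma degSign_mul_self (n : ℕ) : degSign n * degSign n = 1 := by
  induction n with
  | zero => rfl
  | succ n ih =>
    rw [degSign, mul_mul_mul_comm, ih, mul_one, ← mul_pow]
    simp

variable {R : Type u} [CommRing R] {X X' : Type u} {M : Type u} [AddCommGroup M] [Module R M]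

/-- The identification of `C_n(M; X)` with the chains on lists of length `n + 1`. -/
noncomputable def toL (R X M : Type u) [CommRing R] [AddCommGroup M] [Module R M] (n : ℕ) :
    Chain X M n →ₗ[R] (List X →₀ M) :=
  degSign n • Finsupp.lmapDomain M R List.ofFn

lemma toL_single (n : ℕ) (x : Fin (n + 1) → X) (m : M) :
    toL R X M n (Finsupp.single x m) = degSign n • Finsupp.single (List.ofFn x) m := by
  rw [toL, LinearMap.smul_apply, Finsupp.lmapDomain_apply, Finsupp.mapDomain_single]

lemma degSign_smul_toL (n : ℕ) (c : Chain X M n) :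
    degSign n • toL R X M n c = Finsupp.mapDomain List.ofFn c := by
  rw [toL, LinearMap.smul_apply, smul_smul, degSign_mul_self, one_smul,
    Finsupp.lmapDomain_apply]

lemma toL_injective (n : ℕ) : Function.Injective (toL R X M n) := by
  intro c c' h
  refine Finsupp.mapDomain_injective List.ofFn_injective ?_
  rw [← degSign_smul_toL (R := R), h, degSign_smul_toL]

lemma toL_mem_grC (n : ℕ) (c : Chain X M n) : toL R X M n c ∈ grC R X M (n + 1) := by
  refine map_mem_of_mem_supported (s := Set.univ) _ (fun x _ m => ?_) (by simp)
  rw [toL_single]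
  exact zsmul_mem (single_mem_grC (by simp) m) _

lemma exists_toL_eq {n : ℕ} {w : List X →₀ M} (hw : w ∈ grC R X M (n + 1)) :
    ∃ c, toL R X M n c = w := by
  refine map_mem_of_mem_supported (U := LinearMap.range (toL R X M n)) LinearMap.id
    (fun l hl m => ?_) hw
  rw [Set.mem_ofPred_eq] at hl
  have hl : l.length = n + 1 := by omega
  obtain ⟨x, rfl⟩ : ∃ x : Fin (n + 1) → X, l = List.ofFn x :=
    ⟨fun i => l[(i : ℕ)], List.ext_getElem (by simp [hl]) fun i _ _ => by
      rw [List.getElem_ofFn]⟩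
  refine ⟨degSign n • Finsupp.single x m, ?_⟩
  rw [map_zsmul, toL_single, smul_smul, degSign_mul_self, one_smul]
  rfl

lemma degen_ofFn_iff {n : ℕ} (x : Fin (n + 1) → X) : Degen (List.ofFn x) ↔ IsDegenerate x := by
  induction n with
  | zero =>
    rw [List.ofFn_succ, List.ofFn_zero, iff_false_intro not_degen_singleton, false_iff]
    exact fun ⟨i, _⟩ => i.elim0
  | succ n ih =>
    have h := ih fun i => x i.succ
    rw [List.ofFn_succ] at h
    rw [List.ofFn_succ, List.ofFn_succ, degen_cons_cons, h, IsDegenerate, IsDegenerate,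
      Fin.exists_fin_succ]
    rfl

lemma mem_degenerate_iff {n : ℕ} {c : Chain X M n} :
    c ∈ degenerate R X M n ↔ ∀ x, c x ≠ 0 → IsDegenerate x := by
  refine Iff.trans ?_ (mem_supported_iff (R := R) (s := {x | IsDegenerate x}))
  refine ⟨fun h => ?_, fun h => ?_⟩
  · refine (Submodule.span_le (p := Finsupp.supported M R {x | IsDegenerate x})).2 ?_ h
    rintro _ ⟨m, x, hx, rfl⟩
    exact Finsupp.single_mem_supported R m hx
  · exact map_mem_of_mem_supported LinearMap.id (fun x hx m => single_mem_degenerate hx m) h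

lemma toL_mem_degC_iff {n : ℕ} {c : Chain X M n} :
    toL R X M n c ∈ degC R X M ↔ c ∈ degenerate R X M n := by
  refine ⟨fun h => mem_degenerate_iff.2 fun x hx => ?_, fun h => ?_⟩
  · rw [← degen_ofFn_iff]
    refine mem_supported_iff.1 (zsmul_mem h (degSign n)) _ ?_
    rwa [degSign_smul_toL, Finsupp.mapDomain_apply List.ofFn_injective]
  · refine (Submodule.span_le (p := (degC R X M).comap (toL R X M n))).2 ?_ h
    rintro _ ⟨m, x, hx, rfl⟩
    rw [SetLike.mem_coe, Submodule.mem_comap, toL_single]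
    exact zsmul_mem (single_mem_degC ((degen_ofFn_iff x).2 hx) m) _

variable [Spindle X] [Spindle X']

lemma mapL_toL (φ : SpindleHom X X') (n : ℕ) (c : Chain X M n) :
    mapL φ.toFun (LinearMap.id : M →ₗ[R] M) (toL R X M n c) =
      toL R X' M n (mapChain R M φ n c) := by
  suffices h : mapL φ.toFun (LinearMap.id : M →ₗ[R] M) ∘ₗ toL R X M n =
      toL R X' M n ∘ₗ mapChain R M φ n from LinearMap.congr_fun h c
  refine Finsupp.lhom_ext fun x m => ?_
  rw [LinearMap.comp_apply, LinearMap.comp_apply, toL_single, map_zsmul, mapL_single, mapChain,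
    Finsupp.lmapDomain_apply, Finsupp.mapDomain_single, toL_single, List.map_ofFn]
  rfl

lemma trivFace_zero {X : Type u} {n : ℕ} (x : Fin (n + 2) → X) :
    trivFace 0 x = fun i => x i.succ := rfl

lemma starFace_zero {n : ℕ} (x : Fin (n + 2) → X) :
    starFace 0 x = fun i => Spindle.op (x i.succ) (x 0) := rfl

lemma ofFn_trivFace_succ {X : Type u} {n : ℕ} (i : Fin (n + 2)) (x : Fin (n + 3) → X) :
    List.ofFn (trivFace i.succ x) = x 0 :: List.ofFn (trivFace i fun j => x j.succ) := by
  rw [List.ofFn_succ]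
  congr 1
  refine congrArg List.ofFn (funext fun j => ?_)
  simp only [trivFace, ← Fin.succ_castSucc, Fin.succ_lt_succ_iff]

lemma ofFn_starFace_succ {n : ℕ} (i : Fin (n + 2)) (x : Fin (n + 3) → X) :
    List.ofFn (starFace i.succ x) = x 0 :: List.ofFn (starFace i fun j => x j.succ) := by
  rw [List.ofFn_succ]
  congr 1
  refine congrArg List.ofFn (funext fun j => ?_)
  simp only [starFace, ← Fin.succ_castSucc, Fin.succ_lt_succ_iff]

/-- The head of the list is x_0, and prepending a letter shifts the index of a face and changes its
sign; hence the sign (-1)^i, counted from the opposite end compared with `rackD`. -/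
lemma dC_single_ofFn (A : Action R X M) (n : ℕ) (x : Fin (n + 2) → X) (m : M) :
    dC A (Finsupp.single (List.ofFn x) m) = ∑ i : Fin (n + 2), (-1 : ℤ) ^ (i : ℕ) •
      (Finsupp.single (List.ofFn (trivFace i x)) m -
        Finsupp.single (List.ofFn (starFace i x)) (A.act (x i) m)) := by
  induction n with
  | zero =>
    rw [Fin.sum_univ_two]
    simp [dC, twist_cons, trivFace, starFace]
    abel
  | succ n ih =>
    rw [Fin.sum_univ_succ, List.ofFn_succ, dC, twist_cons, ← dC, ih fun i => x i.succ]
    simp only [ofFn_trivFace_succ, ofFn_starFace_succ, map_sum, map_zsmul, map_sub,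
      consL_single, Fin.val_zero, pow_zero, one_smul, LinearMap.id_apply, Fin.val_succ, pow_succ,
      mul_neg, mul_one, neg_smul, Finset.sum_neg_distrib, trivFace_zero, starFace_zero,
      List.map_ofFn, ← sub_eq_add_neg]
    rfl

/-- The signs (-1)^i and (-1)^(n+1-i) differ by (-1)^(n+1), which is the ratio of consecutive values
of `degSign`. -/
lemma dC_toL (A : Action R X M) (n : ℕ) (c : Chain X M (n + 1)) :
    dC A (toL R X M (n + 1) c) = toL R X M n (rackD A n c) := by
  suffices h : dC A ∘ₗ toL R X M (n + 1) = toL R X M n ∘ₗ rackD A n from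
    LinearMap.congr_fun h c
  refine Finsupp.lhom_ext fun x m => ?_
  rw [LinearMap.comp_apply, LinearMap.comp_apply, toL_single, map_zsmul, dC_single_ofFn, rackD_eq,
    LinearMap.sum_apply, map_sum, Finset.smul_sum]
  refine Finset.sum_congr rfl fun i _ => ?_
  rw [LinearMap.smul_apply, map_zsmul, rackFace, LinearMap.sub_apply, dTriv_single, dStar_single,
    map_sub, toL_single, toL_single, ← smul_sub, smul_smul, smul_smul, degSign]
  congr 1
  have h : (-1 : ℤ) ^ (n + 1 - (i : ℕ)) = (-1) ^ (n + 1) * (-1) ^ (i : ℕ) := by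
    rw [← pow_add]
    apply neg_one_pow_congr
    have := i.2
    simp only [Nat.even_iff]
    omega
  rw [h]
  ring

lemma CN_d_mk (A : Action R X M) (n : ℕ) (c : Chain X M (n + 1)) :
    (CN A).d (n + 1) n (Submodule.Quotient.mk c : Chain X M (n + 1) ⧸ degenerate R X M (n + 1)) =
      (Submodule.Quotient.mk (rackD A n c) : Chain X M n ⧸ degenerate R X M n) := by
  have h : (CN A).d (n + 1) n = ModuleCat.ofHom
      (Submodule.mapQ _ _ (rackD A n) (rackD_mem_degenerate A n)) := by
    simp only [CN, ChainComplex.of_d]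
  rw [h]
  rfl

lemma CD_d_val (A : Action R X M) (n : ℕ) (c : degenerate R X M (n + 1)) :
    ((CD A).d (n + 1) n c : degenerate R X M n).1 = rackD A n c.1 := by
  have h : (CD A).d (n + 1) n = ModuleCat.ofHom
      ((rackD A n).restrict (rackD_mem_degenerate A n)) := by
    simp only [CD, ChainComplex.of_d]
  rw [h]
  rfl

/-- The guard n ≠ 0 is needed because `dC` continues a single letter into the augmentation m - m ⋆
x, whereas the normalized complex stops there. -/
lemma CN_d_eq_zero_iff (A : Action R X M) (n : ℕ) (c : Chain X M n) :
    (∀ m, (CN A).d n m (Submodule.Quotient.mk c : Chain X M n ⧸ degenerate R X M n) = 0) ↔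
      (n ≠ 0 → dC A (toL R X M n c) ∈ degC R X M) := by
  cases n with
  | zero =>
    refine ⟨fun _ h => absurd rfl h, fun _ m => ?_⟩
    rw [(CN A).shape _ _ (by simp)]
    rfl
  | succ n =>
    have h : (CN A).d (n + 1) n (Submodule.Quotient.mk c : Chain X M (n + 1) ⧸ _) = 0 ↔
        dC A (toL R X M (n + 1) c) ∈ degC R X M := by
      rw [dC_toL, toL_mem_degC_iff, CN_d_mk]
      exact Submodule.Quotient.mk_eq_zero _
    refine ⟨fun hm _ => h.1 (hm n), fun hd m => ?_⟩
    by_cases hm : m = n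
    · subst hm
      exact h.2 (hd (Nat.succ_ne_zero _))
    · rw [(CN A).shape _ _ (by simpa using hm)]
      rfl

/-- No guard is needed: a single letter is never degenerate, so degree 0 is zero. -/
lemma CD_d_eq_zero_iff (A : Action R X M) (n : ℕ) (c : degenerate R X M n) :
    (∀ m, (CD A).d n m c = 0) ↔ dC A (toL R X M n c.1) = 0 := by
  cases n with
  | zero =>
    have hc : c.1 = 0 := Finsupp.ext fun x => by
      by_contra h
      obtain ⟨i, _⟩ := mem_degenerate_iff.1 c.2 x h
      exact i.elim0
    refine ⟨fun _ => by rw [hc, map_zero, map_zero], fun _ m => ?_⟩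
    rw [(CD A).shape _ _ (by simp)]
    rfl
  | succ n =>
    have h : (CD A).d (n + 1) n c = 0 ↔ dC A (toL R X M (n + 1) c.1) = 0 := by
      rw [dC_toL, map_eq_zero_iff _ (toL_injective n), ← CD_d_val]
      exact Subtype.ext_iff
    refine ⟨fun hm => h.1 (hm n), fun hd m => ?_⟩
    by_cases hm : m = n
    · subst hm
      exact h.2 hd
    · rw [(CD A).shape _ _ (by simpa using hm)]
      rfl

/-- Elementwise form of the bijectivity of `φ_*` on normalized homology. -/
lemma isIso_mapHN_iff (A : Action R X' M) (φ : SpindleHom X X') (n : ℕ) :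
    IsIso (mapHN A φ n) ↔
      (∀ a ∈ grC R X M (n + 1), (n ≠ 0 → dC (A.comap φ) a ∈ degC R X M) →
        (∃ b ∈ grC R X' M (n + 2), dC A b - mapL φ.toFun (LinearMap.id : M →ₗ[R] M) a ∈
          degC R X' M) →
        ∃ a' ∈ grC R X M (n + 2), dC (A.comap φ) a' - a ∈ degC R X M) ∧
      ∀ b ∈ grC R X' M (n + 1), (n ≠ 0 → dC A b ∈ degC R X' M) →
        ∃ a ∈ grC R X M (n + 1), (n ≠ 0 → dC (A.comap φ) a ∈ degC R X M) ∧
          ∃ b' ∈ grC R X' M (n + 2),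
            dC A b' - (b - mapL φ.toFun (LinearMap.id : M →ₗ[R] M) a) ∈ degC R X' M := by
  have hgr {Y : Type u} {p : (List Y →₀ M) → Prop} (k : ℕ) :
      (∀ a ∈ grC R Y M (k + 1), p a) ↔ ∀ c : Chain Y M k, p (toL R Y M k c) :=
    ⟨fun h c => h _ (toL_mem_grC k c),
      fun h a ha => by obtain ⟨c, rfl⟩ := exists_toL_eq ha; exact h c⟩
  have hgr' {Y : Type u} {p : (List Y →₀ M) → Prop} (k : ℕ) :
      (∃ a ∈ grC R Y M (k + 1), p a) ↔ ∃ c : Chain Y M k, p (toL R Y M k c) :=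
    ⟨fun ⟨a, ha, h⟩ => by obtain ⟨c, rfl⟩ := exists_toL_eq ha; exact ⟨c, h⟩,
      fun ⟨c, h⟩ => ⟨_, toL_mem_grC k c, h⟩⟩
  have e : (n : ℤ) + 2 = (n + 1 : ℕ) + 1 := by push_cast; ring
  have hmk {Y : Type u} (k : ℕ) {p : Chain Y M k ⧸ degenerate R Y M k → Prop} :
      (∀ a, p a) ↔ ∀ c, p (Submodule.Quotient.mk c) :=
    (Submodule.Quotient.mk_surjective _).forall
  have hmk' {Y : Type u} (k : ℕ) {p : Chain Y M k ⧸ degenerate R Y M k → Prop} :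
      (∃ a, p a) ↔ ∃ c, p (Submodule.Quotient.mk c) :=
    (Submodule.Quotient.mk_surjective _).exists
  have hmap (c : Chain X M n) :
      (mapCN A φ).f n (Submodule.Quotient.mk c : Chain X M n ⧸ degenerate R X M n) =
      (Submodule.Quotient.mk (mapChain R M φ n c) : Chain X' M n ⧸ degenerate R X' M n) := rfl
  rw [e]
  simp only [hgr, hgr', dC_toL, mapL_toL, ← map_sub, toL_mem_degC_iff]
  rw [mapHN, isIso_homologyMap_iff]
  refine and_congr ((hmk n).trans (forall_congr' fun a => ?_))
    ((hmk n).trans (forall_congr' fun b => ?_))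
  · refine imp_congr (CN_d_eq_zero_iff _ _ _) (imp_congr ?_ ?_)
    · refine (hmk' (n + 1)).trans (exists_congr fun b => ?_)
      rw [hmap, CN_d_mk]
      exact Submodule.Quotient.eq _
    · refine (hmk' (n + 1)).trans (exists_congr fun b => ?_)
      rw [CN_d_mk]
      exact Submodule.Quotient.eq _
  · refine imp_congr (CN_d_eq_zero_iff _ _ _) ((hmk' n).trans (exists_congr fun a =>
      and_congr (CN_d_eq_zero_iff _ _ _) ((hmk' (n + 1)).trans (exists_congr fun b' => ?_))))
    rw [hmap, CN_d_mk]
    exact Submodule.Quotient.eq _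

lemma dC_eq_zero {A : Action R X M} {v : List X →₀ M} (hv : v ∈ grC R X M 0) : dC A v = 0 :=
  grC_eq_bot (by norm_num) (dC_mem_grC A hv)

lemma eq_zero_of_mem_degC {X : Type u} {v : List X →₀ M} {n : ℤ} (hn : n ≤ 1)
    (hv : v ∈ grC R X M n) (hd : v ∈ degC R X M) : v = 0 :=
  Finsupp.ext fun l => by
    by_contra h
    have h1 := mem_supported_iff.1 hv l h
    have h2 := mem_supported_iff.1 hd l h
    rw [Set.mem_ofPred_eq] at h1 h2
    match l, h1, h2 with
    | [], _, h2 => exact not_degen_nil h2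
    | [_], _, h2 => exact not_degen_singleton h2
    | _ :: _ :: _, h1, _ => simp at h1; omega

lemma exists_eq_single_nil {X : Type u} {v : List X →₀ M} (hv : v ∈ grC R X M 0) :
    ∃ m, v = Finsupp.single [] m := by
  refine ⟨v [], Finsupp.ext fun l => ?_⟩
  cases l with
  | nil => rw [Finsupp.single_eq_same]
  | cons x l =>
    rw [Finsupp.single_eq_of_ne (by simp)]
    by_contra h
    have := mem_supported_iff.1 hv _ h
    rw [Set.mem_ofPred_eq] at this
    simp at this
    omega

/-- Above degree 1 this is the usual passage from a quasi-isomorphism to an exact cone. Degrees 0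
and 1 involve the augmentation term M, on which φ is the identity, and there the surjectivity of φ_*
on HN_0 suffices. -/
theorem coneExact_normalized (A : Action R X' M) (φ : SpindleHom X X')
    (h : ∀ n, IsIso (mapHN A φ n)) (n : ℤ) :
    ConeExact (dC (A.comap φ)) (dC A) (mapL φ.toFun (LinearMap.id : M →ₗ[R] M))
      (grC R X M) (degC R X M) (grC R X' M) (degC R X' M) n := by
  have h := fun n => (isIso_mapHN_iff A φ n).1 (h n)
  set f := mapL φ.toFun (LinearMap.id : M →ₗ[R] M) with hf
  have hfd : ∀ v, f (dC (A.comap φ) v) = dC A (f v) := mapL_comap_dC A φ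
  have hfP : ∀ v ∈ degC R X M, f v ∈ degC R X' M := fun v hv => by
    refine map_mem_of_mem_supported _ (fun l hl m => ?_) hv
    rw [hf, mapL_single]
    exact single_mem_degC (Degen.map _ hl) _
  intro b hb a ha hda hdb
  obtain hn | rfl | rfl | ⟨k, rfl⟩ : n < 0 ∨ n = 0 ∨ n = 1 ∨ ∃ k : ℕ, n = k + 2 := by
    rcases lt_or_ge n 0 with hn | hn
    · exact .inl hn
    · obtain ⟨k, rfl⟩ := Int.eq_ofNat_of_zero_le hn
      match k with
      | 0 => exact .inr (.inl rfl)
      | 1 => exact .inr (.inr (.inl rfl))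
      | k + 2 => exact .inr (.inr (.inr ⟨k, by push_cast; ring⟩))
  · obtain rfl := grC_eq_bot hn hb
    obtain rfl := grC_eq_bot (by omega) ha
    exact ⟨0, zero_mem _, 0, zero_mem _, by simp, by simp⟩
  · obtain rfl := grC_eq_bot (by norm_num) ha
    obtain ⟨m, rfl⟩ := exists_eq_single_nil hb
    have hm : Finsupp.single [] m ∈ grC R X M 0 := single_mem_grC rfl m
    refine ⟨0, zero_mem _, Finsupp.single [] m, hm, ?_, ?_⟩
    · rw [dC_eq_zero hm, add_zero]
      exact zero_mem _
    · rw [hf, mapL_single, map_zero, sub_zero]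
      simp
  · rw [sub_self] at ha
    have hb1 : b ∈ grC R X' M ((0 : ℕ) + 1) := by simpa using hb
    obtain ⟨a₁, ha₁, -, b₁, hb₁, he⟩ := (h 0).2 b hb1 (by simp)
    simp only [Nat.cast_zero, zero_add] at ha₁ hb₁
    have hdb0 : dC A b + f a = 0 := eq_zero_of_mem_degC (n := 0) (by norm_num)
      (add_mem (by simpa using dC_mem_grC A hb) (mapL_mem_grC _ _ ha)) hdb
    have he0 : dC A b₁ - (b - f a₁) = 0 := eq_zero_of_mem_degC (n := 1) le_rfl
      (sub_mem (by simpa using dC_mem_grC A hb₁) (sub_mem hb (mapL_mem_grC _ _ ha₁))) he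
    refine ⟨b₁, by simpa using hb₁, a₁, ha₁, ?_, ?_⟩
    -- This element lies in length 0, where f is injective, so it is enough that its image vanishes.
    · have h1 : f (a + dC (A.comap φ) a₁) = 0 := by
        rw [map_add, hfd, ← hdb0]
        have := congrArg (dC A) he0
        rw [map_sub, map_sub, dC_dC, map_zero, zero_sub, neg_eq_zero, sub_eq_zero] at this
        rw [this, add_comm]
      obtain ⟨m, hm⟩ := exists_eq_single_nil (v := a + dC (A.comap φ) a₁)
        (add_mem ha (by simpa using dC_mem_grC (A.comap φ) ha₁))
      rw [hm, hf, mapL_single, List.map_nil, Finsupp.single_eq_zero] at h1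
      rw [hm, show m = 0 from h1, Finsupp.single_zero]
      exact zero_mem _
    · have : b - dC A b₁ - f a₁ = 0 := by rw [← neg_eq_zero, ← he0]; abel
      rw [this]
      exact zero_mem _
  · rw [show (k : ℤ) + 2 - 1 = k + 1 by ring] at ha
    -- The image of a bounds -b, so injectivity writes a as a boundary; surjectivity one degree
    -- higher then treats the cycle b + f a₁.
    obtain ⟨a₁, ha₁, h1⟩ := (h k).1 a ha (fun _ => hda) ⟨-b, neg_mem hb, by
      have := neg_mem hdb
      rwa [neg_add, ← map_neg, ← sub_eq_add_neg] at this⟩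
    have e : (k : ℤ) + 2 = (k + 1 : ℕ) + 1 := by push_cast; ring
    have e' : (k : ℤ) + 2 + 1 = (k + 1 : ℕ) + 2 := by push_cast; ring
    obtain ⟨a₂, ha₂, hda₂, b₂, hb₂, h2⟩ := (h (k + 1)).2 (b + f a₁)
      (by rw [← e]; exact add_mem hb (mapL_mem_grC _ _ ha₁)) (fun _ => by
        have := add_mem hdb (hfP _ h1)
        rw [map_sub, hfd] at this
        rw [map_add]
        convert this using 1
        abel)
    rw [← e] at ha₂
    rw [← e'] at hb₂
    refine ⟨b₂, hb₂, a₂ - a₁, sub_mem ha₂ ha₁, ?_, ?_⟩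
    · have := sub_mem (hda₂ (Nat.succ_ne_zero _)) h1
      rw [map_sub]
      convert this using 1
      abel
    · have := neg_mem h2
      rw [map_sub]
      convert this using 1
      abel

theorem isIso_mapHD_of_coneExact (A : Action R X' M) (φ : SpindleHom X X')
    (h : ∀ n, ConeExact (dC (A.comap φ)) (dC A) (mapL φ.toFun (LinearMap.id : M →ₗ[R] M))
      (fun k => grC R X M k ⊓ degC R X M) ⊥ (fun k => grC R X' M k ⊓ degC R X' M) ⊥ n) (n : ℕ) :
    IsIso (mapHD A φ n) := by
  have mem {Y : Type u} (k : ℕ) (c : degenerate R Y M k) :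
      toL R Y M k c.1 ∈ grC R Y M (k + 1) ⊓ degC R Y M :=
    ⟨toL_mem_grC k c.1, toL_mem_degC_iff.2 c.2⟩
  have lift {Y : Type u} (k : ℕ) {w : List Y →₀ M} (hw : w ∈ grC R Y M (k + 1) ⊓ degC R Y M) :
      ∃ c : degenerate R Y M k, toL R Y M k c.1 = w := by
    obtain ⟨c, rfl⟩ := exists_toL_eq hw.1
    exact ⟨⟨c, toL_mem_degC_iff.1 hw.2⟩, rfl⟩
  have hmap (c : degenerate R X M n) :
      ((mapCD A φ).f n c : degenerate R X' M n).1 = mapChain R M φ n c.1 := rfl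
  have e : (n : ℤ) + 2 = (n + 1 : ℕ) + 1 := by push_cast; ring
  rw [mapHD, isIso_homologyMap_iff]
  refine ⟨fun (a : degenerate R X M n) ha hb => ?_, fun (b : degenerate R X' M n) hb => ?_⟩
  · obtain ⟨b, hb⟩ : ∃ b : degenerate R X' M (n + 1), (CD A).d (n + 1) n b =
      (mapCD A φ).f n a := hb
    have hb' := congrArg (fun c : degenerate R X' M n => toL R X' M n c.1) hb
    simp only [CD_d_val, hmap, ← dC_toL, ← mapL_toL] at hb'
    -- Injectivity: the pair (-b, a) is a cone cycle, and exactness gives a = d(-a').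
    obtain ⟨_, _, a', ha', h1, _⟩ := h (n + 2) (-toL R X' M (n + 1) b.1)
      (by rw [e]; exact neg_mem (mem (n + 1) b)) (toL R X M n a.1)
      (by rw [show (n : ℤ) + 2 - 1 = n + 1 by ring]; exact mem n a)
      ((Submodule.mem_bot R).2 ((CD_d_eq_zero_iff _ n a).1 ha))
      ((Submodule.mem_bot R).2 (by rw [map_neg, hb', neg_add_cancel]))
    rw [e] at ha'
    obtain ⟨c, rfl⟩ := lift (n + 1) ha'
    refine ⟨(-c : degenerate R X M (n + 1)), Subtype.ext (toL_injective (R := R) n ?_)⟩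
    rw [CD_d_val, ← dC_toL, Submodule.coe_neg, map_neg, map_neg]
    exact (eq_neg_of_add_eq_zero_left ((Submodule.mem_bot R).1 h1)).symm
  -- Surjectivity: the cone cycle (b, 0) bounds, so b is the image of the cycle a' up to a boundary.
  · obtain ⟨b', hb', a', ha', h1, h2⟩ := h (n + 1) (toL R X' M n b.1) (mem n b) 0 (zero_mem _)
      (by simp) ((Submodule.mem_bot R).2 (by
        rw [map_zero, add_zero, (CD_d_eq_zero_iff A n b).1 hb]))
    rw [show (n : ℤ) + 1 + 1 = (n + 1 : ℕ) + 1 by push_cast; ring] at hb'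
    obtain ⟨c', rfl⟩ := lift (n + 1) hb'
    obtain ⟨c, rfl⟩ := lift n ha'
    rw [zero_add, Submodule.mem_bot] at h1
    rw [Submodule.mem_bot] at h2
    refine ⟨c, (CD_d_eq_zero_iff _ n c).2 h1, c', Subtype.ext (toL_injective (R := R) n ?_)⟩
    have e' (y : degenerate R X' M n) : (b - y).1 = b.1 - y.1 := rfl
    rw [CD_d_val, ← dC_toL]
    refine Eq.trans ?_ (congrArg (toL R X' M n) (e' _).symm)
    rw [map_sub, hmap, ← mapL_toL, ← sub_eq_zero, ← neg_eq_zero, ← h2]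
    abel

end Lists

end RackHomology

theorem corollary7p2 {R : Type u} [CommRing R] {X X' : Type u} [RackHomology.Spindle X]
    [RackHomology.Spindle X'] (φ : RackHomology.SpindleHom X X') {M : Type u} [AddCommGroup M]
    [Module R M] (A : RackHomology.Action R X' M)
    (hX : ∀ n : ℕ, CategoryTheory.IsIso (RackHomology.mapHNTrivial R φ n))
    (hM : ∀ n : ℕ, CategoryTheory.IsIso (RackHomology.mapHN A φ n)) :
    ∀ n : ℕ, CategoryTheory.IsIso (RackHomology.mapHD A φ n) :=
  RackHomology.isIso_mapHD_of_coneExact A φ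
    (RackHomology.coneExact_degenerate_of_normalized A φ
      -- The pullback of the trivial action is the trivial action by definition, so `hX` is an
      -- instance with coefficients R.
      (RackHomology.coneExact_normalized (RackHomology.Action.trivial R X') φ hX)
      (RackHomology.coneExact_normalized A φ hM))
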